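/- Let $-\infty\le a<b\le\infty$, with $(a,\infty]$ read as $(a,\infty)$. Let $r:(a,b]\to[0,\infty)$ be monotone and right-continuous, and let $|dr|$ be the measure on $(a,b]$ with $|dr|((p,q])=|r(q)-r(p)|$. Write $\pm=+$ and $dr=|dr|$ if $r$ is nondecreasing, and $\pm=-$ and $dr=-|dr|$ if $r$ is nonincreasing. Let $h:(a,b]\to\mathbb R$ satisfy $\int|h|\,|dr|<\infty$ and $\int h^2\,|dr|<\infty$, and put $$c=\int_a^b h\,dr,\qquad d=\int_a^b h^2\,dr,\qquad g_\pm(z)=\int_a^b\frac{h(s)}{z\,h(s)\pm1}\,dr(s)\quad(z\in i\mathbb R).$$ Let $(Y(u))_{u\ge0}$ be a Lévy process such that $Y(1)$ has law $\mu=[\gamma,\sigma^2,M]$, that is, $$\hat\mu(u)=\exp\Big(iu\gamma-\tfrac12\sigma^2u^2+\int_{\mathbb R\setminus\{0\}}\big(e^{iux}-1-\tfrac{iux}{1+x^2}\big)M(dx)\Big)$$ with a Lévy measure $M$. Suppose that the random integral $\int_{(a,b]}h(t)\,dY(r(t))$ exists, and let $\rho$ be its law. Here the integral over $(p,q]$ with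 $p,q\in(a,b]$ is the limit in probability of the elementary integrals of step functions on $(p,q]$ that converge to $h$ in $L^2((p,q],|dr|)$, and the integral over $(a,b]$ is the limit in probability of these as $p\downarrow a$ and $q\uparrow b$ (with $q=b$ if $b<\infty$). The free counterpart $\tilde\nu$ of an infinitely divisible law $\nu$ is the freely infinitely divisible probability measure whose Voiculescu transform, continued analytically to the upper half-plane and by $V(\bar z)=\overline{V(z)}$ to the lower one, satisfies $$V_{\tilde\nu}(it)=it^2\int_0^\infty\log\hat\nu(-u)\,e^{-tu}\,du\qquad(t>0),$$ where $\log\hat\nu$ is the continuous logarithm that vanishes at $0$. 1. $\rho$ has a free counterpart $\tilde\rho\in(ID,\boxplus)$. Moreover, if $$(\ast)\qquad \int_{|x|>1}\int_a^b\min(1,|h(s)x|)\,|dr(s)|\,M(dx)<\infty$$ (this always holds when $r$ is bounded), then for all $t>0$ $$V_{\tilde\rho}(it)=\gamma c\pm\frac{\sigma^2}{it}\,d+\int_{\mathbb R\setminus\{0\}}\pm x\Big[g_\pm\Big(\frac{ix}{t}\Big)-\frac{\pm c}{1+x^2}\Big]M(dx),$$ where the integral converges absolutely. 2. Let $m(dx)=\frac{x^2}{1+x^2}M(dx)$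 on $\mathbb R\setminus\{0\}$ and $m(\{0\})=\sigma^2$. Then $m$ is a finite measure and, under $(\ast)$, for all $t>0$ $$V_{\tilde\rho}(it)=\gamma c+\int_{\mathbb R}\pm\Big[g_\pm\Big(\frac{ix}{t}\Big)-\frac{\pm c}{1+x^2}\Big]\frac{1+x^2}{x}\,m(dx),$$ where the integral converges absolutely and the integrand at $x=0$ is its limit $\pm d/(it)$. 3. If $h(s)>0$ for all $s$, then $\mu$ and all the images $T_{\pm h(s)}\mu$ of $\mu$ under $x\mapsto\pm h(s)x$ have free counterparts, and for all $t>0$ $$V_{\tilde\rho}(it)=\int_a^b h(s)\,V_{\tilde\mu}\Big(\frac{\pm it}{h(s)}\Big)dr(s)=\int_a^b\pm V_{\widetilde{T_{\pm h(s)}\mu}}(it)\,dr(s).$$ For nondecreasing $r$ this reads $V_{\tilde\rho}(it)=\int_a^b h(s)V_{\tilde\mu}(it/h(s))\,dr(s)=\int_a^b V_{\widetilde{T_{h(s)}\mu}}(it)\,dr(s)$. The integrals are improper at the ends of $(a,b]$ in the same way as the random integral; they converge absolutely under $(\ast)$. -/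

import Mathlib

open MeasureTheory ProbabilityTheory Filter Set
open scoped NNReal ENNReal Topology

/-! ### The time interval `(a, b]`, time changes and Stieltjes integrals -/

/-- The real points of the interval `(a, b]`; `a = -∞` and `b = ∞` are allowed, and `(a, ∞]` is
read as `(a, ∞)`. -/
def timeSet (a b : EReal) : Set ℝ := {s | a < (s : EReal) ∧ (s : EReal) ≤ b}

instance timeSet_ordConnected (a b : EReal) : (timeSet a b).OrdConnected :=
  ⟨fun _ hx _ hy _ hz =>
    ⟨hx.1.trans_le (EReal.coe_le_coe_iff.2 hz.1), (EReal.coe_le_coe_iff.2 hz.2).trans hy.2⟩⟩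

instance timeSet_compactIcc (a b : EReal) : CompactIccSpace (timeSet a b) := by
  refine ⟨fun {x y} => ?_⟩
  rw [Subtype.isCompact_iff]
  have h : (Subtype.val '' Icc x y : Set ℝ) = Icc (x : ℝ) (y : ℝ) := by
    ext z
    constructor
    · rintro ⟨w, hw, rfl⟩
      exact hw
    · intro hz
      exact ⟨⟨z, (timeSet_ordConnected a b).out x.2 y.2 hz⟩, hz, rfl⟩
  rw [h]
  exact isCompact_Icc

/-- A time change on `(a, b]`: a nonnegative, monotone, right-continuous function `r`.  The number
`sign` is `1` when `r` is taken as a nondecreasing function and `-1` when it is taken as a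
nonincreasing one. -/
structure TimeChange (a b : EReal) where
  /-- the time change itself -/
  toFun : timeSet a b → ℝ≥0
  /-- the sign `±` -/
  sign : ℝ
  sign_eq : (sign = 1 ∧ Monotone toFun) ∨ (sign = -1 ∧ Antitone toFun)
  rightCont : ∀ s, ContinuousWithinAt toFun (Ici s) s

namespace TimeChange

variable {a b : EReal}

/-- The nondecreasing right-continuous function `± r`. -/
def stieltjes (r : TimeChange a b) : StieltjesFunction (timeSet a b) where
  toFun s := r.sign * (r.toFun s : ℝ)
  mono' := by
    intro x y hxy
    rcases r.sign_eq with ⟨h, hm⟩ | ⟨h, hm⟩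
    · have := NNReal.coe_le_coe.2 (hm hxy)
      simpa [h] using this
    · have := NNReal.coe_le_coe.2 (hm hxy)
      simpa [h] using this
  right_continuous' x :=
    continuousWithinAt_const.mul
      (NNReal.continuous_coe.continuousAt.comp_continuousWithinAt (r.rightCont x))

/-- The measure `|dr|` on `(a, b]`, with mass `|r(q) - r(p)|` on `(p, q]`; it is `dr` for
nondecreasing `r` and `-dr` for nonincreasing `r`. -/
noncomputable def absMeasure (r : TimeChange a b) : Measure (timeSet a b) := r.stieltjes.measure

/-- The Lebesgue-Stieltjes integral `∫_a^b F(s) dr(s)`. -/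
noncomputable def integral {E : Type*} [NormedAddCommGroup E] [NormedSpace ℝ E]
    (r : TimeChange a b) (F : timeSet a b → E) : E := r.sign • ∫ s, F s ∂(r.absMeasure)

/-- `L = ∫_a^b F(s) dr(s)` as an improper Stieltjes integral: `F` is integrable on every
`(p, q]` with `p, q ∈ (a, b]`, and `∫_{(p,q]} F dr → L` as `p ↓ a` and `q ↑ b` (with `q = b`
eventually if `b` is finite). -/
def HasImproperIntegral (r : TimeChange a b) (F : timeSet a b → ℂ) (L : ℂ) : Prop :=
  (∀ p q, IntegrableOn F (Ioc p q) r.absMeasure) ∧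
    Tendsto (fun pq : timeSet a b × timeSet a b =>
      r.sign • ∫ s in Ioc pq.1 pq.2, F s ∂(r.absMeasure)) (atBot ×ˢ atTop) (𝓝 L)

/-- `c = ∫_a^b h dr`. -/
noncomputable def constC (r : TimeChange a b) (h : timeSet a b → ℝ) : ℝ := r.integral h

/-- `d = ∫_a^b h² dr`. -/
noncomputable def constD (r : TimeChange a b) (h : timeSet a b → ℝ) : ℝ :=
  r.integral fun s => h s ^ 2

/-- `g_±(z) = ∫_a^b h(s) / (z h(s) ± 1) dr(s)`. -/
noncomputable def kernelG (r : TimeChange a b) (h : timeSet a b → ℝ) (z : ℂ) : ℂ :=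
  r.integral fun s => (h s : ℂ) / (z * h s + r.sign)

/-- The integrand `± x [g_±(ix/t) - (± c)/(1+x²)]` against the Lévy measure. -/
noncomputable def levyKernel (r : TimeChange a b) (h : timeSet a b → ℝ) (t x : ℝ) : ℂ :=
  r.sign * x * (r.kernelG h (Complex.I * x / t) - r.sign * r.constC h / (1 + x ^ 2))

/-- The integrand `± [g_±(ix/t) - (± c)/(1+x²)] (1+x²)/x` against the finite measure `m`, with the
value `± d/(it)` at `x = 0`. -/
noncomputable def finiteKernel (r : TimeChange a b) (h : timeSet a b → ℝ) (t x : ℝ) : ℂ :=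
  open scoped Classical in
  if x = 0 then r.sign * (r.constD h / (Complex.I * t))
  else r.sign * (r.kernelG h (Complex.I * x / t) - r.sign * r.constC h / (1 + x ^ 2))
    * ((1 + x ^ 2) / x)

/-- `∫_{|x|>1} ∫_a^b min(1, |h(s) x|) |dr(s)| M(dx) < ∞`: the double integral that arises from
`levyKernel` converges absolutely at large `x`.  For a Lévy measure `M` this always holds when `r`
is bounded, as then `|dr|` is finite. -/
def LargeJumpsConverge (r : TimeChange a b) (h : timeSet a b → ℝ) (M : Measure ℝ) : Prop :=
  ∫⁻ x in {x : ℝ | 1 < |x|},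
    ∫⁻ s, ENNReal.ofReal (min 1 |h s * x|) ∂(r.absMeasure) ∂M < ∞

end TimeChange

/-! ### Lévy processes and the random integral -/

/-- `Y` is a (càdlàg, real valued) Lévy process. -/
structure IsLevyProcess {Ω : Type*} [MeasurableSpace Ω] (Y : ℝ≥0 → Ω → ℝ) (P : Measure Ω) :
    Prop where
  measurable : ∀ t, Measurable (Y t)
  zero : ∀ᵐ ω ∂P, Y 0 ω = 0
  indep : HasIndepIncrements Y P
  stationary : ∀ s t, IdentDistrib (fun ω => Y (s + t) ω - Y s ω) (Y t) P P
  cadlag : ∀ᵐ ω ∂P, ∀ t, ContinuousWithinAt (fun u => Y u ω) (Ici t) t ∧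
    ∃ l, Tendsto (fun u => Y u ω) (𝓝[<] t) (𝓝 l)

/-- A left-continuous step function `∑ i, c i * 1_{(u i, u (i+1)]}`. -/
structure StepFunction (T : Type*) [Preorder T] where
  /-- number of steps -/
  n : ℕ
  /-- partition points -/
  u : Fin (n + 1) → T
  mono : Monotone u
  /-- values -/
  c : Fin n → ℝ

namespace StepFunction

variable {T : Type*} [Preorder T]

/-- The step function as a function. -/
noncomputable def toFun (f : StepFunction T) (s : T) : ℝ :=
  ∑ i : Fin f.n, (Ioc (f.u i.castSucc) (f.u i.succ)).indicator (fun _ => f.c i) s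

/-- The elementary integral `∑ i, c i * (Z (u (i+1)) - Z (u i))`. -/
noncomputable def integral {Ω : Type*} (f : StepFunction T) (Z : T → Ω → ℝ) (ω : Ω) : ℝ :=
  ∑ i : Fin f.n, f.c i * (Z (f.u i.succ) ω - Z (f.u i.castSucc) ω)

end StepFunction

/-- `X = ∫_{(p,q]} h(t) dY(r(t))`: `X` is the limit in probability of the elementary integrals of
step functions on `(p, q]` that converge to `h` in `L²((p, q], |dr|)`. -/
def IsIntegralOn {Ω : Type*} [MeasurableSpace Ω] (P : Measure Ω) (Y : ℝ≥0 → Ω → ℝ) {a b : EReal}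
    (r : TimeChange a b) (h : timeSet a b → ℝ) (p q : timeSet a b) (X : Ω → ℝ) : Prop :=
  ∃ f : ℕ → StepFunction (timeSet a b),
    (∀ n, p ≤ (f n).u 0 ∧ (f n).u (Fin.last _) ≤ q) ∧
    Tendsto (fun n => eLpNorm (fun s => (f n).toFun s - h s) 2 (r.absMeasure.restrict (Ioc p q)))
      atTop (𝓝 0) ∧
    TendstoInMeasure P (fun n => (f n).integral fun s => Y (r.toFun s)) atTop X

/-- `X = ∫_{(a,b]} h(t) dY(r(t))`: the integrals over `(p, q]` exist for all `p ≤ q` in `(a, b]`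
and converge to `X` in probability as `p ↓ a` and `q ↑ b` (with `q = b` eventually if `b` is
finite). -/
def IsRandomIntegral {Ω : Type*} [MeasurableSpace Ω] (P : Measure Ω) (Y : ℝ≥0 → Ω → ℝ)
    {a b : EReal} (r : TimeChange a b) (h : timeSet a b → ℝ) (X : Ω → ℝ) : Prop :=
  ∃ X' : timeSet a b → timeSet a b → Ω → ℝ,
    (∀ p q, p ≤ q → IsIntegralOn P Y r h p q (X' p q)) ∧
    TendstoInMeasure P (fun pq : timeSet a b × timeSet a b => X' pq.1 pq.2) (atBot ×ˢ atTop) X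

/-! ### Classical infinite divisibility -/

/-- `μ = [γ, σ², M]`: the Lévy-Khintchine representation with shift `γ`, Gaussian variance `σ²` and
Lévy (spectral) measure `M`. -/
structure HasLevyTriplet (μ : Measure ℝ) (γ σ2 : ℝ) (M : Measure ℝ) : Prop where
  sigma_nonneg : 0 ≤ σ2
  levy_zero : M {0} = 0
  levy_finite : ∫⁻ x, ENNReal.ofReal (min 1 (x ^ 2)) ∂M < ∞
  charFun_eq : ∀ t : ℝ, charFun μ t = Complex.exp (Complex.I * t * γ - σ2 * t ^ 2 / 2 +
    ∫ x : ℝ, (Complex.exp (Complex.I * t * x) - 1 - Complex.I * t * x / (1 + x ^ 2)) ∂M)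

/-- The measure `m` with `m(dx) = x²/(1+x²) M(dx)` off `0` and `m({0}) = σ²`. -/
noncomputable def khintchineMeasure (σ2 : ℝ) (M : Measure ℝ) : Measure ℝ :=
  (M.restrict {0}ᶜ).withDensity (fun x => ENNReal.ofReal (x ^ 2 / (1 + x ^ 2))) +
    ENNReal.ofReal σ2 • Measure.dirac 0

/-- `ψ = log φ_μ`, the continuous logarithm of the characteristic function that vanishes at `0`. -/
structure IsLogCharFun (μ : Measure ℝ) (ψ : ℝ → ℂ) : Prop where
  continuous : Continuous ψ
  zero : ψ 0 = 0
  exp_eq : ∀ u, charFun μ u = Complex.exp (ψ u)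

/-! ### Voiculescu transforms and free infinite divisibility -/

/-- The reciprocal Cauchy transform `F_ν = 1 / G_ν`, `G_ν(z) = ∫ 1/(z-x) ν(dx)`. -/
noncomputable def recipCauchy (ν : Measure ℝ) (z : ℂ) : ℂ := (∫ x : ℝ, 1 / (z - x) ∂ν)⁻¹

/-- The truncated cone `{x + iy : y > β, |x| < α y}`. -/
def stolzCone (α β : ℝ) : Set ℂ := {z | β < z.im ∧ |z.re| < α * z.im}

/-- Near infinity, `V` is the Voiculescu transform `z ↦ F_ν⁻¹(z) - z` of the probability measure
`ν`: on each truncated cone that is sufficiently far out, `V` is analytic, `z + V z` is a right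
inverse of `F_ν`, and it is the one with `z + V z = z (1 + o(1))` at infinity. -/
def IsVoiculescuGerm (ν : Measure ℝ) (V : ℂ → ℂ) : Prop :=
  ∀ α : ℝ, 0 < α → ∃ β : ℝ, 0 < β ∧ DifferentiableOn ℂ V (stolzCone α β) ∧
    (∀ z ∈ stolzCone α β, 0 < (z + V z).im ∧ recipCauchy ν (z + V z) = z) ∧
    Tendsto (fun z => V z / z) (Bornology.cobounded ℂ ⊓ 𝓟 (stolzCone α β)) (𝓝 0)

/-- `ν = κ ⊞ ⋯ ⊞ κ` (`n` terms), expressed through `V_{μ₁ ⊞ μ₂} = V_{μ₁} + V_{μ₂}`. -/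
def IsFreeConvPower (κ : Measure ℝ) (n : ℕ) (ν : Measure ℝ) : Prop :=
  ∃ V, IsVoiculescuGerm κ V ∧ IsVoiculescuGerm ν fun z => n * V z

/-- `ν ∈ (ID, ⊞)`. -/
def IsFreelyInfinitelyDivisible (ν : Measure ℝ) : Prop :=
  IsProbabilityMeasure ν ∧ ∀ n : ℕ, 0 < n →
    ∃ κ : Measure ℝ, IsProbabilityMeasure κ ∧ IsFreeConvPower κ n ν

/-- `V = V_ν` is the Voiculescu transform of `ν`, continued analytically to the upper half-plane
and by reflection to the lower half-plane. -/
structure IsVoiculescuTransform (ν : Measure ℝ) (V : ℂ → ℂ) : Prop where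
  analytic : DifferentiableOn ℂ V {z | 0 < z.im}
  germ : IsVoiculescuGerm ν V
  reflection : ∀ z : ℂ, z.im ≠ 0 → V (starRingEnd ℂ z) = starRingEnd ℂ (V z)

/-- `μ'` is the free counterpart of the (classically infinitely divisible) measure `μ`, and `V` is
its Voiculescu transform: `V(it) = i t² ∫_0^∞ log φ_μ(-u) e^{-tu} du` for `t > 0`. -/
structure IsFreeCounterpart (μ μ' : Measure ℝ) (V : ℂ → ℂ) : Prop where
  freelyID : IsFreelyInfinitelyDivisible μ'
  transform : IsVoiculescuTransform μ' V
  formula : ∃ ψ, IsLogCharFun μ ψ ∧ ∀ t : ℝ, 0 < t →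
    IntegrableOn (fun u : ℝ => ψ (-u) * Complex.exp (-(t * u))) (Ioi 0) ∧
    V (Complex.I * t) =
      Complex.I * t ^ 2 * ∫ u : ℝ in Ioi 0, ψ (-u) * Complex.exp (-(t * u))

/-! The proof has a free half and a classical half, joined by a Laplace transform.

Free half (`exists_isVoiculescuGerm`): every V(z) = γ + ∫ (1+xz)/(z-x) m(dx) with m finite is the
Voiculescu transform of a probability measure. Since V/n has the same form, this also gives free
infinite divisibility. The measure is constructed by hand. The wanted F = 1/G solves F(w) = w -
V(F(w)). For finitely supported m, the iterates K_0 = w, K_{n+1} = w - V(K_n) are reciprocals of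
resolvent entries ⟨e, (w-T)⁻¹e⟩ of Hermitian operators, by a Schur complement
(`IsResolventRecip.arrow`), so every 1/K_n is a Cauchy transform. High in the half-plane V is a
contraction and K_n(z + V z) → z. Tightness can be read off Cauchy transforms, so a limit law
exists. Analytic continuation brings the identity down to a cone that does not depend on the
support, and approximation by simple functions reaches general m.

Link: the Laplace transform of each piece of the Lévy-Khintchine exponent is explicit, and the
result is V(it) for the measure m built from (σ², M) (`laplace_levyExponent`,
`levyVoiculescu_I_mul`).

Classical half (`exists_hasLevyTriplet_of_tendsto`): the integral over (p,q] has characteristic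
function exp ∫ ψ(±hξ) |dr|. Its exponent splits into a shift, a Gaussian part and a jump part. As
the characteristic functions converge and the limit is near 1 for small ξ, the real parts bound ∬ (1
- cos(ξhx)) |dr| M(dx); averaging over ξ makes min(1, (hx)²) integrable for |dr| ⊗ M. Gaussian and
jump parts therefore converge absolutely. What remains is e^{iξΓ} with a shift Γ depending on (p,q),
and its convergence to a continuous function forces Γ itself to converge. So ρ has a Lévy triplet,
and the same three limits show that V(it) for ρ is the limit over (p,q] of the integrals of
`scaledVoiculescu` at ±h(s).

That limit is statement 3, because `scaledVoiculescu` at c is both c V(it/c) and the transform of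
the image of μ under x ↦ cx. Under (∗) the merged jump kernel is integrable on the product space,
and Fubini turns the limit into statement 1; dividing the kernel by x²/(1+x²) gives statement 2. -/

/-! ### Cauchy transforms -/

/-- The Cauchy transform `G_ν(z) = ∫ 1/(z-x) ν(dx)`. -/
noncomputable def cauchyTransform (ν : Measure ℝ) (z : ℂ) : ℂ := ∫ x : ℝ, 1 / (z - x) ∂ν

lemma sub_ofReal_ne_zero {z : ℂ} (hz : z.im ≠ 0) (x : ℝ) : z - x ≠ 0 := by
  intro h
  apply hz
  have := congrArg Complex.im h
  simpa using this

lemma im_le_norm_sub_ofReal (z : ℂ) (x : ℝ) : |z.im| ≤ ‖z - x‖ := by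
  simpa using Complex.abs_im_le_norm (z - x)

lemma norm_one_div_sub_le {z : ℂ} (hz : 0 < z.im) (x : ℝ) : ‖1 / (z - x)‖ ≤ 1 / z.im := by
  rw [norm_div, norm_one]
  exact one_div_le_one_div_of_le hz ((le_abs_self _).trans (im_le_norm_sub_ofReal z x))

lemma measurable_one_div_sub (z : ℂ) : Measurable fun x : ℝ => 1 / (z - x) := by fun_prop

lemma integrable_one_div_sub {ν : Measure ℝ} [IsFiniteMeasure ν] {z : ℂ} (hz : 0 < z.im) :
    Integrable (fun x : ℝ => 1 / (z - x)) ν :=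
  .of_bound (measurable_one_div_sub z).aestronglyMeasurable (1 / z.im)
    (ae_of_all _ (norm_one_div_sub_le hz))

lemma norm_cauchyTransform_sub_le {ν : Measure ℝ} [IsProbabilityMeasure ν] {z w : ℂ}
    (hz : 0 < z.im) (hw : 0 < w.im) :
    ‖cauchyTransform ν z - cauchyTransform ν w‖ ≤ ‖z - w‖ * (1 / z.im * (1 / w.im)) := by
  unfold cauchyTransform
  rw [← integral_sub (integrable_one_div_sub hz) (integrable_one_div_sub hw)]
  refine (norm_integral_le_of_norm_le_const (C := ‖z - w‖ * (1 / z.im * (1 / w.im)))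
    (ae_of_all _ fun x => ?_)).trans (by simp)
  have h1 := sub_ofReal_ne_zero hz.ne' x
  have h2 := sub_ofReal_ne_zero hw.ne' x
  have : 1 / (z - x) - 1 / (w - x) = (w - z) * (1 / (z - x) * (1 / (w - x))) := by
    field_simp; ring
  rw [this, norm_mul, norm_mul, norm_sub_rev]
  gcongr
  · exact norm_one_div_sub_le hz x
  · exact norm_one_div_sub_le hw x

lemma im_one_div_sub (z : ℂ) (x : ℝ) :
    (1 / (z - x)).im = -z.im / ((z.re - x) ^ 2 + z.im ^ 2) := by
  rw [one_div, Complex.inv_im, Complex.normSq_apply]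
  simp [pow_two]

/-- With y = im z, the function 1 + y im(1/(z-x)) = (re z - x)²/((re z - x)² + y²) is nonnegative
and at least 1/2 once |re z - x| ≥ y; Markov's inequality then controls the tail. -/
lemma measureReal_abs_gt_le_cauchyTransform {ν : Measure ℝ} [IsProbabilityMeasure ν] {z : ℂ}
    (hz : 0 < z.im) :
    ν.real {x | |z.re| + z.im < |x|} ≤ 2 * (1 + z.im * (cauchyTransform ν z).im) := by
  have hint := integrable_one_div_sub (ν := ν) hz
  have him : Integrable (fun x : ℝ => (1 / (z - x)).im) ν := hint.im
  have h1 : 1 + z.im * (cauchyTransform ν z).im = ∫ x : ℝ, (1 + z.im * (1 / (z - x)).im) ∂ν := by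
    have := integral_im hint
    simp only [RCLike.im_to_complex] at this
    rw [integral_add (integrable_const 1) (him.const_mul _), integral_const_mul, this]
    simp [cauchyTransform]
  have hnn : ∀ x : ℝ, 0 ≤ 1 + z.im * (1 / (z - x)).im := fun x => by
    rw [im_one_div_sub]
    have : 0 < (z.re - x) ^ 2 + z.im ^ 2 := by positivity
    have h : 1 + z.im * (-z.im / ((z.re - x) ^ 2 + z.im ^ 2))
        = (z.re - x) ^ 2 / ((z.re - x) ^ 2 + z.im ^ 2) := by field_simp; ring
    rw [h]; positivity
  have hm := mul_meas_ge_le_integral_of_nonneg (ae_of_all ν hnn)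
    ((integrable_const 1).add (him.const_mul z.im)) (1 / 2)
  rw [h1]
  have hsub : {x : ℝ | |z.re| + z.im < |x|} ⊆ {x | 1 / 2 ≤ 1 + z.im * (1 / (z - x)).im} := by
    intro x hx
    simp only [mem_ofPred_eq] at hx ⊢
    rw [im_one_div_sub]
    have hpos : 0 < (z.re - x) ^ 2 + z.im ^ 2 := by positivity
    have h : 1 + z.im * (-z.im / ((z.re - x) ^ 2 + z.im ^ 2))
        = (z.re - x) ^ 2 / ((z.re - x) ^ 2 + z.im ^ 2) := by field_simp; ring
    rw [h, le_div_iff₀ hpos]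
    have h3 : z.im ≤ |z.re - x| := by
      have := abs_sub_abs_le_abs_sub x z.re
      rw [abs_sub_comm] at this
      linarith
    have h4 : z.im ^ 2 ≤ (z.re - x) ^ 2 := by
      rw [← sq_abs (z.re - x)]; gcongr
    linarith
  have := measureReal_mono (μ := ν) hsub
  linarith

/-- The tail estimate turns `htight` into tightness, Prokhorov gives a weak cluster point, and x ↦
1/(w-x) is bounded and continuous. The points w may form any set, so uniqueness of the limit plays
no role. -/
lemma exists_of_tendsto_cauchyTransform {ι : Type*} (ν : ℕ → Measure ℝ)
    [∀ n, IsProbabilityMeasure (ν n)] (w g : ι → ℂ) (hw : ∀ i, 0 < (w i).im)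
    (hlim : ∀ i, Tendsto (fun n => cauchyTransform (ν n) (w i)) atTop (𝓝 (g i)))
    (htight : ∀ ε : ℝ, 0 < ε → ∃ i, 1 + (w i).im * (g i).im < ε) :
    ∃ ν' : Measure ℝ, IsProbabilityMeasure ν' ∧ ∀ i, cauchyTransform ν' (w i) = g i := by
  have ht : IsTightMeasureSet (range ν) := by
    apply isTightMeasureSet_range_of_tendsto_limsup_measure_norm_gt
    rw [ENNReal.tendsto_atTop_zero]
    intro ε hε
    obtain ⟨δ, hδ0, hδ⟩ : ∃ δ : ℝ, 0 < δ ∧ ENNReal.ofReal (2 * δ) ≤ ε := by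
      rcases eq_or_ne ε ∞ with rfl | hε'
      · exact ⟨1, one_pos, le_top⟩
      · refine ⟨ε.toReal / 2, half_pos (ENNReal.toReal_pos hε.ne' hε'), ?_⟩
        rw [mul_div_cancel₀ _ two_ne_zero, ENNReal.ofReal_toReal hε']
    obtain ⟨i, hi⟩ := htight δ hδ0
    refine ⟨|(w i).re| + (w i).im, fun R hR => le_trans ?_ hδ⟩
    refine limsup_le_of_le (h := ?_)
    have hev : ∀ᶠ n in atTop, 1 + (w i).im * (cauchyTransform (ν n) (w i)).im < δ :=
      (((Complex.continuous_im.tendsto _).comp (hlim i)).const_mul _ |>.const_add 1).eventually_lt_const hi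
    filter_upwards [hev] with n hn
    have h1 := measureReal_abs_gt_le_cauchyTransform (ν := ν n) (hw i)
    rw [← ofReal_measureReal]
    apply ENNReal.ofReal_le_ofReal
    refine (measureReal_mono ?_).trans (h1.trans (by linarith))
    intro x hx
    simp only [mem_ofPred_eq, Real.norm_eq_abs] at hx ⊢
    linarith
  let N : ℕ → ProbabilityMeasure ℝ := fun n => ⟨ν n, inferInstance⟩
  have hc : IsCompact (closure (range N)) := by
    apply isCompact_closure_of_isTightMeasureSet
    convert ht using 1
    ext κ
    constructor
    · rintro ⟨_, ⟨n, rfl⟩, rfl⟩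
      exact ⟨n, rfl⟩
    · rintro ⟨n, rfl⟩
      exact ⟨N n, ⟨n, rfl⟩, rfl⟩
  obtain ⟨κ, -, hκ⟩ := hc.exists_mapClusterPt (f := atTop) (u := N)
    (tendsto_principal.2 (Eventually.of_forall fun n => subset_closure (mem_range_self n)))
  -- Along a finer ultrafilter the cluster point is a genuine limit, and the limits assumed in
  -- `hlim` persist.
  obtain ⟨U, hU, hUκ⟩ := mapClusterPt_iff_ultrafilter.1 hκ
  refine ⟨κ, inferInstance, fun i => ?_⟩
  have hb := (ProbabilityMeasure.tendsto_iff_forall_integral_rclike_tendsto ℂ).1 hUκ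
    (BoundedContinuousFunction.ofNormedAddCommGroup (fun x : ℝ => 1 / (w i - x))
      (continuous_const.div (by fun_prop) fun x => sub_ofReal_ne_zero (hw i).ne' x) (1 / (w i).im)
      (norm_one_div_sub_le (hw i)))
  exact tendsto_nhds_unique hb ((hlim i).mono_left hU)

/-! ### Reciprocal Cauchy transforms from finite-dimensional self-adjoint operators -/

/-- `1/K(w) = ⟨e, (w-T)⁻¹ e⟩` on the upper half-plane, for a symmetric operator `T` and a unit vector
`e` of a finite-dimensional space. -/
def IsResolventRecip (K : ℂ → ℂ) : Prop :=
  ∃ (E : Type) (_ : NormedAddCommGroup E) (_ : InnerProductSpace ℂ E) (_ : FiniteDimensional ℂ E)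
    (T : E →ₗ[ℂ] E) (e : E), T.IsSymmetric ∧ ‖e‖ = 1 ∧ ∀ w : ℂ, 0 < w.im →
      0 < (K w).im ∧ ∃ v, w • v - T v = e ∧ K w * inner ℂ e v = 1

/-- The spectral measure of T at e: mass |⟨b_i, e⟩|² at the i-th eigenvalue, of total mass 1 by
Parseval. -/
lemma IsResolventRecip.exists_measure {K : ℂ → ℂ} (hK : IsResolventRecip K) :
    ∃ ν : Measure ℝ, IsProbabilityMeasure ν ∧ ∀ w : ℂ, 0 < w.im → K w * cauchyTransform ν w = 1 := by
  obtain ⟨E, _, _, _, T, e, hT, he, hv⟩ := hK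
  set b := hT.eigenvectorBasis rfl with hb
  set l := hT.eigenvalues rfl with hl
  refine ⟨∑ i, ENNReal.ofReal (‖inner ℂ (b i) e‖ ^ 2) • Measure.dirac (l i), ⟨?_⟩, fun w hw => ?_⟩
  · simp only [Measure.coe_finsetSum, Finset.sum_apply, Measure.smul_apply, measure_univ, smul_eq_mul,
      mul_one]
    rw [← ENNReal.ofReal_sum_of_nonneg (fun _ _ => by positivity), b.sum_sq_norm_inner_right, he]
    simp
  · obtain ⟨-, v, hv, hKv⟩ := hv w hw
    rw [← hKv]
    congr 1
    unfold cauchyTransform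
    rw [integral_finsetSum_measure fun i _ =>
      (integrable_dirac (by simp)).smul_measure ENNReal.ofReal_ne_top]
    simp only [integral_smul_measure, integral_dirac]
    rw [← b.sum_inner_mul_inner]
    refine Finset.sum_congr rfl fun i _ => ?_
    have h1 : (w - l i) * inner ℂ (b i) v = inner ℂ (b i) e := by
      rw [← hv, inner_sub_right, inner_smul_right, ← hT, hT.apply_eigenvectorBasis, inner_smul_left]
      simp
      ring
    have h0 := sub_ofReal_ne_zero hw.ne' (l i)
    have h2 : inner ℂ (b i) v = inner ℂ (b i) e / (w - l i) := by
      rw [← h1]; field_simp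
    have h3 : inner ℂ e (b i) * inner ℂ (b i) e = ((‖inner ℂ (b i) e‖ ^ 2 : ℝ) : ℂ) := by
      rw [← inner_conj_symm, Complex.conj_mul']
      simp
    rw [h2, ← mul_div_assoc, h3, ENNReal.toReal_ofReal (by positivity), Complex.real_smul]
    ring

lemma IsResolventRecip.im_pos {K : ℂ → ℂ} (hK : IsResolventRecip K) {w : ℂ} (hw : 0 < w.im) :
    0 < (K w).im := by
  obtain ⟨E, _, _, _, T, e, hT, he, hv⟩ := hK
  exact (hv w hw).1

lemma IsResolventRecip.congr {K K' : ℂ → ℂ} (hK : IsResolventRecip K)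
    (h : ∀ w : ℂ, 0 < w.im → K w = K' w) : IsResolventRecip K' := by
  obtain ⟨E, i1, i2, i3, T, e, hT, he, hv⟩ := hK
  refine ⟨E, i1, i2, i3, T, e, hT, he, fun w hw => ?_⟩
  rw [← h w hw]
  exact hv w hw

lemma isResolventRecip_id : IsResolventRecip fun w => w := by
  refine ⟨ℂ, inferInstance, inferInstance, inferInstance, 0, 1, LinearMap.IsSymmetric.zero, by simp,
    fun w hw => ⟨hw, 1 / w, ?_, ?_⟩⟩
  · have : w ≠ 0 := by rintro rfl; simp at hw
    simp [this]
  · have : w ≠ 0 := by rintro rfl; simp at hw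
    simp [this]

lemma im_div_sub_nonpos {z : ℂ} (hz : 0 < z.im) {q : ℝ} (hq : 0 ≤ q) (x : ℝ) :
    ((q : ℂ) / (z - x)).im ≤ 0 := by
  have : (q : ℂ) / (z - x) = q * (1 / (z - x)) := by ring
  rw [this, Complex.im_ofReal_mul, im_one_div_sub]
  exact mul_nonpos_of_nonneg_of_nonpos hq
    (div_nonpos_of_nonpos_of_nonneg (by linarith) (by positivity))

section Arrow

variable {ι : Type} [Fintype ι] {E : Type} [NormedAddCommGroup E] [InnerProductSpace ℂ E]

/-- The self-adjoint "arrow" operator on `ℂ ⊕ E^ι` with corner `a`, first row `(√q_i e^*)_i`, and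
diagonal blocks `T + x_i e e^*`. -/
noncomputable def arrowOperator (T : E →ₗ[ℂ] E) (e : E) (a : ℝ) (q x : ι → ℝ) :
    WithLp 2 (ℂ × PiLp 2 (fun _ : ι => E)) →ₗ[ℂ] WithLp 2 (ℂ × PiLp 2 (fun _ : ι => E)) where
  toFun v := WithLp.toLp 2 (a * v.fst + ∑ i, (√(q i) : ℂ) * inner ℂ e (v.snd i),
    WithLp.toLp 2 fun i => T (v.snd i) + ((x i : ℂ) * inner ℂ e (v.snd i) + (√(q i) : ℂ) * v.fst) • e)
  map_add' u v := by
    apply WithLp.ofLp_injective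
    ext
    · simp [mul_add, Finset.sum_add_distrib]; ring
    · simp [mul_add, add_smul]; abel
  map_smul' c v := by
    apply WithLp.ofLp_injective
    ext
    · simp [mul_add, Finset.mul_sum, mul_left_comm]
    · simp [mul_add, smul_smul]; ring_nf

lemma arrowOperator_isSymmetric {T : E →ₗ[ℂ] E} (hT : T.IsSymmetric) (e : E) (a : ℝ)
    (q x : ι → ℝ) : (arrowOperator T e a q x).IsSymmetric := by
  rintro ⟨u₀, ⟨u⟩⟩ ⟨v₀, ⟨v⟩⟩
  simp only [arrowOperator, LinearMap.coe_mk, AddHom.coe_mk, WithLp.prod_inner_apply,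
    PiLp.inner_apply, inner_add_left, inner_add_right, inner_smul_left, inner_smul_right, hT _ _,
    Finset.sum_add_distrib, map_add, map_mul, Complex.conj_ofReal, inner_conj_symm, RCLike.inner_apply, map_sum, WithLp.toLp_fst, WithLp.toLp_snd]
  simp only [mul_add, add_mul, Finset.mul_sum, Finset.sum_mul, Finset.sum_add_distrib]
  ring_nf
  rw [show ∑ i, (x i : ℂ) * inner ℂ (u i) e * inner ℂ e (v i)
      = ∑ i, (x i : ℂ) * inner ℂ e (v i) * inner ℂ (u i) e from
    Finset.sum_congr rfl fun i _ => by ring]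
  ring

/-- Schur complement. Writing v = (w-T)⁻¹e, the rank-one perturbation satisfies (w - T - x e e^*)⁻¹e
= K/(K-x) v, whose e-entry is 1/(K-x). Eliminating the blocks of the arrow operator leaves w - a - ∑
q_i/(K - x_i) in the corner. -/
lemma IsResolventRecip.arrow {K : ℂ → ℂ} (hK : IsResolventRecip K) (a : ℝ) (q x : ι → ℝ)
    (hq : ∀ i, 0 ≤ q i) : IsResolventRecip fun w => w - a - ∑ i, q i / (K w - x i) := by
  obtain ⟨E, _, _, _, T, e, hT, he, hv⟩ := hK
  refine ⟨_, inferInstance, inferInstance, inferInstance, arrowOperator T e a q x,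
    WithLp.toLp 2 (1, 0), arrowOperator_isSymmetric hT e a q x, ?_, fun w hw => ?_⟩
  · simp
  obtain ⟨hKw, v, hv, hKv⟩ := hv w hw
  set K' : ℂ := w - a - ∑ i, q i / (K w - x i) with hK'
  have him : 0 < K'.im := by
    have : (∑ i, (q i : ℂ) / (K w - x i)).im ≤ 0 := by
      rw [Complex.im_sum]
      exact Finset.sum_nonpos fun i _ => im_div_sub_nonpos hKw (hq i) (x i)
    simp only [hK', Complex.sub_im, Complex.ofReal_im]
    linarith
  have hK0 : K' ≠ 0 := by rintro h; simp [h] at him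
  have hKx := fun i => sub_ofReal_ne_zero hKw.ne' (x i)
  have hKne : K w ≠ 0 := by rintro h; simp [h] at hKw
  have hev : inner ℂ e v = 1 / K w := by rw [← hKv]; field_simp
  -- The solution of the arrow system with right-hand side (1, 0): corner 1/K', and in block i the
  -- source √q_i/K' times the perturbed resolvent vector K/(K - x_i) v.
  refine ⟨him, WithLp.toLp 2 (1 / K', WithLp.toLp 2 fun i =>
    ((√(q i) : ℂ) * (1 / K') * (K w / (K w - x i))) • v), ?_, ?_⟩
  · have hTv : T v = w • v - e := by rw [← hv]; abel
    apply WithLp.ofLp_injective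
    ext i
    · simp [arrowOperator, hev]
      have h1 : ∀ i, (√(q i) : ℂ) * (√(q i) * K'⁻¹ * (K w / (K w - x i)) * (K w)⁻¹)
          = q i / (K w - x i) * K'⁻¹ := fun i => by
        have : (√(q i) : ℂ) * √(q i) = q i := by
          rw [← Complex.ofReal_mul, Real.mul_self_sqrt (hq i)]
        rw [← this]
        have := hKx i
        field_simp
      simp_rw [h1, ← Finset.sum_mul]
      rw [← add_mul, ← sub_mul, ← sub_sub, ← hK', mul_inv_cancel₀ hK0]
    · simp [arrowOperator, hev, hTv]
      rw [smul_smul, smul_sub, smul_smul]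
      have h2 : (x i : ℂ) * (√(q i) * K'⁻¹ * (K w / (K w - x i)) * (K w)⁻¹) + √(q i) * K'⁻¹
          = √(q i) * K'⁻¹ * (K w / (K w - x i)) := by
        have := hKx i
        field_simp
        ring
      rw [h2, mul_comm w]
      abel
  · change K' * _ = 1
    simp [WithLp.prod_inner_apply, hK0]

end Arrow

/-! ### The kernel `(1 + xz)/(z - x)` -/

/-- The kernel `(1 + xz)/(z - x)` of the free Lévy-Khintchine formula. -/
noncomputable def nevKernel (z : ℂ) (x : ℝ) : ℂ := (1 + x * z) / (z - x)

/-- A constant plus a positive multiple of 1/(z-x): exactly the shape that the arrow construction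
produces. -/
lemma nevKernel_eq {z : ℂ} (hz : z.im ≠ 0) (x : ℝ) :
    nevKernel z x = x + ((1 + x ^ 2 : ℝ) : ℂ) / (z - x) := by
  have := sub_ofReal_ne_zero hz x
  rw [nevKernel]; push_cast; field_simp; ring

lemma measurable_nevKernel (z : ℂ) : Measurable (nevKernel z) := by
  unfold nevKernel; fun_prop

lemma im_nevKernel_nonpos {z : ℂ} (hz : 0 < z.im) (x : ℝ) : (nevKernel z x).im ≤ 0 := by
  rw [nevKernel_eq hz.ne', Complex.add_im, Complex.ofReal_im, zero_add]
  exact im_div_sub_nonpos hz (by positivity) x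

lemma nevKernel_sub {z w : ℂ} (hz : z.im ≠ 0) (hw : w.im ≠ 0) (x : ℝ) :
    nevKernel z x - nevKernel w x
      = ((1 + x ^ 2 : ℝ) : ℂ) * (w - z) * (1 / (z - x) * (1 / (w - x))) := by
  have h1 := sub_ofReal_ne_zero hz x
  have h2 := sub_ofReal_ne_zero hw x
  rw [nevKernel_eq hz, nevKernel_eq hw]
  field_simp
  ring

lemma nevKernel_conj (z : ℂ) (x : ℝ) :
    nevKernel (starRingEnd ℂ z) x = starRingEnd ℂ (nevKernel z x) := by
  simp [nevKernel]

/-- Splits the kernel as 1/(z-x) + z · x/(z-x). In the cone |x| ≤ |z| + |z-x| and |z| ≤ (1+α)|z-x|,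
which gives the bounded alternative of the minimum; the other one makes the bound on the quotient by
|z| vanish as im z → ∞ for each fixed x. Dominated convergence then needs no moments of m. -/
lemma norm_nevKernel_le {α : ℝ} {z : ℂ} (hz : 0 < z.im) (hα : |z.re| ≤ α * z.im) (x : ℝ) :
    ‖nevKernel z x‖ ≤ ‖z‖ * (1 / z.im ^ 2 + min (2 + α) (|x| / z.im)) := by
  have h0 := sub_ofReal_ne_zero hz.ne' x
  have him : z.im ≤ ‖z‖ := (le_abs_self _).trans (Complex.abs_im_le_norm z)
  have h1 : nevKernel z x = 1 / (z - x) + z * (x / (z - x)) := by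
    rw [nevKernel]; field_simp
  have h2 : ‖(1 : ℂ) / (z - x)‖ ≤ ‖z‖ * (1 / z.im ^ 2) := by
    refine (norm_one_div_sub_le hz x).trans ?_
    calc 1 / z.im = z.im * (1 / z.im ^ 2) := by field_simp
      _ ≤ _ := by gcongr
  have hd : z.im ≤ ‖z - x‖ := (le_abs_self _).trans (im_le_norm_sub_ofReal z x)
  have hd0 : 0 < ‖z - x‖ := hz.trans_le hd
  have h3 : ‖(x : ℂ) / (z - x)‖ ≤ min (2 + α) (|x| / z.im) := by
    rw [norm_div, Complex.norm_real, Real.norm_eq_abs]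
    refine le_min ?_ (by gcongr)
    rw [div_le_iff₀ hd0]
    have hα0 : 0 ≤ α := by
      by_contra h
      have := abs_nonneg z.re
      nlinarith
    have h4 : |x| ≤ ‖z‖ + ‖z - x‖ := by
      have := norm_sub_le z (z - x)
      rw [sub_sub_cancel, Complex.norm_real, Real.norm_eq_abs] at this
      exact this
    have h5 : ‖z‖ ≤ (1 + α) * ‖z - x‖ := by
      calc ‖z‖ ≤ |z.re| + |z.im| := Complex.norm_le_abs_re_add_abs_im z
        _ ≤ α * z.im + z.im := by rw [abs_of_pos hz]; gcongr
        _ = (1 + α) * z.im := by ring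
        _ ≤ _ := by gcongr
    linarith
  rw [h1]
  calc _ ≤ ‖(1 : ℂ) / (z - x)‖ + ‖z * (x / (z - x))‖ := norm_add_le _ _
    _ ≤ ‖z‖ * (1 / z.im ^ 2) + ‖z‖ * min (2 + α) (|x| / z.im) := by
      rw [norm_mul z]; gcongr
    _ = _ := by ring

lemma norm_nevKernel_le_const {z : ℂ} (hz : 0 < z.im) (x : ℝ) :
    ‖nevKernel z x‖ ≤ ‖z‖ * (1 / z.im ^ 2 + (2 + |z.re| / z.im)) := by
  refine (norm_nevKernel_le (α := |z.re| / z.im) hz (by field_simp; rfl) x).trans ?_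
  gcongr
  exact min_le_left _ _

/-! ### Voiculescu transforms of finitely supported data -/

section Finite

variable {ι : Type} [Fintype ι]

/-- Fixed-point iteration for F(w) = w - V(F(w)): every iterate is a resolvent reciprocal by
`IsResolventRecip.arrow`, and at w = z + V z the iterates converge geometrically to the fixed point
z. -/
lemma exists_cauchyTransform_of_finite (γ : ℝ) (p x : ι → ℝ) (hp : ∀ i, 0 ≤ p i) :
    ∃ ν : Measure ℝ, IsProbabilityMeasure ν ∧ ∃ β : ℝ, 0 < β ∧ ∀ z : ℂ, 0 < z.im →
      β ≤ (z + (γ + ∑ i, p i * nevKernel z (x i))).im →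
        cauchyTransform ν (z + (γ + ∑ i, p i * nevKernel z (x i))) = 1 / z := by
  set V : ℂ → ℂ := fun z => γ + ∑ i, p i * nevKernel z (x i) with hV
  set Q : ℝ := ∑ i, p i * (1 + x i ^ 2) with hQ
  have hQ0 : 0 ≤ Q := Finset.sum_nonneg fun i _ => mul_nonneg (hp i) (by positivity)
  -- On im ≥ β the function V has Lipschitz constant Q/β², and this β makes it at most 1/2.
  set β : ℝ := 1 + 2 * Q with hβ
  have hβ0 : 0 < β := by linarith
  have hVim : ∀ z : ℂ, 0 < z.im → (V z).im ≤ 0 := fun z hz => by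
    simp only [hV, Complex.add_im, Complex.ofReal_im, zero_add, Complex.im_sum,
      Complex.im_ofReal_mul]
    exact Finset.sum_nonpos fun i _ =>
      mul_nonpos_of_nonneg_of_nonpos (hp i) (im_nevKernel_nonpos hz _)
  have hVlip : ∀ z w : ℂ, β ≤ z.im → β ≤ w.im → ‖V z - V w‖ ≤ 1 / 2 * ‖z - w‖ := by
    intro z w hz hw
    have hz0 := hβ0.trans_le hz
    have hw0 := hβ0.trans_le hw
    have : V z - V w = ∑ i, p i * (nevKernel z (x i) - nevKernel w (x i)) := by
      simp only [hV, mul_sub, Finset.sum_sub_distrib]; ring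
    rw [this]
    calc _ ≤ ∑ i, p i * ((1 + x i ^ 2) * ‖z - w‖ * (1 / β * (1 / β))) := by
          refine norm_sum_le_of_le _ fun i _ => ?_
          rw [norm_mul, Complex.norm_real, Real.norm_of_nonneg (hp i),
            nevKernel_sub hz0.ne' hw0.ne', norm_mul, norm_mul, norm_mul, Complex.norm_real,
            Real.norm_of_nonneg (by positivity), norm_sub_rev w z]
          have := hp i
          gcongr
          · exact (norm_one_div_sub_le hz0 _).trans (by gcongr)
          · exact (norm_one_div_sub_le hw0 _).trans (by gcongr)
      _ = Q * (1 / β * (1 / β)) * ‖z - w‖ := by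
          rw [hQ, Finset.sum_mul, Finset.sum_mul]
          exact Finset.sum_congr rfl fun i _ => by ring
      _ ≤ _ := by
          gcongr
          rw [one_div_mul_one_div, mul_one_div, div_le_iff₀ (by positivity)]
          nlinarith
  let K : ℕ → ℂ → ℂ := fun n => (fun k w => w - V (k w))^[n] fun w => w
  have hKs : ∀ n w, K (n + 1) w = w - V (K n w) := fun n w => by
    simp only [K, Function.iterate_succ_apply']
  have hK : ∀ n, IsResolventRecip (K n) := by
    intro n
    induction n with
    | zero => exact isResolventRecip_id
    | succ n ih =>
      have h := ih.arrow (γ + ∑ i, p i * x i) (fun i => p i * (1 + x i ^ 2)) x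
        fun i => mul_nonneg (hp i) (by positivity)
      refine h.congr fun w hw => ?_
      have him := (ih.im_pos hw).ne'
      rw [hKs]
      have he : ∀ i, (p i : ℂ) * nevKernel (K n w) (x i)
          = p i * x i + ((p i * (1 + x i ^ 2) : ℝ) : ℂ) / (K n w - x i) := fun i => by
        rw [nevKernel_eq him]; push_cast; ring
      simp only [hV, he, Finset.sum_add_distrib, Complex.ofReal_add, Complex.ofReal_sum,
        Complex.ofReal_mul]
      ring
  choose ν hν hνK using fun n => (hK n).exists_measure
  -- Because im V ≤ 0, the iteration never loses height and so stays where V is a contraction.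
  have hKim : ∀ n w, 0 < w.im → w.im ≤ (K n w).im := by
    intro n w hw
    induction n with
    | zero => exact le_rfl
    | succ n ih =>
      rw [hKs, Complex.sub_im]
      have := hVim (K n w) (hw.trans_le ih)
      linarith
  have hconv : ∀ z : ℂ, 0 < z.im → β ≤ (z + V z).im →
      Tendsto (fun n => K n (z + V z)) atTop (𝓝 z) := by
    intro z hz hβz
    have hzβ : β ≤ z.im := by
      have := hVim z hz
      rw [Complex.add_im] at hβz
      linarith
    have hb : ∀ n, ‖K n (z + V z) - z‖ ≤ (1 / 2) ^ n * ‖V z‖ := by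
      intro n
      induction n with
      | zero => simp [K]
      | succ n ih =>
        have h1 : K (n + 1) (z + V z) - z = -(V (K n (z + V z)) - V z) := by rw [hKs]; ring
        rw [h1, norm_neg, pow_succ']
        refine (hVlip _ _ (hβz.trans (hKim n _ (hβ0.trans_le hβz))) hzβ).trans ?_
        nlinarith
    rw [tendsto_iff_norm_sub_tendsto_zero]
    refine squeeze_zero (fun _ => norm_nonneg _) hb ?_
    simpa using (tendsto_pow_atTop_nhds_zero_of_lt_one (r := (1 / 2 : ℝ)) (by norm_num)
      (by norm_num)).mul_const ‖V z‖
  suffices h : ∃ ν' : Measure ℝ, IsProbabilityMeasure ν' ∧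
      ∀ z : {z : ℂ // 0 < z.im ∧ β ≤ (z + V z).im}, cauchyTransform ν' (z + V z) = 1 / (z : ℂ) by
    obtain ⟨ν', hν', hνeq⟩ := h
    exact ⟨ν', hν', β, hβ0, fun z hz hβz => hνeq ⟨z, hz, hβz⟩⟩
  refine exists_of_tendsto_cauchyTransform ν _ _ (fun z => hβ0.trans_le z.2.2)
    (fun z => ?_) fun ε hε => ?_
  · have hz0 : (z : ℂ) ≠ 0 := by
      intro h
      have := z.2.1
      simp [h] at this
    have := (hconv z z.2.1 z.2.2).inv₀ hz0
    rw [one_div]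
    refine this.congr fun n => ?_
    exact inv_eq_of_mul_eq_one_right (hνK n _ (hβ0.trans_le z.2.2))
  -- At z = iy one has |im V| ≤ Q/y ≤ Q. The summand β + Q keeps im(z + V z) above β; Q/ε makes the
  -- tightness quantity -im V(iy)/y smaller than ε.
  · set y : ℝ := β + Q + 1 + Q / ε with hy
    have hQε : 0 ≤ Q / ε := by positivity
    have hy1 : 1 ≤ y := by linarith
    have hy0 : 0 < y := by linarith
    have hVy : -(Q / y) ≤ (V (Complex.I * y)).im := by
      have hz : (0 : ℝ) < (Complex.I * y).im := by simpa using hy0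
      simp only [hV, Complex.add_im, Complex.ofReal_im, zero_add, Complex.im_sum,
        Complex.im_ofReal_mul, hQ, Finset.sum_div, ← Finset.sum_neg_distrib]
      refine Finset.sum_le_sum fun i _ => ?_
      rw [mul_div_assoc, ← mul_neg]
      refine mul_le_mul_of_nonneg_left ?_ (hp i)
      rw [nevKernel_eq hz.ne', Complex.add_im, Complex.ofReal_im, zero_add]
      refine neg_le_of_abs_le ((Complex.abs_im_le_norm _).trans ?_)
      rw [norm_div, Complex.norm_real, Real.norm_of_nonneg (by positivity)]
      gcongr
      simpa [abs_of_pos hy0] using im_le_norm_sub_ofReal (Complex.I * y) (x i)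
    have hQy : Q / y ≤ Q := div_le_self hQ0 hy1
    refine ⟨⟨Complex.I * y, by simpa using hy0, ?_⟩, ?_⟩
    · simp only [Complex.add_im, Complex.mul_im, Complex.I_re, Complex.I_im, Complex.ofReal_re,
        Complex.ofReal_im]
      linarith
    · have h1 : (1 / (Complex.I * y)).im = -(1 / y) := by
        rw [one_div, mul_inv, Complex.inv_I, ← Complex.ofReal_inv, Complex.im_mul_ofReal]
        simp
      simp only [h1, Complex.add_im, Complex.mul_im, Complex.I_re, Complex.I_im, Complex.ofReal_re,
        Complex.ofReal_im]
      have h2 : 1 + (0 * 0 + 1 * y + (V (Complex.I * y)).im) * -(1 / y)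
          = -(V (Complex.I * y)).im / y := by field_simp; ring
      rw [h2, div_lt_iff₀ hy0]
      have h3 : Q < ε * y := by
        have : ε * y = ε * (β + Q + 1) + Q := by rw [hy]; field_simp
        rw [this]
        have : 0 < ε * (β + Q + 1) := by positivity
        linarith
      linarith

end Finite

/-! ### The free Lévy-Khintchine function and its probability measure -/

/-- Cauchy's estimate on small circles converts a locally uniform bound on F into one on its
derivative, so only F itself has to be estimated. -/
lemma differentiableOn_integral_of_norm_le {X : Type*} [MeasurableSpace X] {m : Measure X}
    [IsFiniteMeasure m] {U : Set ℂ} (hU : IsOpen U) {F F' : ℂ → X → ℂ}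
    (hd : ∀ z ∈ U, ∀ x, HasDerivAt (fun z => F z x) (F' z x) z)
    (hF : ∀ z ∈ U, AEStronglyMeasurable (F z) m) (hF' : ∀ z ∈ U, AEStronglyMeasurable (F' z) m)
    {B : ℂ → ℝ} (hB : ContinuousOn B U) (hle : ∀ z ∈ U, ∀ x, ‖F z x‖ ≤ B z) :
    DifferentiableOn ℂ (fun z => ∫ x, F z x ∂m) U := by
  intro z₀ hz₀
  have hBz : ∀ᶠ z in 𝓝 z₀, z ∈ U ∧ B z < B z₀ + 1 :=
    Eventually.and (hU.mem_nhds hz₀) <|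
      (hB.continuousAt (hU.mem_nhds hz₀)).eventually_lt_const (by linarith)
  obtain ⟨R, hR, hball⟩ := Metric.eventually_nhds_iff_ball.1 hBz
  have hb : ∀ x, ∀ z ∈ Metric.ball z₀ (R / 2), ‖F' z x‖ ≤ (B z₀ + 1) / (R / 4) := by
    intro x z hz
    have hsub : Metric.closedBall z (R / 4) ⊆ Metric.ball z₀ R := by
      intro w hw
      rw [Metric.mem_closedBall] at hw
      rw [Metric.mem_ball] at hz ⊢
      have := dist_triangle w z z₀
      linarith
    rw [← (hd z (hball z (hsub (Metric.mem_closedBall_self (by positivity)))).1 x).deriv]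
    refine Complex.norm_deriv_le_of_forall_mem_sphere_norm_le (by positivity) ?_ fun w hw => ?_
    · refine DifferentiableOn.diffContOnCl fun w hw => ?_
      have hw' := hsub (Metric.closure_ball_subset_closedBall hw)
      exact (hd w (hball w hw').1 x).differentiableAt.differentiableWithinAt
    · have hw' := hball w (hsub (Metric.sphere_subset_closedBall hw))
      exact (hle w hw'.1 x).trans hw'.2.le
  have := (hasDerivAt_integral_of_dominated_loc_of_deriv_le (μ := m) (F := F) (F' := F')
    (s := Metric.ball z₀ (R / 2)) (x₀ := z₀) (bound := fun _ => (B z₀ + 1) / (R / 4))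
    (Metric.ball_mem_nhds _ (by positivity))
    (by filter_upwards [hU.mem_nhds hz₀] with z hz using hF z hz)
    (.of_bound (hF z₀ hz₀) (B z₀) (ae_of_all _ (hle z₀ hz₀))) (hF' z₀ hz₀)
    (ae_of_all _ hb) (integrable_const _)
    (ae_of_all _ fun x z hz => hd z (hball z (Metric.ball_subset_ball (by linarith) hz)).1 x)).2
  exact this.differentiableAt.differentiableWithinAt

lemma isOpen_upperHalf : IsOpen {z : ℂ | 0 < z.im} := isOpen_lt continuous_const Complex.continuous_im

lemma differentiableOn_cauchyTransform (ν : Measure ℝ) [IsFiniteMeasure ν] :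
    DifferentiableOn ℂ (cauchyTransform ν) {z | 0 < z.im} := by
  refine differentiableOn_integral_of_norm_le isOpen_upperHalf
    (F' := fun z x => -1 / (z - x) ^ 2) (B := fun z => 1 / z.im) (fun z hz x => ?_)
    (fun z _ => (measurable_one_div_sub z).aestronglyMeasurable)
    (fun z _ => Measurable.aestronglyMeasurable (by fun_prop)) ?_ (fun z hz x => norm_one_div_sub_le hz x)
  · have := sub_ofReal_ne_zero (z := z) hz.ne' x
    simpa [one_div] using ((hasDerivAt_id' z).sub_const (x : ℂ)).fun_inv this
  · exact continuousOn_const.div Complex.continuous_im.continuousOn fun z hz => ne_of_gt hz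

/-- `V(z) = γ + ∫ (1 + xz)/(z - x) m(dx)`. -/
noncomputable def voiculescuFun (γ : ℝ) (m : Measure ℝ) (z : ℂ) : ℂ := γ + ∫ x, nevKernel z x ∂m

section

variable {m : Measure ℝ} [IsFiniteMeasure m]

lemma differentiableOn_voiculescuFun (γ : ℝ) :
    DifferentiableOn ℂ (voiculescuFun γ m) {z | 0 < z.im} := by
  refine (differentiableOn_const _).add ?_
  refine differentiableOn_integral_of_norm_le isOpen_upperHalf
    (F' := fun z x => (x * (z - x) - (1 + x * z)) / (z - x) ^ 2)
    (B := fun z => ‖z‖ * (1 / z.im ^ 2 + (2 + |z.re| / z.im))) (fun z hz x => ?_)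
    (fun z _ => (measurable_nevKernel z).aestronglyMeasurable)
    (fun z _ => Measurable.aestronglyMeasurable (by fun_prop)) ?_ (fun z hz x => norm_nevKernel_le_const hz x)
  · have := sub_ofReal_ne_zero (z := z) hz.ne' x
    have h := (((hasDerivAt_id' z).const_mul (x : ℂ)).const_add 1).fun_div
      ((hasDerivAt_id' z).sub_const (x : ℂ)) this
    simpa [nevKernel] using h
  · have him : ∀ z ∈ {z : ℂ | 0 < z.im}, z.im ≠ 0 := fun z hz => ne_of_gt hz
    refine continuousOn_id.norm.mul (ContinuousOn.add ?_ (continuousOn_const.add ?_))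
    · exact continuousOn_const.div (Complex.continuous_im.continuousOn.pow 2)
        fun z hz => pow_ne_zero 2 (him z hz)
    · exact Complex.continuous_re.abs.continuousOn.div Complex.continuous_im.continuousOn him

lemma voiculescuFun_conj (γ : ℝ) (m : Measure ℝ) (z : ℂ) :
    voiculescuFun γ m (starRingEnd ℂ z) = starRingEnd ℂ (voiculescuFun γ m z) := by
  simp only [voiculescuFun, nevKernel_conj, map_add, Complex.conj_ofReal, integral_conj]

/-- A bound for `V(z)/z` on the cone `|re z| ≤ α im z`, with `y = im z`. -/
noncomputable def coneBound (γ : ℝ) (m : Measure ℝ) (α y : ℝ) : ℝ :=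
  |γ| / y + m.real univ / y ^ 2 + ∫ x : ℝ, min (2 + α) (2 * |x| / y) ∂m

lemma integrable_min_coneBound {α y : ℝ} (hα : 0 ≤ α) (hy : 0 < y) :
    Integrable (fun x : ℝ => min (2 + α) (2 * |x| / y)) m := by
  refine .of_bound (by fun_prop) (2 + α) (ae_of_all _ fun x => ?_)
  rw [Real.norm_of_nonneg (by positivity)]
  exact min_le_left _ _

lemma coneBound_anti {γ α y y' : ℝ} (hα : 0 ≤ α) (hy : 0 < y) (hyy : y ≤ y') :
    coneBound γ m α y' ≤ coneBound γ m α y := by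
  unfold coneBound
  have : 0 ≤ m.real univ := measureReal_nonneg
  refine add_le_add (by gcongr) ?_
  exact integral_mono (integrable_min_coneBound (m := m) hα (hy.trans_le hyy))
    (integrable_min_coneBound hα hy)
    fun x => min_le_min_left _ (by gcongr)

lemma tendsto_coneBound (γ : ℝ) {α : ℝ} (hα : 0 ≤ α) :
    Tendsto (coneBound γ m α) atTop (𝓝 0) := by
  have h1 : Tendsto (fun y : ℝ => |γ| / y) atTop (𝓝 0) := tendsto_const_nhds.div_atTop tendsto_id
  have h2 : Tendsto (fun y : ℝ => m.real univ / y ^ 2) atTop (𝓝 0) :=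
    tendsto_const_nhds.div_atTop (tendsto_pow_atTop two_ne_zero)
  have h3 : Tendsto (fun y : ℝ => ∫ x : ℝ, min (2 + α) (2 * |x| / y) ∂m) atTop
      (𝓝 (∫ x : ℝ, (0 : ℝ) ∂m)) := by
    refine tendsto_integral_filter_of_dominated_convergence (fun _ => 2 + α)
      (Eventually.of_forall fun y => by fun_prop) ?_ (integrable_const _) (ae_of_all _ fun x => ?_)
    · filter_upwards [eventually_gt_atTop 0] with y hy
      refine ae_of_all _ fun x => ?_
      rw [Real.norm_of_nonneg (by positivity)]
      exact min_le_left _ _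
    · have : Tendsto (fun y : ℝ => min (2 + α) (2 * |x| / y)) atTop (𝓝 (min (2 + α) 0)) :=
        tendsto_const_nhds.min (tendsto_const_nhds.div_atTop tendsto_id)
      rwa [min_eq_right (by positivity)] at this
  have := (h1.add h2).add h3
  rw [integral_zero, add_zero, add_zero] at this
  exact this

/-- The bound involves m but not φ, so it is uniform over the simple-function approximants of the
identity, which satisfy |φ x| ≤ 2|x|. This is the origin of the factor 2 in `coneBound`. -/
lemma norm_voiculescuFun_map_le (γ : ℝ) {φ : ℝ → ℝ} (hφ : Measurable φ) (hφx : ∀ x, |φ x| ≤ 2 * |x|)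
    {α : ℝ} {z : ℂ} (hz : 0 < z.im) (hzα : |z.re| ≤ α * z.im) :
    ‖voiculescuFun γ (m.map φ) z‖ ≤ ‖z‖ * coneBound γ m α z.im := by
  have hα : 0 ≤ α := by
    by_contra h
    have := abs_nonneg z.re
    nlinarith
  have him : z.im ≤ ‖z‖ := (le_abs_self _).trans (Complex.abs_im_le_norm z)
  have hγ : ‖(γ : ℂ)‖ ≤ ‖z‖ * (|γ| / z.im) := by
    rw [Complex.norm_real, Real.norm_eq_abs, mul_div_left_comm]
    exact le_mul_of_one_le_right (abs_nonneg _) ((one_le_div hz).2 him)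
  have hint : ‖∫ x, nevKernel z (φ x) ∂m‖
      ≤ ‖z‖ * (m.real univ / z.im ^ 2 + ∫ x : ℝ, min (2 + α) (2 * |x| / z.im) ∂m) := by
    calc _ ≤ ∫ x : ℝ, ‖z‖ * (1 / z.im ^ 2 + min (2 + α) (2 * |x| / z.im)) ∂m := by
          refine norm_integral_le_of_norm_le
            (((integrable_const _).add (integrable_min_coneBound hα hz)).const_mul _)
            (ae_of_all _ fun x => (norm_nevKernel_le hz hzα (φ x)).trans ?_)
          gcongr
          exact hφx x
      _ = _ := by
          rw [integral_const_mul, integral_add (integrable_const _) (integrable_min_coneBound hα hz)]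
          simp [div_eq_mul_inv]
  rw [voiculescuFun, integral_map hφ.aemeasurable (measurable_nevKernel z).aestronglyMeasurable]
  refine (norm_add_le _ _).trans ((add_le_add hγ hint).trans (le_of_eq ?_))
  rw [coneBound]; ring

lemma norm_voiculescuFun_le (γ : ℝ) {α : ℝ} {z : ℂ} (hz : 0 < z.im) (hzα : |z.re| ≤ α * z.im) :
    ‖voiculescuFun γ m z‖ ≤ ‖z‖ * coneBound γ m α z.im := by
  simpa using norm_voiculescuFun_map_le (m := m) γ measurable_id
    (fun x => by simp only [id]; linarith [abs_nonneg x]) hz hzα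

lemma voiculescuFun_map_simpleFunc (γ : ℝ) (φ : SimpleFunc ℝ ℝ) (z : ℂ) :
    voiculescuFun γ (m.map φ) z
      = γ + ∑ y : φ.range, m.real (φ ⁻¹' {(y : ℝ)}) * nevKernel z y := by
  rw [voiculescuFun, integral_map φ.measurable.aemeasurable
    (measurable_nevKernel z).aestronglyMeasurable]
  congr 1
  have : ∀ x, nevKernel z (φ x)
      = ∑ y ∈ φ.range, (φ ⁻¹' {y}).indicator (fun _ => nevKernel z y) x := fun x => by
    rw [Finset.sum_eq_single (φ x)]
    · simp
    · intro y _ hy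
      exact indicator_of_notMem (fun h => hy (by simpa using h.symm)) _
    · intro h
      exact absurd (φ.mem_range_self x) h
  simp_rw [this]
  rw [integral_finsetSum _ fun y _ =>
    (integrable_const _).indicator (φ.measurableSet_fiber y), ← Finset.sum_coe_sort]
  refine Finset.sum_congr rfl fun y _ => ?_
  rw [integral_indicator_const _ (φ.measurableSet_fiber y), Complex.real_smul]

end

/-! ### Truncated cones and the measure belonging to a general finite `m`. -/

lemma isOpen_stolzCone (α β : ℝ) : IsOpen (stolzCone α β) :=
  (isOpen_lt continuous_const Complex.continuous_im).inter
    (isOpen_lt Complex.continuous_re.abs (continuous_const.mul Complex.continuous_im))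

lemma convex_stolzCone (α β : ℝ) : Convex ℝ (stolzCone α β) := by
  intro z hz w hw a b ha hb hab
  obtain ⟨hz1, hz2⟩ := hz
  obtain ⟨hw1, hw2⟩ := hw
  constructor
  · have : (a • z + b • w).im = a * z.im + b * w.im := by simp
    rw [this]
    obtain rfl : b = 1 - a := by linarith
    rcases ha.eq_or_lt with rfl | ha
    · simpa using hw1
    · nlinarith
  · have h1 : (a • z + b • w).im = a * z.im + b * w.im := by simp
    have h2 : (a • z + b • w).re = a * z.re + b * w.re := by simp
    rw [h1, h2]
    have h3 : |a * z.re + b * w.re| ≤ a * |z.re| + b * |w.re| := by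
      refine (abs_add_le _ _).trans ?_
      rw [abs_mul, abs_mul, abs_of_nonneg ha, abs_of_nonneg hb]
    refine h3.trans_lt ?_
    obtain rfl : b = 1 - a := by linarith
    rcases ha.eq_or_lt with rfl | ha
    · simpa using hw2
    · nlinarith

lemma norm_le_of_mem_stolzCone {α β : ℝ} {z : ℂ} (hβ : 0 ≤ β) (hz : z ∈ stolzCone α β) :
    ‖z‖ ≤ (1 + α) * z.im := by
  have h0 : 0 < z.im := hβ.trans_lt hz.1
  have h1 := Complex.norm_le_abs_re_add_abs_im z
  rw [abs_of_pos h0] at h1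
  have := hz.2
  linarith

section

variable {m : Measure ℝ} [IsFiniteMeasure m]

/-- In the cone |z| ≤ (1+α) im z, so the perturbation V costs only a fraction of the height; once
that fraction is below 1, z + V z stays in the upper half-plane, uniformly in φ. -/
lemma le_im_add_voiculescuFun_map {γ : ℝ} {φ : ℝ → ℝ} (hφ : Measurable φ)
    (hφx : ∀ x, |φ x| ≤ 2 * |x|) {α β : ℝ} (hα : 0 ≤ α) (hβ : 0 < β) {z : ℂ}
    (hz : z ∈ stolzCone α β) :
    z.im * (1 - (1 + α) * coneBound γ m α β) ≤ (z + voiculescuFun γ (m.map φ) z).im := by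
  have h0 : 0 < z.im := hβ.trans hz.1
  have h1 := norm_voiculescuFun_map_le (m := m) γ hφ hφx h0 hz.2.le
  have h2 := norm_le_of_mem_stolzCone hβ.le hz
  have h3 := coneBound_anti (γ := γ) (m := m) hα hβ hz.1.le
  have h4 : 0 ≤ coneBound γ m α z.im := by
    by_contra h
    have h5 : 0 < ‖z‖ := by rw [norm_pos_iff]; rintro rfl; simp at h0
    have := norm_nonneg (voiculescuFun γ (m.map φ) z)
    nlinarith
  have h5 := (abs_le.1 (Complex.abs_im_le_norm (voiculescuFun γ (m.map φ) z))).1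
  have h6 : ‖z‖ * coneBound γ m α z.im ≤ (1 + α) * z.im * coneBound γ m α β := by gcongr
  rw [Complex.add_im]
  linarith

lemma le_im_add_voiculescuFun {γ α β : ℝ} (hα : 0 ≤ α) (hβ : 0 < β) {z : ℂ}
    (hz : z ∈ stolzCone α β) :
    z.im * (1 - (1 + α) * coneBound γ m α β) ≤ (z + voiculescuFun γ m z).im := by
  simpa using le_im_add_voiculescuFun_map (γ := γ) (m := m) measurable_id
    (fun x => by simp only [id]; linarith [abs_nonneg x]) hα hβ hz

/-- The height in the finite case depends on ∑ p_i(1 + x_i²), which is not controlled along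
approximations. Both sides are analytic on the whole cone, which is convex, so the identity theorem
extends the equation to a cone that depends on γ, m and α only. -/
lemma exists_cauchyTransform_of_simpleFunc (γ : ℝ) (φ : SimpleFunc ℝ ℝ)
    (hφx : ∀ x, |φ x| ≤ 2 * |x|) :
    ∃ ν : Measure ℝ, IsProbabilityMeasure ν ∧ ∀ α β : ℝ, 0 < α → 0 < β →
      (1 + α) * coneBound γ m α β < 1 → ∀ z ∈ stolzCone α β,
        cauchyTransform ν (z + voiculescuFun γ (m.map φ) z) = 1 / z := by
  obtain ⟨ν, hν, β₀, hβ₀, h⟩ := exists_cauchyTransform_of_finite γ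
    (fun y : φ.range => m.real (φ ⁻¹' {(y : ℝ)})) (fun y => y) fun _ => measureReal_nonneg
  refine ⟨ν, hν, fun α β hα hβ hδ => ?_⟩
  simp only [← voiculescuFun_map_simpleFunc] at h
  set V := voiculescuFun γ (m.map φ) with hV
  set δ := (1 + α) * coneBound γ m α β with hδ'
  have him : ∀ z ∈ stolzCone α β, z.im * (1 - δ) ≤ (z + V z).im := fun z hz =>
    le_im_add_voiculescuFun_map φ.measurable hφx hα.le hβ hz
  have hpos : ∀ z ∈ stolzCone α β, 0 < (z + V z).im := fun z hz =>
    lt_of_lt_of_le (mul_pos (hβ.trans hz.1) (by linarith)) (him z hz)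
  have hVd : DifferentiableOn ℂ V (stolzCone α β) :=
    (differentiableOn_voiculescuFun γ).mono fun z hz => hβ.trans hz.1
  have hd : DifferentiableOn ℂ (fun z => cauchyTransform ν (z + V z) * z) (stolzCone α β) :=
    ((differentiableOn_cauchyTransform ν).comp (differentiableOn_id.add hVd) hpos).mul
      differentiableOn_id
  -- Above height Y, im(z + V z) ≥ (1-δ) im z ≥ β₀, so the finite case applies.
  set Y := max β (β₀ / (1 - δ)) with hY
  have hY0 : 0 < Y := hβ.trans_le (le_max_left _ _)
  have key : ∀ z ∈ stolzCone α Y, cauchyTransform ν (z + V z) * z = 1 := by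
    intro z hz
    have hz0 : 0 < z.im := hY0.trans hz.1
    have hne : z ≠ 0 := by rintro rfl; simp at hz0
    rw [h z hz0, one_div_mul_cancel hne]
    have h1 := him z ⟨(le_max_left _ _).trans_lt hz.1, hz.2⟩
    have h2 : β₀ / (1 - δ) ≤ z.im := (le_max_right _ _).trans hz.1.le
    rw [div_le_iff₀ (by linarith)] at h2
    exact h2.trans h1
  have hz₀ : Complex.I * ((Y + 1 : ℝ) : ℂ) ∈ stolzCone α Y := by
    constructor
    · simp
    · simpa using by positivity
  have heq := (hd.analyticOnNhd (isOpen_stolzCone α β)).eqOn_of_preconnected_of_eventuallyEq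
    (analyticOnNhd_const (v := (1 : ℂ))) (convex_stolzCone α β).isPreconnected
    (z₀ := Complex.I * ((Y + 1 : ℝ) : ℂ)) ⟨(le_max_left _ _).trans_lt hz₀.1, hz₀.2⟩
    (by filter_upwards [(isOpen_stolzCone α Y).mem_nhds hz₀] with z hz using key z hz)
  intro z hz
  have hz0 : 0 < z.im := hβ.trans hz.1
  have hne : z ≠ 0 := by rintro rfl; simp at hz0
  rw [eq_div_iff hne]
  exact heq hz

lemma tendsto_voiculescuFun_map (γ : ℝ) {φ : ℕ → ℝ → ℝ} (hφ : ∀ n, Measurable (φ n))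
    (hlim : ∀ x, Tendsto (fun n => φ n x) atTop (𝓝 x)) {z : ℂ} (hz : 0 < z.im) :
    Tendsto (fun n => voiculescuFun γ (m.map (φ n)) z) atTop (𝓝 (voiculescuFun γ m z)) := by
  refine tendsto_const_nhds.add ?_
  simp_rw [fun n => integral_map (μ := m) (hφ n).aemeasurable
    (measurable_nevKernel z).aestronglyMeasurable]
  refine tendsto_integral_of_dominated_convergence _
    (fun n => ((measurable_nevKernel z).comp (hφ n)).aestronglyMeasurable)
    (integrable_const _) (fun n => ae_of_all _ fun x => norm_nevKernel_le_const hz (φ n x))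
    (ae_of_all _ fun x => ?_)
  have hc : Continuous (nevKernel z) :=
    Continuous.div (by fun_prop) (by fun_prop) fun x => sub_ofReal_ne_zero hz.ne' x
  exact (hc.tendsto x).comp (hlim x)

/-- Simple functions tending to the identity push m to finitely supported measures with transforms
V_n → V on common cones. The limit law is extracted for the cones of all apertures simultaneously,
so that one measure serves every α. -/
theorem exists_isVoiculescuGerm (γ : ℝ) (m : Measure ℝ) [IsFiniteMeasure m] :
    ∃ ν : Measure ℝ, IsProbabilityMeasure ν ∧ IsVoiculescuGerm ν (voiculescuFun γ m) := by
  set V := voiculescuFun γ m with hV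
  let φ : ℕ → SimpleFunc ℝ ℝ := SimpleFunc.approxOn id measurable_id univ 0 (mem_univ _)
  have hφx : ∀ n x, |φ n x| ≤ 2 * |x| := fun n x => by
    have := SimpleFunc.norm_approxOn_zero_le measurable_id (mem_univ (0 : ℝ)) x n
    rw [two_mul]
    exact this
  have hφlim : ∀ x, Tendsto (fun n => φ n x) atTop (𝓝 x) := fun x =>
    SimpleFunc.tendsto_approxOn measurable_id (mem_univ (0 : ℝ)) (by simp)
  choose ν hν hνG using fun n => exists_cauchyTransform_of_simpleFunc (m := m) γ (φ n) (hφx n)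
  have hexists : ∀ α ε : ℝ, 0 < α → 0 < ε → ∃ β, 0 < β ∧ (1 + α) * coneBound γ m α β < ε := by
    intro α ε hα hε
    have := (tendsto_coneBound (m := m) γ hα.le).const_mul (1 + α)
    rw [mul_zero] at this
    obtain ⟨β, hβ1, hβ2⟩ := ((this.eventually_lt_const hε).and (eventually_gt_atTop 0)).exists
    exact ⟨β, hβ2, hβ1⟩
  obtain ⟨ν', hν', hG⟩ : ∃ ν' : Measure ℝ, IsProbabilityMeasure ν' ∧
      ∀ z : {z : ℂ // ∃ α β, 0 < α ∧ 0 < β ∧ (1 + α) * coneBound γ m α β < 1 ∧ z ∈ stolzCone α β},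
        cauchyTransform ν' (z + V z) = 1 / (z : ℂ) := by
    have hpos : ∀ z : {z : ℂ // ∃ α β, 0 < α ∧ 0 < β ∧ (1 + α) * coneBound γ m α β < 1 ∧
        z ∈ stolzCone α β}, 0 < ((z : ℂ) + V z).im := by
      rintro ⟨z, α, β, hα, hβ, hδ, hz⟩
      exact lt_of_lt_of_le (mul_pos (hβ.trans hz.1) (by linarith))
        (le_im_add_voiculescuFun hα.le hβ hz)
    refine exists_of_tendsto_cauchyTransform ν _ _ hpos (fun z => ?_) fun ε hε => ?_
    · have hz' := hpos z
      obtain ⟨z, α, β, hα, hβ, hδ, hz⟩ := z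
      have hz0 : 0 < z.im := hβ.trans hz.1
      set c := z.im * (1 - (1 + α) * coneBound γ m α β) with hc
      have hc0 : 0 < c := mul_pos hz0 (by linarith)
      have hcn : ∀ n, c ≤ (z + voiculescuFun γ (m.map (φ n)) z).im := fun n =>
        le_im_add_voiculescuFun_map (φ n).measurable (hφx n) hα.le hβ hz
      rw [tendsto_iff_norm_sub_tendsto_zero]
      refine squeeze_zero (fun _ => norm_nonneg _)
        (g := fun n => ‖V z - voiculescuFun γ (m.map (φ n)) z‖ * (1 / (z + V z).im * (1 / c)))
        (fun n => ?_) ?_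
      -- The known value is at the moving point z + V_n z; the Lipschitz bound for Cauchy transforms
      -- carries it to the fixed point z + V z.
      · rw [← hνG n α β hα hβ hδ z hz]
        refine (norm_cauchyTransform_sub_le hz' (hc0.trans_le (hcn n))).trans ?_
        rw [add_sub_add_left_eq_sub]
        gcongr
        exact hcn n
      · have h1 := tendsto_voiculescuFun_map (m := m) γ (fun n => (φ n).measurable) hφlim hz0
        have h2 := (h1.const_sub (V z)).norm.mul_const (1 / (z + V z).im * (1 / c))
        rwa [← hV, sub_self, norm_zero, zero_mul] at h2
    · obtain ⟨β, hβ, hδ⟩ := hexists 1 (min 1 ε) one_pos (by positivity)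
      have hδ1 := hδ.trans_le (min_le_left _ _)
      have hδε := hδ.trans_le (min_le_right _ _)
      set z : ℂ := Complex.I * ((β + 1 : ℝ) : ℂ) with hzdef
      have hzim : z.im = β + 1 := by simp [hzdef]
      have hz : z ∈ stolzCone 1 β := by
        constructor
        · rw [hzim]; linarith
        · rw [hzim]; simpa [hzdef] using by positivity
      refine ⟨⟨z, 1, β, one_pos, hβ, hδ1, hz⟩, ?_⟩
      have h1 := le_im_add_voiculescuFun (γ := γ) (m := m) zero_le_one hβ hz
      have h2 : (1 / z).im = -(1 / (β + 1)) := by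
        rw [one_div, hzdef, mul_inv, Complex.inv_I, ← Complex.ofReal_inv, Complex.im_mul_ofReal]
        simp
      rw [hzim] at h1
      have h3 : (1 - (1 + 1) * coneBound γ m 1 β) ≤ (z + V z).im * (1 / (β + 1)) := by
        rw [mul_one_div, le_div_iff₀ (by positivity)]
        linarith
      simp only [h2]
      linarith
  refine ⟨ν', hν', fun α hα => ?_⟩
  obtain ⟨β, hβ, hδ⟩ := hexists α 1 hα one_pos
  have him : ∀ z ∈ stolzCone α β, 0 < z.im := fun z hz => hβ.trans hz.1
  refine ⟨β, hβ, (differentiableOn_voiculescuFun γ).mono him, fun z hz => ⟨?_, ?_⟩, ?_⟩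
  · exact lt_of_lt_of_le (mul_pos (him z hz) (by linarith)) (le_im_add_voiculescuFun hα.le hβ hz)
  · have := hG ⟨z, α, β, hα, hβ, hδ, hz⟩
    rw [recipCauchy]
    simp only [cauchyTransform] at this
    rw [this, one_div, inv_inv]
  · have hT : Tendsto Complex.im (Bornology.cobounded ℂ ⊓ 𝓟 (stolzCone α β)) atTop := by
      have h1 : Tendsto (fun z : ℂ => (1 + α)⁻¹ * ‖z‖) (Bornology.cobounded ℂ ⊓ 𝓟 (stolzCone α β))
          atTop :=
        (tendsto_norm_cobounded_atTop.const_mul_atTop (by positivity)).mono_left inf_le_left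
      refine tendsto_atTop_mono' _ ?_ h1
      filter_upwards [mem_inf_of_right (mem_principal_self _)] with z hz
      rw [inv_mul_le_iff₀ (by positivity)]
      exact norm_le_of_mem_stolzCone hβ.le hz
    refine squeeze_zero_norm' ?_ ((tendsto_coneBound (m := m) γ hα.le).comp hT)
    filter_upwards [mem_inf_of_right (mem_principal_self _)] with z hz
    rw [norm_div]
    have h0 : 0 < ‖z‖ := by
      rw [norm_pos_iff]
      rintro rfl
      simpa using him _ hz
    rw [div_le_iff₀ h0, mul_comm]
    exact norm_voiculescuFun_le γ (him z hz) hz.2.le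

end

/-! ### Lévy exponents -/

/-- The integrand `e^{iξx} - 1 - iξx/(1+x²)` of the Lévy-Khintchine formula. -/
noncomputable def levyIntegrand (ξ x : ℝ) : ℂ :=
  Complex.exp (Complex.I * ξ * x) - 1 - Complex.I * ξ * x / (1 + x ^ 2)

/-- The Lévy-Khintchine exponent of the triplet `(γ, σ², M)`. -/
noncomputable def levyExponent (γ σ2 : ℝ) (M : Measure ℝ) (ξ : ℝ) : ℂ :=
  Complex.I * ξ * γ - σ2 * ξ ^ 2 / 2 + ∫ x, levyIntegrand ξ x ∂M

lemma one_add_sq_ne_zero (x : ℝ) : (1 + (x : ℂ) ^ 2) ≠ 0 := by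
  have : (0 : ℝ) < 1 + x ^ 2 := by positivity
  exact_mod_cast this.ne'

@[fun_prop]
lemma continuous_levyIntegrand : Continuous fun p : ℝ × ℝ => levyIntegrand p.1 p.2 := by
  unfold levyIntegrand
  refine Continuous.sub (by fun_prop) (Continuous.div (by fun_prop) (by fun_prop) fun p => ?_)
  exact one_add_sq_ne_zero p.2

lemma norm_exp_I_mul_sub_le (θ : ℝ) :
    ‖Complex.exp (Complex.I * θ) - 1 - Complex.I * θ‖ ≤ 2 * θ ^ 2 := by
  rcases le_or_gt |θ| 1 with h | h
  · refine (Complex.norm_exp_sub_one_sub_id_le (by simpa using h)).trans ?_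
    simp only [norm_mul, Complex.norm_I, one_mul, Complex.norm_real, Real.norm_eq_abs, sq_abs]
    nlinarith [sq_nonneg θ]
  · have h1 := Real.norm_exp_I_mul_ofReal_sub_one_le (x := θ)
    calc _ ≤ ‖Complex.exp (Complex.I * θ) - 1‖ + ‖Complex.I * θ‖ := norm_sub_le _ _
      _ ≤ |θ| + |θ| := by
        refine add_le_add h1 (le_of_eq ?_)
        simp
      _ ≤ 2 * θ ^ 2 := by rw [← sq_abs]; nlinarith

/-- A bound of product form: the growth 1 + ξ² suits the Laplace transform and an L² integrand put
in place of ξ, and min(1, x²) is what a Lévy measure integrates. -/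
lemma norm_levyIntegrand_le (ξ x : ℝ) :
    ‖levyIntegrand ξ x‖ ≤ 3 * (1 + ξ ^ 2) * min 1 (x ^ 2) := by
  have hξ : |ξ| ≤ 1 + ξ ^ 2 := by rw [← sq_abs]; nlinarith [sq_nonneg (|ξ| - 1), abs_nonneg ξ]
  rcases le_or_gt |x| 1 with h | h
  · have hx2 : x ^ 2 ≤ 1 := by rw [← sq_abs]; nlinarith [abs_nonneg x]
    rw [min_eq_right hx2]
    have hne := one_add_sq_ne_zero x
    have he : levyIntegrand ξ x = (Complex.exp (Complex.I * ((ξ * x : ℝ) : ℂ)) - 1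
        - Complex.I * ((ξ * x : ℝ) : ℂ)) + Complex.I * ((ξ * x * (x ^ 2 / (1 + x ^ 2)) : ℝ) : ℂ) := by
      rw [levyIntegrand]
      push_cast
      rw [← mul_assoc]
      field_simp
      ring
    rw [he]
    have h1 : |ξ * x * (x ^ 2 / (1 + x ^ 2))| ≤ |ξ| * x ^ 2 := by
      rw [abs_mul, abs_mul, abs_of_nonneg (by positivity : 0 ≤ x ^ 2 / (1 + x ^ 2))]
      have h2 : x ^ 2 / (1 + x ^ 2) ≤ x ^ 2 := div_le_self (by positivity) (by nlinarith)
      calc |ξ| * |x| * (x ^ 2 / (1 + x ^ 2)) ≤ |ξ| * 1 * x ^ 2 := by gcongr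
        _ = _ := by ring
    calc _ ≤ 2 * (ξ * x) ^ 2 + |ξ| * x ^ 2 := by
          refine (norm_add_le _ _).trans (add_le_add (norm_exp_I_mul_sub_le _) ?_)
          rw [norm_mul, Complex.norm_I, one_mul, Complex.norm_real]
          exact h1
      _ ≤ _ := by nlinarith [sq_nonneg x, sq_nonneg (ξ * x)]
  · have hx2 : 1 ≤ x ^ 2 := by rw [← sq_abs]; nlinarith
    rw [min_eq_left hx2, levyIntegrand]
    have h1 : ‖Complex.exp (Complex.I * ξ * x)‖ = 1 := by
      rw [show Complex.I * ξ * x = ((ξ * x : ℝ) : ℂ) * Complex.I by push_cast; ring,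
        Complex.norm_exp_ofReal_mul_I]
    have h2 : ‖Complex.I * ξ * x / (1 + x ^ 2)‖ ≤ |ξ| := by
      have : Complex.I * ξ * x / (1 + x ^ 2) = Complex.I * ((ξ * (x / (1 + x ^ 2)) : ℝ) : ℂ) := by
        push_cast; ring
      rw [this, norm_mul, Complex.norm_I, one_mul, Complex.norm_real, Real.norm_eq_abs, abs_mul,
        abs_div, abs_of_pos (by positivity : 0 < 1 + x ^ 2)]
      refine mul_le_of_le_one_right (abs_nonneg _) ((div_le_one (by positivity)).2 ?_)
      rw [← sq_abs x]; nlinarith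
    calc _ ≤ ‖Complex.exp (Complex.I * ξ * x)‖ + ‖(1 : ℂ)‖ + ‖Complex.I * ξ * x / (1 + x ^ 2)‖ :=
          (norm_sub_le _ _).trans (by gcongr; exact norm_sub_le _ _)
      _ ≤ 1 + 1 + |ξ| := by rw [h1, norm_one]; gcongr
      _ ≤ _ := by nlinarith

section Exponent

variable {γ σ2 : ℝ} {M : Measure ℝ}

lemma integrable_levyIntegrand (hM : Integrable (fun x : ℝ => min 1 (x ^ 2)) M) (ξ : ℝ) :
    Integrable (levyIntegrand ξ) M :=
  (hM.const_mul (3 * (1 + ξ ^ 2))).mono'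
    (continuous_levyIntegrand.comp (Continuous.prodMk_right ξ)).aestronglyMeasurable
    (ae_of_all _ (norm_levyIntegrand_le ξ))

lemma continuous_levyExponent (hM : Integrable (fun x : ℝ => min 1 (x ^ 2)) M) :
    Continuous (levyExponent γ σ2 M) := by
  refine Continuous.add (by fun_prop) (continuous_iff_continuousAt.2 fun ξ₀ => ?_)
  have h1 : ∀ᶠ ξ : ℝ in 𝓝 ξ₀, ξ ^ 2 < ξ₀ ^ 2 + 1 :=
    (continuous_pow 2).continuousAt.eventually_lt_const (by linarith)
  refine continuousAt_of_dominated (bound := fun x => 3 * (1 + (ξ₀ ^ 2 + 1)) * min 1 (x ^ 2))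
    (Eventually.of_forall fun ξ => (integrable_levyIntegrand hM ξ).aestronglyMeasurable) ?_
    (hM.const_mul _) (ae_of_all _ fun x => ?_)
  · filter_upwards [h1] with ξ hξ
    refine ae_of_all _ fun x => (norm_levyIntegrand_le ξ x).trans ?_
    gcongr
  · exact (continuous_levyIntegrand.comp (Continuous.prodMk_left x)).continuousAt

lemma levyExponent_zero : levyExponent γ σ2 M 0 = 0 := by
  simp [levyExponent, levyIntegrand]

/-- A constant `C` with `|ψ(ξ)| ≤ C (1 + ξ²)`. -/
noncomputable def levyConst (γ σ2 : ℝ) (M : Measure ℝ) : ℝ :=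
  |γ| + |σ2| + 3 * ∫ x : ℝ, min 1 (x ^ 2) ∂M

lemma levyConst_nonneg : 0 ≤ levyConst γ σ2 M := by
  have : 0 ≤ ∫ x : ℝ, min 1 (x ^ 2) ∂M := integral_nonneg fun x => by positivity
  unfold levyConst
  positivity

lemma norm_integral_levyIntegrand_le (hM : Integrable (fun x : ℝ => min 1 (x ^ 2)) M) (ξ : ℝ) :
    ‖∫ x, levyIntegrand ξ x ∂M‖ ≤ 3 * (1 + ξ ^ 2) * ∫ x : ℝ, min 1 (x ^ 2) ∂M := by
  rw [← integral_const_mul]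
  exact norm_integral_le_of_norm_le (hM.const_mul _) (ae_of_all _ (norm_levyIntegrand_le ξ))

lemma norm_levyExponent_le (hM : Integrable (fun x : ℝ => min 1 (x ^ 2)) M) (ξ : ℝ) :
    ‖levyExponent γ σ2 M ξ‖ ≤ levyConst γ σ2 M * (1 + ξ ^ 2) := by
  have hξ : |ξ| ≤ 1 + ξ ^ 2 := by rw [← sq_abs]; nlinarith [sq_nonneg (|ξ| - 1), abs_nonneg ξ]
  have h1 : ‖Complex.I * ξ * γ‖ = |ξ| * |γ| := by simp
  have h2 : ‖(σ2 : ℂ) * ξ ^ 2 / 2‖ = |σ2| * ξ ^ 2 / 2 := by simp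
  have h3 := norm_integral_levyIntegrand_le hM ξ
  calc _ ≤ ‖Complex.I * ξ * γ‖ + ‖(σ2 : ℂ) * ξ ^ 2 / 2‖ + ‖∫ x, levyIntegrand ξ x ∂M‖ :=
        (norm_add_le _ _).trans (by gcongr; exact norm_sub_le _ _)
    _ ≤ (1 + ξ ^ 2) * |γ| + |σ2| * (1 + ξ ^ 2) + 3 * (1 + ξ ^ 2) * ∫ x : ℝ, min 1 (x ^ 2) ∂M := by
        rw [h1, h2]
        gcongr
        nlinarith [abs_nonneg σ2, mul_nonneg (abs_nonneg σ2) (sq_nonneg ξ)]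
    _ = _ := by rw [levyConst]; ring

end Exponent

/-! ### The Laplace transform of a Lévy exponent -/

lemma integrableOn_pow_mul_exp_neg (n : ℕ) {t : ℝ} (ht : 0 < t) :
    IntegrableOn (fun u : ℝ => u ^ n * Real.exp (-(t * u))) (Ioi 0) := by
  have := integrableOn_rpow_mul_exp_neg_mul_rpow (s := n) (p := 1) (b := t)
    (by have : (0 : ℝ) ≤ n := n.cast_nonneg
        linarith) one_pos ht
  refine this.congr_fun (fun u _ => ?_) measurableSet_Ioi
  simp

lemma integral_pow_mul_exp_neg (n : ℕ) {t : ℝ} (ht : 0 < t) :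
    ∫ u in Ioi (0 : ℝ), u ^ n * Real.exp (-(t * u)) = n.factorial / t ^ (n + 1) := by
  have := Real.integral_rpow_mul_exp_neg_mul_Ioi (a := n + 1) (r := t) (by positivity) ht
  rw [Real.Gamma_nat_eq_factorial] at this
  rw [show (n.factorial : ℝ) / t ^ (n + 1) = (1 / t) ^ ((n : ℝ) + 1) * n.factorial by
    rw [show ((n : ℝ) + 1) = ((n + 1 : ℕ) : ℝ) by push_cast; rfl, Real.rpow_natCast, one_div_pow]
    ring, ← this]
  refine setIntegral_congr_fun measurableSet_Ioi fun u _ => ?_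
  simp

lemma integrableOn_ofReal_pow_mul_exp_neg (n : ℕ) {t : ℝ} (ht : 0 < t) :
    IntegrableOn (fun u : ℝ => (u : ℂ) ^ n * Complex.exp (-(t * u))) (Ioi 0) := by
  have := (integrableOn_pow_mul_exp_neg n ht).ofReal (𝕜 := ℂ)
  refine this.congr (ae_of_all _ fun u => ?_)
  simp

lemma integral_ofReal_pow_mul_exp_neg (n : ℕ) {t : ℝ} (ht : 0 < t) :
    ∫ u in Ioi (0 : ℝ), (u : ℂ) ^ n * Complex.exp (-(t * u)) = n.factorial / (t : ℂ) ^ (n + 1) := by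
  have h1 : ∀ u : ℝ, (u : ℂ) ^ n * Complex.exp (-(t * u))
      = ((u ^ n * Real.exp (-(t * u)) : ℝ) : ℂ) := fun u => by simp
  simp_rw [h1, integral_complex_ofReal, integral_pow_mul_exp_neg n ht]
  push_cast
  rfl

/-- `y [1/(1 + iy/t) - 1/(1 + y²)]`. -/
noncomputable def freeIntegrand (t y : ℝ) : ℂ :=
  y * (1 / (1 + Complex.I * y / t) - 1 / (1 + y ^ 2))

lemma one_add_I_mul_div_ne_zero (y t : ℝ) : (1 + Complex.I * y / t) ≠ 0 := by
  intro h
  have := congrArg Complex.re h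
  rw [show Complex.I * (y : ℂ) / t = Complex.I * ((y / t : ℝ) : ℂ) by push_cast; ring] at this
  simp at this

/-- Matches the classical jump contribution with the kernel (1+yz)/(z-y) at z = it, the factor
y²/(1+y²) being the density of m. -/
lemma freeIntegrand_eq {t : ℝ} (ht : t ≠ 0) (y : ℝ) :
    freeIntegrand t y = ((y ^ 2 / (1 + y ^ 2) : ℝ) : ℂ) * nevKernel (Complex.I * t) y := by
  have h1 := one_add_I_mul_div_ne_zero y t
  have h2 := one_add_sq_ne_zero y
  have h3 : Complex.I * t - y ≠ 0 := sub_ofReal_ne_zero (by simpa using ht) y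
  have h4 : (t : ℂ) ≠ 0 := by exact_mod_cast ht
  have h5 : 1 / (1 + Complex.I * y / t) = Complex.I * t / (Complex.I * t - y) := by
    rw [div_eq_div_iff h1 h3]
    field_simp
    linear_combination -(y : ℂ) * Complex.I_sq
  rw [freeIntegrand, nevKernel, h5]
  push_cast
  field_simp
  ring

/-- The three terms of the integrand have Laplace transforms 1/(t+ix), 1/t and a multiple of 1/t²;
the rest is algebra. -/
lemma laplace_levyIntegrand {t : ℝ} (ht : 0 < t) (x : ℝ) :
    Complex.I * t ^ 2 * ∫ u : ℝ in Ioi 0, levyIntegrand (-u) x * Complex.exp (-(t * u))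
      = freeIntegrand t x := by
  have h0 : (t : ℂ) ≠ 0 := by exact_mod_cast ht.ne'
  have hre : (-(t + Complex.I * x : ℂ)).re < 0 := by simpa using ht
  have h1 : ∀ u : ℝ, levyIntegrand (-u) x * Complex.exp (-(t * u))
      = Complex.exp (-(t + Complex.I * x) * u) - (u : ℂ) ^ 0 * Complex.exp (-(t * u))
        + Complex.I * x / (1 + x ^ 2) * ((u : ℂ) ^ 1 * Complex.exp (-(t * u))) := fun u => by
    rw [show -(t + Complex.I * x) * (u : ℂ) = Complex.I * ((-u : ℝ) : ℂ) * x + -(t * u) by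
      push_cast; ring, Complex.exp_add, levyIntegrand]
    push_cast
    ring
  have hsub : IntegrableOn (fun u : ℝ => Complex.exp (-(t + Complex.I * x) * u)
      - (u : ℂ) ^ 0 * Complex.exp (-(t * u))) (Ioi 0) :=
    (integrableOn_exp_mul_complex_Ioi hre 0).sub (integrableOn_ofReal_pow_mul_exp_neg 0 ht)
  simp_rw [h1]
  rw [integral_add hsub ((integrableOn_ofReal_pow_mul_exp_neg 1 ht).const_mul _),
    integral_sub (integrableOn_exp_mul_complex_Ioi hre 0) (integrableOn_ofReal_pow_mul_exp_neg 0 ht),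
    integral_const_mul, integral_ofReal_pow_mul_exp_neg 0 ht, integral_ofReal_pow_mul_exp_neg 1 ht,
    integral_exp_mul_complex_Ioi hre]
  have h2 := one_add_sq_ne_zero x
  have h3 := one_add_I_mul_div_ne_zero x t
  have h4 : (t : ℂ) + Complex.I * x ≠ 0 := by
    intro h
    rw [h] at hre
    simp at hre
  have h5 : 1 / (1 + Complex.I * x / t) = t / (t + Complex.I * x) := by
    rw [div_eq_div_iff h3 h4]
    field_simp
  rw [freeIntegrand, h5]
  simp only [Complex.ofReal_zero, mul_zero, Complex.exp_zero, Nat.factorial, Nat.cast_one]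
  rw [neg_div_neg_eq]
  field_simp
  linear_combination (Complex.I * t ^ 3 * x ^ 2 - (t : ℂ) ^ 4 * x ^ 3) * Complex.I_sq

/-! ### The measure `m` -/

section Khintchine

variable {σ2 : ℝ} {M : Measure ℝ}

lemma restrict_compl_singleton_of_measure_eq_zero (h0 : M {0} = 0) : M.restrict {0}ᶜ = M :=
  Measure.restrict_eq_self_of_ae_mem (by rw [ae_iff]; simpa using h0)

lemma integrable_min_one_sq (hM : ∫⁻ x, ENNReal.ofReal (min 1 (x ^ 2)) ∂M < ∞) :
    Integrable (fun x : ℝ => min 1 (x ^ 2)) M :=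
  (lintegral_ofReal_ne_top_iff_integrable (by fun_prop)
    (ae_of_all _ fun x => by positivity)).1 hM.ne

lemma sq_div_one_add_sq_le (x : ℝ) : x ^ 2 / (1 + x ^ 2) ≤ min 1 (x ^ 2) :=
  le_min ((div_le_one (by positivity)).2 (by linarith))
    (div_le_self (by positivity) (by nlinarith [sq_nonneg x]))

lemma isFiniteMeasure_khintchineMeasure (hM : ∫⁻ x, ENNReal.ofReal (min 1 (x ^ 2)) ∂M < ∞) :
    IsFiniteMeasure (khintchineMeasure σ2 M) := by
  have h1 : IsFiniteMeasure ((M.restrict {0}ᶜ).withDensity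
      fun x => ENNReal.ofReal (x ^ 2 / (1 + x ^ 2))) := by
    refine isFiniteMeasure_withDensity (ne_of_lt (lt_of_le_of_lt ?_ hM))
    refine (setLIntegral_le_lintegral _ _).trans (lintegral_mono fun x => ?_)
    exact ENNReal.ofReal_le_ofReal (sq_div_one_add_sq_le x)
  have h2 : IsFiniteMeasure (ENNReal.ofReal σ2 • Measure.dirac (0 : ℝ)) :=
    Measure.smul_finite _ ENNReal.ofReal_ne_top
  unfold khintchineMeasure
  infer_instance

lemma toReal_ofReal_sq_div (x : ℝ) :
    (ENNReal.ofReal (x ^ 2 / (1 + x ^ 2))).toReal = x ^ 2 / (1 + x ^ 2) :=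
  ENNReal.toReal_ofReal (by positivity)

lemma integrable_khintchineMeasure_aux (h0 : M {0} = 0) {F : ℝ → ℂ}
    (hF : Integrable (fun x => ((x ^ 2 / (1 + x ^ 2) : ℝ) : ℂ) * F x) M) :
    Integrable F ((M.restrict {0}ᶜ).withDensity fun x => ENNReal.ofReal (x ^ 2 / (1 + x ^ 2))) := by
  rw [restrict_compl_singleton_of_measure_eq_zero h0,
    integrable_withDensity_iff_integrable_smul' (by fun_prop) (by simp)]
  simpa only [toReal_ofReal_sq_div, Complex.real_smul] using hF

lemma integrable_dirac_khintchineMeasure (F : ℝ → ℂ) :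
    Integrable F (ENNReal.ofReal σ2 • Measure.dirac (0 : ℝ)) :=
  (integrable_dirac (by simp)).smul_measure ENNReal.ofReal_ne_top

lemma integrable_khintchineMeasure (h0 : M {0} = 0) {F : ℝ → ℂ}
    (hF : Integrable (fun x => ((x ^ 2 / (1 + x ^ 2) : ℝ) : ℂ) * F x) M) :
    Integrable F (khintchineMeasure σ2 M) :=
  (integrable_khintchineMeasure_aux h0 hF).add_measure (integrable_dirac_khintchineMeasure F)

lemma integral_khintchineMeasure (hσ : 0 ≤ σ2) (h0 : M {0} = 0) {F : ℝ → ℂ}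
    (hF : Integrable (fun x => ((x ^ 2 / (1 + x ^ 2) : ℝ) : ℂ) * F x) M) :
    ∫ x, F x ∂(khintchineMeasure σ2 M)
      = ∫ x, ((x ^ 2 / (1 + x ^ 2) : ℝ) : ℂ) * F x ∂M + σ2 * F 0 := by
  rw [khintchineMeasure, integral_add_measure (integrable_khintchineMeasure_aux h0 hF)
    (integrable_dirac_khintchineMeasure F), restrict_compl_singleton_of_measure_eq_zero h0,
    integral_withDensity_eq_integral_toReal_smul (by fun_prop) (by simp), integral_smul_measure,
    integral_dirac, ENNReal.toReal_ofReal hσ]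
  simp only [toReal_ofReal_sq_div, Complex.real_smul]

lemma norm_freeIntegrand_le {t : ℝ} (ht : t ≠ 0) (y : ℝ) :
    ‖freeIntegrand t y‖ ≤ |t| * (1 / t ^ 2 + 2) * min 1 (y ^ 2) := by
  have h1 : ‖nevKernel (Complex.I * t) y‖ ≤ |t| * (1 / t ^ 2 + 2) := by
    have h2 : ‖nevKernel (Complex.I * t) y‖ = ‖nevKernel (Complex.I * (|t| : ℝ)) y‖ := by
      rcases abs_choice t with h | h
      · rw [h]
      · rw [h, ← Complex.norm_conj, ← nevKernel_conj]
        simp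
    rw [h2]
    refine (norm_nevKernel_le_const (by simpa using ht) y).trans (le_of_eq ?_)
    simp
  rw [freeIntegrand_eq ht, norm_mul, Complex.norm_real, Real.norm_of_nonneg (by positivity), mul_comm]
  gcongr
  exact sq_div_one_add_sq_le y

lemma measurable_freeIntegrand : Measurable fun p : ℝ × ℝ => freeIntegrand p.1 p.2 := by
  unfold freeIntegrand; fun_prop

lemma integrable_freeIntegrand (hM : Integrable (fun x : ℝ => min 1 (x ^ 2)) M) {t : ℝ}
    (ht : t ≠ 0) : Integrable (freeIntegrand t) M :=
  (hM.const_mul _).mono' (measurable_freeIntegrand.comp measurable_prodMk_left).aestronglyMeasurable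
    (ae_of_all _ (norm_freeIntegrand_le ht))

/-- The Voiculescu transform of the free counterpart of `[γ, σ², M]`. -/
noncomputable def levyVoiculescu (γ σ2 : ℝ) (M : Measure ℝ) : ℂ → ℂ :=
  voiculescuFun γ (khintchineMeasure σ2 M)

lemma levyVoiculescu_I_mul {γ : ℝ} (hσ : 0 ≤ σ2) (h0 : M {0} = 0)
    (hM : Integrable (fun x : ℝ => min 1 (x ^ 2)) M) {t : ℝ} (ht : t ≠ 0) :
    levyVoiculescu γ σ2 M (Complex.I * t)
      = γ + σ2 / (Complex.I * t) + ∫ y, freeIntegrand t y ∂M := by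
  have hint : Integrable (fun y => ((y ^ 2 / (1 + y ^ 2) : ℝ) : ℂ) * nevKernel (Complex.I * t) y) M :=
    (integrable_freeIntegrand hM ht).congr (ae_of_all _ (freeIntegrand_eq ht))
  rw [levyVoiculescu, voiculescuFun, integral_khintchineMeasure hσ h0 hint]
  simp only [freeIntegrand_eq ht]
  rw [nevKernel]
  simp only [Complex.ofReal_zero, zero_mul, sub_zero, add_zero]
  ring

/-- Fubini, with the dominating product 3(1+u²)e^{-tu} · min(1, x²), reduces the jump part to a
single x. -/
lemma laplace_levyExponent {γ : ℝ} [SFinite M] (hM : Integrable (fun x : ℝ => min 1 (x ^ 2)) M)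
    {t : ℝ} (ht : 0 < t) :
    IntegrableOn (fun u : ℝ => levyExponent γ σ2 M (-u) * Complex.exp (-(t * u))) (Ioi 0) ∧
    Complex.I * t ^ 2 * ∫ u : ℝ in Ioi 0, levyExponent γ σ2 M (-u) * Complex.exp (-(t * u))
      = γ + σ2 / (Complex.I * t) + ∫ y, freeIntegrand t y ∂M := by
  have h0 : (t : ℂ) ≠ 0 := by exact_mod_cast ht.ne'
  have hi1 := integrableOn_ofReal_pow_mul_exp_neg 1 ht
  have hi2 := integrableOn_ofReal_pow_mul_exp_neg 2 ht
  have hdom : IntegrableOn (fun u : ℝ => 3 * (1 + u ^ 2) * Real.exp (-(t * u))) (Ioi 0) := by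
    refine (((integrableOn_pow_mul_exp_neg 0 ht).add
      (integrableOn_pow_mul_exp_neg 2 ht)).const_mul 3).congr (ae_of_all _ fun u => ?_)
    simp only [Pi.add_apply]
    ring
  have hprod : Integrable (fun p : ℝ × ℝ => levyIntegrand (-p.1) p.2 * Complex.exp (-(t * p.1)))
      ((volume.restrict (Ioi 0)).prod M) := by
    refine (hdom.integrable.mul_prod hM).mono'
      (Continuous.aestronglyMeasurable ?_) (ae_of_all _ fun p => ?_)
    · exact (continuous_levyIntegrand.comp (continuous_fst.neg.prodMk continuous_snd)).mul
        (by fun_prop)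
    · rw [norm_mul, show -((t : ℂ) * p.1) = ((-(t * p.1) : ℝ) : ℂ) by push_cast; rfl,
        ← Complex.ofReal_exp, Complex.norm_real, Real.norm_of_nonneg (Real.exp_pos _).le]
      have := norm_levyIntegrand_le (-p.1) p.2
      rw [neg_sq] at this
      calc _ ≤ 3 * (1 + p.1 ^ 2) * min 1 (p.2 ^ 2) * Real.exp (-(t * p.1)) := by gcongr
        _ = _ := by ring
  have hi3 : IntegrableOn (fun u : ℝ => ∫ x, levyIntegrand (-u) x * Complex.exp (-(t * u)) ∂M)
      (Ioi 0) := hprod.integral_prod_left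
  have hswap : ∫ u : ℝ in Ioi 0, ∫ x, levyIntegrand (-u) x * Complex.exp (-(t * u)) ∂M
      = ∫ x, (∫ u : ℝ in Ioi 0, levyIntegrand (-u) x * Complex.exp (-(t * u))) ∂M :=
    integral_integral_swap
      (f := fun u x : ℝ => levyIntegrand (-u) x * Complex.exp (-(t * u))) hprod
  have heq : ∀ u : ℝ, levyExponent γ σ2 M (-u) * Complex.exp (-(t * u))
      = -(Complex.I * γ) * ((u : ℂ) ^ 1 * Complex.exp (-(t * u)))
        + -(σ2 / 2 : ℂ) * ((u : ℂ) ^ 2 * Complex.exp (-(t * u)))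
        + ∫ x, levyIntegrand (-u) x * Complex.exp (-(t * u)) ∂M := fun u => by
    rw [integral_mul_const, levyExponent]
    push_cast
    ring
  have hi12 : IntegrableOn (fun u : ℝ => -(Complex.I * γ) * ((u : ℂ) ^ 1 * Complex.exp (-(t * u)))
        + -(σ2 / 2 : ℂ) * ((u : ℂ) ^ 2 * Complex.exp (-(t * u)))) (Ioi 0) :=
    (hi1.const_mul _).add (hi2.const_mul _)
  simp_rw [heq]
  refine ⟨hi12.add hi3, ?_⟩
  rw [integral_add hi12 hi3, integral_add (hi1.const_mul _) (hi2.const_mul _), integral_const_mul,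
    integral_const_mul, integral_ofReal_pow_mul_exp_neg 1 ht, integral_ofReal_pow_mul_exp_neg 2 ht,
    hswap, mul_add, ← integral_const_mul]
  simp_rw [laplace_levyIntegrand ht]
  congr 1
  have hI := Complex.I_ne_zero
  simp only [Nat.factorial, Nat.cast_one, Nat.cast_mul]
  field_simp
  linear_combination (-2 * (t : ℂ) ^ 6 * γ * Complex.I - 2 * (t : ℂ) ^ 5 * σ2) * Complex.I_sq

end Khintchine

/-! ### Free counterparts of infinitely divisible laws -/

lemma HasLevyTriplet.integrable_min {μ : Measure ℝ} {γ σ2 : ℝ} {M : Measure ℝ}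
    (hμ : HasLevyTriplet μ γ σ2 M) : Integrable (fun x : ℝ => min 1 (x ^ 2)) M :=
  integrable_min_one_sq hμ.levy_finite

/-- An integrable function lives on a σ-finite set, and min(1, x²) is positive off the null set {0}.
Fubini relies on this. -/
lemma sigmaFinite_of_integrable_min {M : Measure ℝ} (h0 : M {0} = 0)
    (hM : Integrable (fun x : ℝ => min 1 (x ^ 2)) M) : SigmaFinite M := by
  obtain ⟨s, hs, hs0, hfin⟩ := (memLp_one_iff_integrable.2 hM).aefinStronglyMeasurable (by simp)
    (by simp) |>.exists_set_sigmaFinite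
  have hmem : ∀ᵐ x ∂M, x ∈ s := by
    rw [Filter.EventuallyEq, ae_restrict_iff' hs.compl] at hs0
    have hne : ∀ᵐ x ∂M, x ≠ 0 := by rw [ae_iff]; simpa using h0
    filter_upwards [hs0, hne] with x hx hx0
    by_contra hxs
    have : 0 < min 1 (x ^ 2) := by positivity
    exact this.ne' (hx hxs)
  have h : M.restrict s = M := Measure.restrict_eq_self_of_ae_mem hmem
  rwa [h] at hfin

lemma isLogCharFun_levyExponent {μ : Measure ℝ} {γ σ2 : ℝ} {M : Measure ℝ}
    (hμ : HasLevyTriplet μ γ σ2 M) : IsLogCharFun μ (levyExponent γ σ2 M) where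
  continuous := continuous_levyExponent hμ.integrable_min
  zero := levyExponent_zero
  exp_eq := hμ.charFun_eq

lemma voiculescuFun_div (γ : ℝ) (m : Measure ℝ) {n : ℕ} (hn : 0 < n) (z : ℂ) :
    n * voiculescuFun (γ / n) (ENNReal.ofReal (1 / n) • m) z = voiculescuFun γ m z := by
  have : (n : ℂ) ≠ 0 := by exact_mod_cast hn.ne'
  rw [voiculescuFun, voiculescuFun, integral_smul_measure, ENNReal.toReal_ofReal (by positivity),
    Complex.real_smul]
  push_cast
  field_simp

/-- V/n belongs to (γ/n, m/n), so the existence theorem supplies the n-th free convolution root. -/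
lemma isFreelyInfinitelyDivisible_of_germ {ν : Measure ℝ} [IsProbabilityMeasure ν] {γ : ℝ}
    {m : Measure ℝ} [IsFiniteMeasure m] (h : IsVoiculescuGerm ν (voiculescuFun γ m)) :
    IsFreelyInfinitelyDivisible ν := by
  refine ⟨inferInstance, fun n hn => ?_⟩
  have : IsFiniteMeasure (ENNReal.ofReal (1 / n) • m) := Measure.smul_finite _ ENNReal.ofReal_ne_top
  obtain ⟨κ, hκ, hκV⟩ := exists_isVoiculescuGerm (γ / n) (ENNReal.ofReal (1 / n) • m)
  refine ⟨κ, hκ, _, hκV, ?_⟩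
  simpa only [voiculescuFun_div γ m hn] using h

theorem HasLevyTriplet.exists_isFreeCounterpart {μ : Measure ℝ} {γ σ2 : ℝ} {M : Measure ℝ}
    (hμ : HasLevyTriplet μ γ σ2 M) :
    ∃ μ' : Measure ℝ, IsFreeCounterpart μ μ' (levyVoiculescu γ σ2 M) := by
  have := isFiniteMeasure_khintchineMeasure (σ2 := σ2) hμ.levy_finite
  have := sigmaFinite_of_integrable_min hμ.levy_zero hμ.integrable_min
  obtain ⟨μ', hμ', hV⟩ := exists_isVoiculescuGerm γ (khintchineMeasure σ2 M)
  refine ⟨μ', isFreelyInfinitelyDivisible_of_germ hV,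
    ⟨differentiableOn_voiculescuFun γ, hV, fun z _ => voiculescuFun_conj γ _ z⟩,
    _, isLogCharFun_levyExponent hμ, fun t ht => ?_⟩
  obtain ⟨h1, h2⟩ := laplace_levyExponent (γ := γ) (σ2 := σ2) hμ.integrable_min ht
  exact ⟨h1, by rw [h2, levyVoiculescu_I_mul hμ.sigma_nonneg hμ.levy_zero hμ.integrable_min ht.ne']⟩

/-! ### Characteristic functions of Lévy processes -/

/-- A continuous map from the line into the finite set of n-th roots of unity is constant. This
singles out the n-th root of a characteristic function. -/
lemma eq_one_of_continuous_pow_eq_one {f : ℝ → ℂ} (hf : Continuous f) {n : ℕ} (hn : 0 < n)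
    (hpow : ∀ x, f x ^ n = 1) (h0 : f 0 = 1) (x : ℝ) : f x = 1 := by
  have hfin : {z : ℂ | z ^ n = 1}.Finite := by
    refine (Polynomial.finite_setOfPred_isRoot (Polynomial.X_pow_sub_C_ne_zero hn (1 : ℂ))).subset ?_
    intro z hz
    simpa [Polynomial.IsRoot, sub_eq_zero] using hz
  obtain ⟨y, -, hy⟩ := isPreconnected_univ.eqOn_const_of_mapsTo hfin.isDiscrete
    hf.continuousOn (fun x _ => hpow x) ⟨1, by simp⟩
  have h1 := hy (mem_univ 0)
  have h2 := hy (mem_univ x)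
  simp only [Function.const_apply] at h1 h2
  rw [h2, ← h1, h0]

lemma tendsto_charFun_of_tendstoInMeasure {Ω ι : Type*} [MeasurableSpace Ω] {P : Measure Ω}
    [IsProbabilityMeasure P] {l : Filter ι} [l.NeBot] [l.IsCountablyGenerated] {X : ι → Ω → ℝ}
    {Z : Ω → ℝ} (h : TendstoInMeasure P X l Z) (hX : ∀ i, AEMeasurable (X i) P) (ξ : ℝ) :
    Tendsto (fun i => charFun (P.map (X i)) ξ) l (𝓝 (charFun (P.map Z) ξ)) := by
  have h1 := (h.tendstoInDistribution hX).tendsto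
  have h2 := (ProbabilityMeasure.tendsto_iff_forall_integral_rclike_tendsto ℂ).1 h1
    (BoundedContinuousFunction.ofNormedAddCommGroup
      (fun x : ℝ => Complex.exp (ξ * x * Complex.I)) (by fun_prop) 1 fun x => by
        rw [← Complex.ofReal_mul, Complex.norm_exp_ofReal_mul_I])
  simp only [charFun_apply_real]
  exact h2

namespace IsLevyProcess

variable {Ω : Type*} [MeasurableSpace Ω] {P : Measure Ω} [IsProbabilityMeasure P] {Y : ℝ≥0 → Ω → ℝ}

lemma charFun_add (hY : IsLevyProcess Y P) (s t : ℝ≥0) (ξ : ℝ) :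
    charFun (P.map (Y (s + t))) ξ = charFun (P.map (Y s)) ξ * charFun (P.map (Y t)) ξ := by
  have h1 := hY.indep.indepFun_eval_sub (r := 0) (s := s) (t := s + t) zero_le (by simp) hY.zero
  have h2 := h1.charFun_map_add_eq_mul (hY.measurable s).aemeasurable
    ((hY.measurable (s + t)).sub (hY.measurable s)).aemeasurable
  rw [add_sub_cancel] at h2
  rw [h2, Pi.mul_apply]
  congr 2
  exact (hY.stationary s t).map_eq

lemma charFun_zero_time (hY : IsLevyProcess Y P) (ξ : ℝ) : charFun (P.map (Y 0)) ξ = 1 := by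
  have : P.map (Y 0) = P.map fun _ => (0 : ℝ) := Measure.map_congr hY.zero
  rw [this, Measure.map_const]
  simp

lemma charFun_nsmul (hY : IsLevyProcess Y P) (n : ℕ) (t : ℝ≥0) (ξ : ℝ) :
    charFun (P.map (Y (n * t))) ξ = charFun (P.map (Y t)) ξ ^ n := by
  induction n with
  | zero => simp [hY.charFun_zero_time]
  | succ n ih => rw [Nat.cast_succ, add_mul, one_mul, hY.charFun_add, ih, pow_succ]

lemma continuousWithinAt_charFun (hY : IsLevyProcess Y P) (t : ℝ≥0) (ξ : ℝ) :
    ContinuousWithinAt (fun u => charFun (P.map (Y u)) ξ) (Ici t) t := by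
  have h : ∀ u, charFun (P.map (Y u)) ξ = ∫ ω, Complex.exp (ξ * Y u ω * Complex.I) ∂P := fun u => by
    rw [charFun_apply_real, integral_map (hY.measurable u).aemeasurable (by fun_prop)]
  simp_rw [h]
  refine continuousWithinAt_of_dominated (bound := fun _ => 1)
    (Eventually.of_forall fun u => ?_) (Eventually.of_forall fun u => ae_of_all _ fun ω => ?_)
    (integrable_const _) ?_
  · have := hY.measurable u
    exact Measurable.aestronglyMeasurable (by fun_prop)
  · rw [← Complex.ofReal_mul, Complex.norm_exp_ofReal_mul_I]
  · filter_upwards [hY.cadlag] with ω hω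
    have hc : Continuous fun x : ℝ => Complex.exp (ξ * x * Complex.I) := by fun_prop
    exact hc.continuousAt.comp_continuousWithinAt (hω t).1

variable {μ : Measure ℝ} {ψ : ℝ → ℂ}

/-- Times 1/n come from the unique continuous n-th root, rational times from stationary independent
increments, all other times from right-continuity. -/
lemma charFun_eq_exp (hY : IsLevyProcess Y P) (hY1 : HasLaw (Y 1) μ P) (hψ : IsLogCharFun μ ψ)
    (t : ℝ≥0) (ξ : ℝ) : charFun (P.map (Y t)) ξ = Complex.exp (t * ψ ξ) := by
  have hpY : ∀ t, IsProbabilityMeasure (P.map (Y t)) := fun t =>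
    Measure.isProbabilityMeasure_map (hY.measurable t).aemeasurable
  have hinv : ∀ n : ℕ, 0 < n → ∀ ξ, charFun (P.map (Y (n : ℝ≥0)⁻¹)) ξ = Complex.exp (ψ ξ / n) := by
    intro n hn ξ
    have hn0 : (n : ℂ) ≠ 0 := by exact_mod_cast hn.ne'
    have hn1 : (n : ℝ≥0) ≠ 0 := by exact_mod_cast hn.ne'
    have h1 := eq_one_of_continuous_pow_eq_one
      (f := fun ξ => charFun (P.map (Y (n : ℝ≥0)⁻¹)) ξ * Complex.exp (-(ψ ξ / n)))
      (continuous_charFun.mul (Complex.continuous_exp.comp (hψ.continuous.div_const _).neg)) hn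
      (fun ξ => ?_) (by simp [hψ.zero]) ξ
    · rw [Complex.exp_neg] at h1
      exact eq_of_mul_inv_eq_one h1
    · rw [mul_pow, ← hY.charFun_nsmul, mul_inv_cancel₀ hn1, hY1.map_eq, hψ.exp_eq,
        ← Complex.exp_nat_mul, ← Complex.exp_add]
      rw [show ψ ξ + n * -(ψ ξ / n) = 0 by field_simp; ring, Complex.exp_zero]
  have hrat : ∀ k n : ℕ, 0 < n →
      charFun (P.map (Y (k / n))) ξ = Complex.exp (((k / n : ℝ≥0) : ℝ) * ψ ξ) := by
    intro k n hn
    rw [div_eq_mul_inv, hY.charFun_nsmul, hinv n hn, ← Complex.exp_nat_mul]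
    congr 1
    push_cast
    ring
  -- The + 1 makes the rationals approach t from the right, the side on which continuity is
  -- available.
  have hlim : Tendsto (fun n : ℕ => ((⌊(t : ℝ) * n⌋₊ + 1 : ℕ) / n : ℝ≥0)) atTop (𝓝[Ici t] t) := by
    rw [tendsto_nhdsWithin_iff]
    constructor
    · have h1 : Tendsto (fun n : ℕ => ((⌊(t : ℝ) * n⌋₊ : ℝ) / n) + 1 / (n : ℝ)) atTop (𝓝 (t + 0)) :=
        ((tendsto_nat_floor_mul_div_atTop t.2).comp tendsto_natCast_atTop_atTop).add
          tendsto_one_div_atTop_nhds_zero_nat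
      rw [add_zero] at h1
      rw [← NNReal.tendsto_coe]
      refine h1.congr fun n => ?_
      push_cast
      ring
    · filter_upwards [eventually_gt_atTop 0] with n hn
      have : (0 : ℝ≥0) < n := by exact_mod_cast hn
      rw [mem_Ici, le_div_iff₀ this, ← NNReal.coe_le_coe]
      push_cast
      exact (Nat.lt_floor_add_one _).le
  have h1 := (hY.continuousWithinAt_charFun t ξ).tendsto.comp hlim
  have h2 : Tendsto (fun u : ℝ≥0 => Complex.exp (u * ψ ξ)) (𝓝[Ici t] t)
      (𝓝 (Complex.exp (t * ψ ξ))) := by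
    have : Continuous fun u : ℝ≥0 => Complex.exp ((u : ℝ) * ψ ξ) := by fun_prop
    exact (this.tendsto t).mono_left nhdsWithin_le_nhds
  refine tendsto_nhds_unique h1 ((h2.comp hlim).congr' ?_)
  filter_upwards [eventually_gt_atTop 0] with n hn
  exact (hrat _ n hn).symm

lemma charFun_sub_eq_exp (hY : IsLevyProcess Y P) (hY1 : HasLaw (Y 1) μ P) (hψ : IsLogCharFun μ ψ)
    {s t : ℝ≥0} (hst : s ≤ t) (ξ : ℝ) :
    charFun (P.map fun ω => Y t ω - Y s ω) ξ = Complex.exp ((t - s : ℝ) * ψ ξ) := by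
  obtain ⟨u, rfl⟩ := exists_add_of_le hst
  rw [(hY.stationary s u).map_eq, hY.charFun_eq_exp hY1 hψ]
  push_cast
  congr 2
  ring

end IsLevyProcess

/-! ### Random integrals -/

/-- Quadratic growth against L² convergence: on an a.e. convergent subsequence the excess of |ψ(f) -
ψ(h)| over 2C(f-h)² is dominated by C(2 + 3h²), while the integral of 2C(f-h)² tends to 0. -/
lemma exists_seq_tendsto_integral_of_tendsto_eLpNorm {T : Type*} [MeasurableSpace T]
    {ν : Measure T} [IsFiniteMeasure ν] {f : ℕ → T → ℝ} {h : T → ℝ} (hf : ∀ n, MemLp (f n) 2 ν)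
    (hh : MemLp h 2 ν) (hlim : Tendsto (fun n => eLpNorm (fun s => f n s - h s) 2 ν) atTop (𝓝 0))
    {ψ : ℝ → ℂ} (hψ : Continuous ψ) {C : ℝ} (hC : 0 ≤ C) (hψC : ∀ u, ‖ψ u‖ ≤ C * (1 + u ^ 2)) :
    ∃ ns : ℕ → ℕ, StrictMono ns ∧
      Tendsto (fun n => ∫ s, ψ (f (ns n) s) ∂ν) atTop (𝓝 (∫ s, ψ (h s) ∂ν)) := by
  obtain ⟨ns, hns, hae⟩ := (tendstoInMeasure_of_tendsto_eLpNorm two_ne_zero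
    (fun n => (hf n).1) hh.1 hlim).exists_seq_tendsto_ae
  refine ⟨ns, hns, ?_⟩
  have hint : ∀ g : T → ℝ, MemLp g 2 ν → Integrable (fun s => ψ (g s)) ν := fun g hg =>
    (((integrable_const 1).add hg.integrable_sq).const_mul C).mono'
      (hψ.comp_aestronglyMeasurable hg.1) (ae_of_all _ fun s => hψC (g s))
  have hdiff : ∀ n, MemLp (fun s => f n s - h s) 2 ν := fun n => (hf n).sub hh
  have hsq : Tendsto (fun n => ∫ s, (f (ns n) s - h s) ^ 2 ∂ν) atTop (𝓝 0) := by
    have h1 : ∀ n, ∫ s, (f (ns n) s - h s) ^ 2 ∂ν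
        = (eLpNorm (fun s => f (ns n) s - h s) 2 ν).toReal ^ 2 := fun n => by
      have := (hdiff (ns n)).eLpNorm_eq_integral_rpow_norm two_ne_zero (by simp)
      rw [this, ENNReal.toReal_ofReal (by positivity)]
      simp only [ENNReal.toReal_ofNat, Real.rpow_ofNat, Real.norm_eq_abs, sq_abs]
      rw [← Real.rpow_natCast, ← Real.rpow_mul (integral_nonneg fun s => by positivity)]
      norm_num
    simp_rw [h1]
    have h2 := ((ENNReal.tendsto_toReal ENNReal.zero_ne_top).comp
      (hlim.comp hns.tendsto_atTop)).pow 2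
    simpa using h2
  have hmax : Tendsto (fun n => ∫ s, max (‖ψ (f (ns n) s) - ψ (h s)‖
      - 2 * C * (f (ns n) s - h s) ^ 2) 0 ∂ν) atTop (𝓝 (∫ _, (0 : ℝ) ∂ν)) := by
    refine tendsto_integral_of_dominated_convergence (fun s => C * (2 + 3 * h s ^ 2))
      (fun n => ?_) ?_ (fun n => ae_of_all _ fun s => ?_) ?_
    · have h1 := ((hint _ (hf (ns n))).sub (hint h hh)).norm
      exact ((h1.sub ((hdiff (ns n)).integrable_sq.const_mul (2 * C))).sup
        (integrable_zero _ _ _)).aestronglyMeasurable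
    · exact ((integrable_const 2).add (hh.integrable_sq.const_mul 3)).const_mul C
    · rw [Real.norm_of_nonneg (le_max_right _ _)]
      refine max_le ?_ (by positivity)
      have h1 : ‖ψ (f (ns n) s) - ψ (h s)‖ ≤ C * (1 + f (ns n) s ^ 2) + C * (1 + h s ^ 2) :=
        (norm_sub_le _ _).trans (add_le_add (hψC _) (hψC _))
      have h2 : C * f (ns n) s ^ 2 ≤ C * (2 * (f (ns n) s - h s) ^ 2 + 2 * h s ^ 2) := by
        gcongr
        nlinarith [sq_nonneg (f (ns n) s - 2 * h s)]
      linarith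
    · filter_upwards [hae] with s hs
      have h1 : Tendsto (fun n => ‖ψ (f (ns n) s) - ψ (h s)‖ - 2 * C * (f (ns n) s - h s) ^ 2) atTop
          (𝓝 (‖ψ (h s) - ψ (h s)‖ - 2 * C * (h s - h s) ^ 2)) :=
        ((((hψ.tendsto _).comp hs).sub_const _).norm).sub
          (((hs.sub_const _).pow 2).const_mul _)
      have h2 := h1.max (tendsto_const_nhds (x := (0 : ℝ)))
      simpa using h2
  rw [tendsto_iff_norm_sub_tendsto_zero]
  refine squeeze_zero (fun _ => norm_nonneg _) (fun n => ?_)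
    (by simpa using hmax.add (hsq.const_mul (2 * C)))
  rw [← integral_sub (hint _ (hf _)) (hint _ hh)]
  refine (norm_integral_le_integral_norm _).trans ?_
  have hi1 : Integrable (fun s => ‖ψ (f (ns n) s) - ψ (h s)‖) ν :=
    ((hint _ (hf (ns n))).sub (hint h hh)).norm
  have hi2 := (hdiff (ns n)).integrable_sq.const_mul (2 * C)
  have hi3 : Integrable (fun s => max (‖ψ (f (ns n) s) - ψ (h s)‖
      - 2 * C * (f (ns n) s - h s) ^ 2) 0) ν := (hi1.sub hi2).sup (integrable_zero _ _ _)
  rw [← integral_const_mul, ← integral_add hi3 hi2]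
  refine integral_mono hi1 (hi3.add hi2) fun s => ?_
  have := le_max_left (‖ψ (f (ns n) s) - ψ (h s)‖ - 2 * C * (f (ns n) s - h s) ^ 2) 0
  dsimp only
  linarith

namespace TimeChange

variable {a b : EReal} (r : TimeChange a b)

lemma sign_mul_self : r.sign * r.sign = 1 := by
  rcases r.sign_eq with ⟨h, -⟩ | ⟨h, -⟩ <;> simp [h]

lemma sign_sq : r.sign ^ 2 = 1 := by rw [sq, r.sign_mul_self]

lemma sign_ne_zero : r.sign ≠ 0 := by
  intro h
  simpa [h] using r.sign_mul_self

lemma abs_sign : |r.sign| = 1 := by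
  rcases r.sign_eq with ⟨h, -⟩ | ⟨h, -⟩ <;> simp [h]

instance isLocallyFiniteMeasure_absMeasure : IsLocallyFiniteMeasure r.absMeasure := by
  unfold absMeasure; infer_instance

lemma absMeasure_Ioc_lt_top (p q : timeSet a b) : r.absMeasure (Ioc p q) < ∞ := by
  rw [absMeasure, StieltjesFunction.measure_Ioc]
  exact ENNReal.ofReal_lt_top

instance isFiniteMeasure_restrict_absMeasure (p q : timeSet a b) :
    IsFiniteMeasure (r.absMeasure.restrict (Ioc p q)) :=
  ⟨by simpa using r.absMeasure_Ioc_lt_top p q⟩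

lemma absMeasure_real_Ioc {p q : timeSet a b} (hpq : p ≤ q) :
    r.absMeasure.real (Ioc p q) = r.sign * r.toFun q - r.sign * r.toFun p := by
  rw [measureReal_def, absMeasure, StieltjesFunction.measure_Ioc, ENNReal.toReal_ofReal]
  · rfl
  · exact sub_nonneg.2 (r.stieltjes.mono hpq)

end TimeChange

/-! ### Characteristic functions of elementary and random integrals. -/

section

variable {a b : EReal} {r : TimeChange a b} {Ω : Type*} [MeasurableSpace Ω] {P : Measure Ω}
  {Y : ℝ≥0 → Ω → ℝ} {μ : Measure ℝ} {ψ : ℝ → ℂ}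

/-- For nonincreasing r the increment is the negative of a forward increment of Y. The sign thus
moves into the argument of ψ, and the mass of |dr| stays positive; from here on only ±h and |dr|
occur. -/
lemma IsLevyProcess.charFun_increment [IsProbabilityMeasure P] (hY : IsLevyProcess Y P) (hY1 : HasLaw (Y 1) μ P)
    (hψ : IsLogCharFun μ ψ) {p q : timeSet a b} (hpq : p ≤ q) (ξ : ℝ) :
    charFun (P.map fun ω => Y (r.toFun q) ω - Y (r.toFun p) ω) ξ
      = Complex.exp (r.absMeasure.real (Ioc p q) * ψ (r.sign * ξ)) := by
  rw [r.absMeasure_real_Ioc hpq]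
  rcases r.sign_eq with ⟨h, hm⟩ | ⟨h, hm⟩
  · rw [hY.charFun_sub_eq_exp hY1 hψ (hm hpq), h]
    push_cast
    simp
  · have h1 : (fun ω => Y (r.toFun q) ω - Y (r.toFun p) ω)
        = (fun x => -1 * x) ∘ fun ω => Y (r.toFun p) ω - Y (r.toFun q) ω := by
      ext ω; simp
    have hm' : Measurable fun ω => Y (r.toFun p) ω - Y (r.toFun q) ω :=
      (hY.measurable _).sub (hY.measurable _)
    rw [h1, ← Measure.map_map (by fun_prop) hm', charFun_map_mul, hY.charFun_sub_eq_exp hY1 hψ (hm hpq), h]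
    push_cast
    congr 2
    ring

lemma IsLevyProcess.iIndepFun_increments (hY : IsLevyProcess Y P) (f : StepFunction (timeSet a b)) :
    iIndepFun (fun (i : Fin f.n) ω => Y (r.toFun (f.u i.succ)) ω - Y (r.toFun (f.u i.castSucc)) ω)
      P := by
  rcases r.sign_eq with ⟨h, hm⟩ | ⟨h, hm⟩
  · exact hY.indep f.n (fun j => r.toFun (f.u j)) (hm.comp f.mono)
  -- For nonincreasing r the times become ordered after reversing the partition, which also flips
  -- the sign of each increment.
  · have h1 := hY.indep f.n (fun j => r.toFun (f.u j.rev))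
      fun i j hij => hm (f.mono (Fin.rev_le_rev.2 hij))
    have h2 := (h1.precomp (g := Fin.rev) Fin.rev_injective).comp (fun _ x => -x)
      fun _ => measurable_neg
    convert h2 using 2 with i
    ext ω
    simp [Fin.rev_succ, Fin.rev_castSucc]

/-- The intervals of a step function are disjoint, so at most one summand is nonzero; g(0) = 0
handles points outside all of them. -/
lemma StepFunction.comp_toFun_eq (f : StepFunction (timeSet a b)) {g : ℝ → ℂ} (hg : g 0 = 0)
    (s : timeSet a b) : g (f.toFun s)
      = ∑ i : Fin f.n, (Ioc (f.u i.castSucc) (f.u i.succ)).indicator (fun _ => g (f.c i)) s := by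
  by_cases h : ∃ i : Fin f.n, s ∈ Ioc (f.u i.castSucc) (f.u i.succ)
  · obtain ⟨i, hi⟩ := h
    have hne : ∀ j : Fin f.n, j ≠ i → s ∉ Ioc (f.u j.castSucc) (f.u j.succ) := by
      intro j hj hs
      rcases lt_or_gt_of_ne hj with hlt | hlt
      · exact absurd ((hs.2.trans (f.mono (Fin.succ_le_castSucc_iff.2 hlt))).trans_lt hi.1)
          (lt_irrefl _)
      · exact absurd ((hi.2.trans (f.mono (Fin.succ_le_castSucc_iff.2 hlt))).trans_lt hs.1)
          (lt_irrefl _)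
    have h1 : f.toFun s = f.c i := by
      rw [StepFunction.toFun, Finset.sum_eq_single i (fun j _ hj => indicator_of_notMem (hne j hj) _)
        (by simp), indicator_of_mem hi]
    rw [h1, Finset.sum_eq_single i (fun j _ hj => indicator_of_notMem (hne j hj) _) (by simp),
      indicator_of_mem hi]
  · push Not at h
    have h1 : f.toFun s = 0 :=
      Finset.sum_eq_zero fun i _ => indicator_of_notMem (h i) _
    rw [h1, hg]
    exact (Finset.sum_eq_zero fun i _ => indicator_of_notMem (h i) _).symm

lemma StepFunction.integral_comp (f : StepFunction (timeSet a b)) {p q : timeSet a b}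
    (hp : p ≤ f.u 0) (hq : f.u (Fin.last _) ≤ q) {g : ℝ → ℂ} (hg : g 0 = 0) :
    ∫ s in Ioc p q, g (f.toFun s) ∂r.absMeasure
      = ∑ i : Fin f.n, r.absMeasure.real (Ioc (f.u i.castSucc) (f.u i.succ)) * g (f.c i) := by
  simp_rw [f.comp_toFun_eq hg]
  rw [integral_finsetSum _ fun i _ => (integrable_const _).indicator measurableSet_Ioc]
  refine Finset.sum_congr rfl fun i _ => ?_
  have hsub : Ioc (f.u i.castSucc) (f.u i.succ) ⊆ Ioc p q :=
    Ioc_subset_Ioc (hp.trans (f.mono (Fin.zero_le _))) ((f.mono (Fin.le_last _)).trans hq)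
  rw [integral_indicator_const _ measurableSet_Ioc, measureReal_restrict_apply measurableSet_Ioc,
    inter_eq_self_of_subset_left hsub, Complex.real_smul]

lemma StepFunction.measurable_toFun (f : StepFunction (timeSet a b)) : Measurable f.toFun := by
  unfold StepFunction.toFun
  exact Finset.measurable_sum _ fun i _ => measurable_const.indicator measurableSet_Ioc

lemma StepFunction.memLp_toFun (f : StepFunction (timeSet a b)) (ν : Measure (timeSet a b))
    [IsFiniteMeasure ν] : MemLp f.toFun 2 ν := by
  refine .of_bound f.measurable_toFun.aestronglyMeasurable (∑ i, |f.c i|) (ae_of_all _ fun s => ?_)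
  refine norm_sum_le_of_le _ fun i _ => ?_
  rw [← Real.norm_eq_abs]
  exact norm_indicator_le_norm_self _ _

lemma measurable_stepIntegral (hY : ∀ t, Measurable (Y t)) (f : StepFunction (timeSet a b)) :
    Measurable (f.integral fun s => Y (r.toFun s)) := by
  unfold StepFunction.integral
  exact Finset.measurable_sum _ fun i _ => ((hY _).sub (hY _)).const_mul _

lemma IsLevyProcess.charFun_stepIntegral [IsProbabilityMeasure P] (hY : IsLevyProcess Y P) (hY1 : HasLaw (Y 1) μ P)
    (hψ : IsLogCharFun μ ψ) (f : StepFunction (timeSet a b)) {p q : timeSet a b}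
    (hp : p ≤ f.u 0) (hq : f.u (Fin.last _) ≤ q) (ξ : ℝ) :
    charFun (P.map (f.integral fun s => Y (r.toFun s))) ξ
      = Complex.exp (∫ s in Ioc p q, ψ (r.sign * f.toFun s * ξ) ∂r.absMeasure) := by
  rw [f.integral_comp hp hq (g := fun x => ψ (r.sign * x * ξ)) (by simp [hψ.zero]), Complex.exp_sum]
  have h1 := (hY.iIndepFun_increments (r := r) f).comp (fun i x => f.c i * x) fun i => by fun_prop
  have hm : ∀ i : Fin f.n, Measurable fun ω =>
      Y (r.toFun (f.u i.succ)) ω - Y (r.toFun (f.u i.castSucc)) ω :=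
    fun i => (hY.measurable _).sub (hY.measurable _)
  have h2 := h1.charFun_map_sum_eq_prod fun i =>
    ((measurable_const_mul (f.c i)).comp (hm i)).aemeasurable
  have h3 : (f.integral fun s => Y (r.toFun s)) = ∑ i : Fin f.n, (fun x => f.c i * x) ∘
      fun ω => Y (r.toFun (f.u i.succ)) ω - Y (r.toFun (f.u i.castSucc)) ω := by
    ext ω
    simp [StepFunction.integral]
  rw [h3, h2, Finset.prod_apply]
  refine Finset.prod_congr rfl fun i _ => ?_
  rw [← Measure.map_map (by fun_prop) (hm i), charFun_map_mul,
    hY.charFun_increment hY1 hψ (f.mono (Fin.castSucc_le_succ i))]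
  congr 3
  ring

lemma IsIntegralOn.aemeasurable {h : timeSet a b → ℝ} {p q : timeSet a b} {X : Ω → ℝ}
    (hX : IsIntegralOn P Y r h p q X) (hY : ∀ t, Measurable (Y t)) : AEMeasurable X P := by
  obtain ⟨f, -, -, hf⟩ := hX
  exact hf.aemeasurable fun n => (measurable_stepIntegral hY _).aemeasurable

lemma IsIntegralOn.charFun_eq [IsProbabilityMeasure P] {h : timeSet a b → ℝ} {p q : timeSet a b} {X : Ω → ℝ}
    (hX : IsIntegralOn P Y r h p q X) (hY : IsLevyProcess Y P) (hY1 : HasLaw (Y 1) μ P)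
    (hψ : IsLogCharFun μ ψ) {C : ℝ} (hC : 0 ≤ C) (hψC : ∀ u, ‖ψ u‖ ≤ C * (1 + u ^ 2))
    (hh : MemLp h 2 r.absMeasure) (ξ : ℝ) :
    charFun (P.map X) ξ = Complex.exp (∫ s in Ioc p q, ψ (r.sign * h s * ξ) ∂r.absMeasure) := by
  obtain ⟨f, hfu, hfh, hfX⟩ := hX
  obtain ⟨ns, hns, hlim⟩ := exists_seq_tendsto_integral_of_tendsto_eLpNorm
    (fun n => (f n).memLp_toFun (r.absMeasure.restrict (Ioc p q))) (hh.restrict _) hfh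
    (ψ := fun x => ψ (r.sign * x * ξ)) (hψ.continuous.comp (by fun_prop))
    (C := C * (1 + ξ ^ 2)) (by positivity) fun u => by
      refine (hψC _).trans ?_
      rw [mul_assoc C, mul_pow, mul_pow, r.sign_sq]
      gcongr
      nlinarith [sq_nonneg u, sq_nonneg ξ]
  have h1 : TendstoInMeasure P (fun n => (f (ns n)).integral fun s => Y (r.toFun s)) atTop X :=
    fun ε hε => (hfX ε hε).comp hns.tendsto_atTop
  have h2 := tendsto_charFun_of_tendstoInMeasure h1
    (fun n => (measurable_stepIntegral hY.measurable _).aemeasurable) ξ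
  refine tendsto_nhds_unique h2 (((Complex.continuous_exp.tendsto _).comp hlim).congr fun n => ?_)
  exact (hY.charFun_stepIntegral hY1 hψ _ (hfu _).1 (hfu _).2 ξ).symm

lemma nonempty_timeSet (hab : a < b) : Nonempty (timeSet a b) := by
  obtain ⟨x, hx1, hx2⟩ := EReal.lt_iff_exists_real_btwn.1 hab
  exact ⟨⟨x, hx1, hx2.le⟩⟩

lemma IsRandomIntegral.tendsto_charFun [IsProbabilityMeasure P] (hab : a < b) {h : timeSet a b → ℝ} {X : Ω → ℝ}
    (hX : IsRandomIntegral P Y r h X) (hY : IsLevyProcess Y P) (hY1 : HasLaw (Y 1) μ P)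
    (hψ : IsLogCharFun μ ψ) {C : ℝ} (hC : 0 ≤ C) (hψC : ∀ u, ‖ψ u‖ ≤ C * (1 + u ^ 2))
    (hh : MemLp h 2 r.absMeasure) (ξ : ℝ) :
    Tendsto (fun pq : timeSet a b × timeSet a b =>
      Complex.exp (∫ s in Ioc pq.1 pq.2, ψ (r.sign * h s * ξ) ∂r.absMeasure))
      (atBot ×ˢ atTop) (𝓝 (charFun (P.map X) ξ)) := by
  have := nonempty_timeSet hab
  obtain ⟨X', hX', hlim⟩ := hX
  have hle : ∀ᶠ pq : timeSet a b × timeSet a b in atBot ×ˢ atTop, pq.1 ≤ pq.2 := by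
    obtain ⟨s⟩ := nonempty_timeSet hab
    filter_upwards [(eventually_le_atBot s).prod_mk (eventually_ge_atTop s)] with pq hpq
    exact hpq.1.trans hpq.2
  -- Nothing is known about X' p q for p > q, not even measurability; taking the minimum repairs
  -- this and changes nothing eventually.
  have h1 : TendstoInMeasure P (fun pq : timeSet a b × timeSet a b => X' (min pq.1 pq.2) pq.2)
      (atBot ×ˢ atTop) X := by
    intro ε hε
    refine (hlim ε hε).congr' ?_
    filter_upwards [hle] with pq hpq
    rw [min_eq_left hpq]
  refine (tendsto_charFun_of_tendstoInMeasure h1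
    (fun pq => (hX' _ _ (min_le_right _ _)).aemeasurable hY.measurable) ξ).congr' ?_
  filter_upwards [hle] with pq hpq
  rw [min_eq_left hpq]
  exact (hX' _ _ hpq).charFun_eq hY hY1 hψ hC hψC hh ξ

end

/-! ### Scaling of Lévy exponents -/

/-- The correction of the shift of a triplet under scaling by `c`. -/
noncomputable def driftIntegrand (c x : ℝ) : ℝ := c * x * (1 / (1 + (c * x) ^ 2) - 1 / (1 + x ^ 2))

/-- The shift of the image under `x ↦ cx` of the law with triplet `(γ, σ², M)`. -/
noncomputable def scaledDrift (γ : ℝ) (M : Measure ℝ) (c : ℝ) : ℝ :=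
  c * γ + ∫ x, driftIntegrand c x ∂M

/-- The value at `it` of the Voiculescu transform of the free counterpart of the image under
`x ↦ cx` of the law with triplet `(γ, σ², M)`. -/
noncomputable def scaledVoiculescu (γ σ2 : ℝ) (M : Measure ℝ) (t c : ℝ) : ℂ :=
  scaledDrift γ M c + σ2 * c ^ 2 / (Complex.I * t) + ∫ x, freeIntegrand t (c * x) ∂M

lemma measurable_driftIntegrand : Measurable fun p : ℝ × ℝ => driftIntegrand p.1 p.2 := by
  unfold driftIntegrand; fun_prop

lemma abs_driftIntegrand_le (c x : ℝ) : |driftIntegrand c x| ≤ (1 + c ^ 2) * min 1 (x ^ 2) := by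
  have h1 : driftIntegrand c x
      = (1 - c ^ 2) * (c * x / (1 + (c * x) ^ 2)) * (x ^ 2 / (1 + x ^ 2)) := by
    rw [driftIntegrand]; field_simp; ring
  rw [h1, abs_mul, abs_mul, abs_of_nonneg (by positivity : 0 ≤ x ^ 2 / (1 + x ^ 2))]
  have h2 : |1 - c ^ 2| ≤ 1 + c ^ 2 := abs_le.2 ⟨by nlinarith [sq_nonneg c], by nlinarith [sq_nonneg c]⟩
  have h3 : |c * x / (1 + (c * x) ^ 2)| ≤ 1 := by
    rw [abs_div, abs_of_pos (by positivity : 0 < 1 + (c * x) ^ 2), div_le_one (by positivity),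
      ← sq_abs (c * x)]
    nlinarith [sq_nonneg (|c * x| - 1), abs_nonneg (c * x)]
  calc _ ≤ (1 + c ^ 2) * 1 * min 1 (x ^ 2) := by
        gcongr
        exact sq_div_one_add_sq_le x
    _ = _ := by ring

lemma min_one_mul_sq_le (c x : ℝ) : min 1 ((c * x) ^ 2) ≤ (1 + c ^ 2) * min 1 (x ^ 2) := by
  rcases le_total 1 (x ^ 2) with h | h
  · rw [min_eq_left h]
    exact (min_le_left _ _).trans (by nlinarith [sq_nonneg c])
  · rw [min_eq_right h]
    exact (min_le_right _ _).trans (by nlinarith [sq_nonneg c, sq_nonneg x, sq_nonneg (c * x)])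

section Scaling

variable {γ σ2 : ℝ} {M : Measure ℝ}

lemma integrable_min_one_mul_sq (hM : Integrable (fun x : ℝ => min 1 (x ^ 2)) M) (c : ℝ) :
    Integrable (fun x : ℝ => min 1 ((c * x) ^ 2)) M :=
  (hM.const_mul (1 + c ^ 2)).mono' (by fun_prop) (ae_of_all _ fun x => by
    rw [Real.norm_of_nonneg (by positivity)]; exact min_one_mul_sq_le c x)

lemma integrable_driftIntegrand (hM : Integrable (fun x : ℝ => min 1 (x ^ 2)) M) (c : ℝ) :
    Integrable (driftIntegrand c) M :=
  (hM.const_mul (1 + c ^ 2)).mono'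
    (measurable_driftIntegrand.comp measurable_prodMk_left).aestronglyMeasurable
    (ae_of_all _ (abs_driftIntegrand_le c))

lemma abs_scaledDrift_le (hM : Integrable (fun x : ℝ => min 1 (x ^ 2)) M) (c : ℝ) :
    |scaledDrift γ M c| ≤ (|γ| + ∫ x : ℝ, min 1 (x ^ 2) ∂M) * (1 + c ^ 2) := by
  have h1 : |∫ x, driftIntegrand c x ∂M| ≤ (1 + c ^ 2) * ∫ x : ℝ, min 1 (x ^ 2) ∂M := by
    rw [← integral_const_mul]
    exact norm_integral_le_of_norm_le (f := driftIntegrand c) (hM.const_mul _)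
      (ae_of_all _ (abs_driftIntegrand_le c))
  have h2 : |c| ≤ 1 + c ^ 2 := by rw [← sq_abs]; nlinarith [sq_nonneg (|c| - 1), abs_nonneg c]
  calc _ ≤ |c * γ| + |∫ x, driftIntegrand c x ∂M| := abs_add_le _ _
    _ ≤ (1 + c ^ 2) * |γ| + (1 + c ^ 2) * ∫ x : ℝ, min 1 (x ^ 2) ∂M := by
        rw [abs_mul]; gcongr
    _ = _ := by ring

lemma measurable_scaledDrift [SFinite M] : Measurable (scaledDrift γ M) := by
  unfold scaledDrift
  exact (measurable_id.mul_const γ).add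
    (measurable_driftIntegrand.stronglyMeasurable.integral_prod_right (ν := M)).measurable

/-- Scaling the jumps changes the compensator by a term linear in ξ, that is, by a shift. -/
lemma levyIntegrand_mul (c ξ x : ℝ) : levyIntegrand (c * ξ) x
    = levyIntegrand ξ (c * x) + Complex.I * ξ * (driftIntegrand c x : ℝ) := by
  rw [levyIntegrand, levyIntegrand, driftIntegrand]
  have h1 : Complex.I * ((c * ξ : ℝ) : ℂ) * x = Complex.I * ξ * ((c * x : ℝ) : ℂ) := by
    push_cast; ring
  rw [h1]
  push_cast
  ring

lemma levyExponent_mul (hM : Integrable (fun x : ℝ => min 1 (x ^ 2)) M) (c ξ : ℝ) :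
    levyExponent γ σ2 M (c * ξ) = Complex.I * ξ * scaledDrift γ M c
      + -(σ2 * ξ ^ 2 / 2) * (c ^ 2 : ℝ) + ∫ x, levyIntegrand ξ (c * x) ∂M := by
  have h1 : Integrable (fun x => levyIntegrand ξ (c * x)) M :=
    ((integrable_min_one_mul_sq hM c).const_mul (3 * (1 + ξ ^ 2))).mono'
      (continuous_levyIntegrand.comp (by fun_prop : Continuous fun x : ℝ => (ξ, c * x))).aestronglyMeasurable
      (ae_of_all _ fun x => norm_levyIntegrand_le ξ (c * x))
  have h2 : Integrable (fun x => Complex.I * ξ * (driftIntegrand c x : ℝ)) M :=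
    (integrable_driftIntegrand hM c).ofReal.const_mul _
  simp only [levyExponent, levyIntegrand_mul]
  rw [integral_add h1 h2, integral_const_mul, integral_complex_ofReal, scaledDrift]
  push_cast
  ring

lemma freeIntegrand_mul_eq (t c x : ℝ) : freeIntegrand t (c * x) + (driftIntegrand c x : ℝ)
    = c * x * (1 / (1 + Complex.I * (c * x) / t) - 1 / (1 + x ^ 2)) := by
  rw [freeIntegrand, driftIntegrand]
  push_cast
  ring

lemma integrable_freeIntegrand_mul (hM : Integrable (fun x : ℝ => min 1 (x ^ 2)) M) {t : ℝ}
    (ht : t ≠ 0) (c : ℝ) : Integrable (fun x => freeIntegrand t (c * x)) M :=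
  ((integrable_min_one_mul_sq hM c).const_mul _).mono'
    (measurable_freeIntegrand.comp (by fun_prop : Measurable fun x : ℝ => (t, c * x))).aestronglyMeasurable
    (ae_of_all _ fun x => norm_freeIntegrand_le ht (c * x))

/-- Merging the shift correction with the jump part restores the compensator 1/(1+x²) of M, the one
in the final formula. -/
lemma scaledVoiculescu_eq (hM : Integrable (fun x : ℝ => min 1 (x ^ 2)) M) {t : ℝ} (ht : t ≠ 0)
    (c : ℝ) : scaledVoiculescu γ σ2 M t c = c * γ + σ2 * c ^ 2 / (Complex.I * t)
      + ∫ x : ℝ, c * x * (1 / (1 + Complex.I * (c * x) / t) - 1 / (1 + x ^ 2)) ∂M := by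
  simp only [← freeIntegrand_mul_eq]
  have h1 : Integrable (fun x => ((driftIntegrand c x : ℝ) : ℂ)) M :=
    (integrable_driftIntegrand hM c).ofReal
  rw [integral_add (integrable_freeIntegrand_mul hM ht c) h1,
    integral_complex_ofReal, scaledVoiculescu, scaledDrift]
  push_cast
  ring

end Scaling

/-! ### Convergence of shifts and of Lévy measures -/

/-- No branch of the logarithm is needed: integrating over [0, δ] gives iΓ ∫ e^{iξΓ} dξ = e^{iδΓ} -
1. For small δ the integrals have a nonzero limit J, since χ is near 1, and the equation can be
solved for Γ. -/
lemma exists_tendsto_of_tendsto_exp {ι : Type*} {l : Filter ι} [l.NeBot] [l.IsCountablyGenerated]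
    {Γ : ι → ℝ} {χ : ℝ → ℂ} (hχ : Continuous χ) (h0 : χ 0 = 1)
    (hlim : ∀ ξ : ℝ, Tendsto (fun i => Complex.exp (Complex.I * ξ * Γ i)) l (𝓝 (χ ξ))) :
    ∃ Γ' : ℝ, Tendsto Γ l (𝓝 Γ') ∧ ∀ ξ : ℝ, χ ξ = Complex.exp (Complex.I * ξ * Γ') := by
  obtain ⟨δ, hδ, hball⟩ : ∃ δ > 0, ∀ ξ ∈ Icc (0 : ℝ) δ, ‖χ ξ - 1‖ ≤ 1 / 2 := by
    have h1 : ∀ᶠ ξ in 𝓝 (0 : ℝ), ‖χ ξ - 1‖ < 1 / 2 := by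
      have : ContinuousAt (fun ξ => ‖χ ξ - 1‖) 0 := (hχ.sub continuous_const).norm.continuousAt
      exact this.eventually_lt_const (by simp [h0])
    obtain ⟨δ, hδ, h⟩ := Metric.eventually_nhds_iff_ball.1 h1
    refine ⟨δ / 2, half_pos hδ, fun ξ hξ => (h ξ ?_).le⟩
    rw [Metric.mem_ball, dist_zero_right, Real.norm_of_nonneg hξ.1]
    linarith [hξ.2]
  set J : ℂ := ∫ ξ in (0 : ℝ)..δ, χ ξ with hJ
  have hJ0 : J ≠ 0 := by
    have h1 : ‖∫ ξ in (0 : ℝ)..δ, (χ ξ - 1)‖ ≤ 1 / 2 * |δ - 0| :=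
      intervalIntegral.norm_integral_le_of_norm_le_const fun ξ hξ => by
        rw [uIoc_of_le hδ.le] at hξ
        exact hball ξ ⟨hξ.1.le, hξ.2⟩
    rw [intervalIntegral.integral_sub (hχ.intervalIntegrable _ _) (by simp)] at h1
    intro h
    rw [← hJ, h] at h1
    simp [abs_of_pos hδ] at h1
    linarith
  have hJlim : Tendsto (fun i => ∫ ξ in (0 : ℝ)..δ, Complex.exp (Complex.I * ξ * Γ i)) l (𝓝 J) := by
    refine intervalIntegral.tendsto_integral_filter_of_dominated_convergence (fun _ => 1)
      (Eventually.of_forall fun i => Continuous.aestronglyMeasurable (by fun_prop))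
      (Eventually.of_forall fun i => ae_of_all _ fun ξ _ => ?_) (by simp)
      (ae_of_all _ fun ξ _ => hlim ξ)
    rw [show Complex.I * ξ * Γ i = ((ξ * Γ i : ℝ) : ℂ) * Complex.I by push_cast; ring,
      Complex.norm_exp_ofReal_mul_I]
  have heq : ∀ i, Complex.I * Γ i * ∫ ξ in (0 : ℝ)..δ, Complex.exp (Complex.I * ξ * Γ i)
      = Complex.exp (Complex.I * δ * Γ i) - 1 := by
    intro i
    rcases eq_or_ne (Γ i) 0 with h | h
    · simp [h]
    · have hc : Complex.I * Γ i ≠ 0 := mul_ne_zero Complex.I_ne_zero (by exact_mod_cast h)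
      have h1 := integral_exp_mul_complex (a := 0) (b := δ) hc
      simp only [mul_right_comm Complex.I _ (Γ i : ℂ), h1]
      rw [mul_div_cancel₀ _ hc]
      simp
  have hlimC : Tendsto (fun i => (Γ i : ℂ)) l (𝓝 ((χ δ - 1) / (Complex.I * J))) := by
    have h1 := ((hlim δ).sub_const 1).div (hJlim.const_mul Complex.I)
      (mul_ne_zero Complex.I_ne_zero hJ0)
    refine h1.congr' ?_
    filter_upwards [hJlim.eventually_ne hJ0] with i hi
    simp only [Pi.div_apply]
    rw [← heq i, div_eq_iff (mul_ne_zero Complex.I_ne_zero hi)]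
    ring
  have hre : Tendsto Γ l (𝓝 ((χ δ - 1) / (Complex.I * J)).re) := by
    exact (Complex.continuous_re.tendsto _).comp hlimC
  refine ⟨_, hre, fun ξ => tendsto_nhds_unique (hlim ξ) ?_⟩
  have hc : Continuous fun x : ℝ => Complex.exp (Complex.I * ξ * x) := by fun_prop
  exact (hc.tendsto _).comp hre

/-- If δ|y| ≤ π, then 1 - cos θ ≥ 2θ²/π² applies throughout; otherwise the integral is δ -
sin(δy)/y, at least δ/2. The two cases are the two terms of κ. -/
lemma exists_le_lintegral_one_sub_cos {δ : ℝ} (hδ : 0 < δ) : ∃ κ : ℝ, 0 < κ ∧ ∀ y : ℝ,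
    ENNReal.ofReal (κ * min 1 (y ^ 2))
      ≤ ∫⁻ ξ in Ioc 0 δ, ENNReal.ofReal (1 - Real.cos (ξ * y)) := by
  have hπ := Real.pi_pos
  refine ⟨min (δ / 2) (2 / Real.pi ^ 2 * (δ ^ 3 / 3)), by positivity, fun y => ?_⟩
  have hnn : ∀ ξ : ℝ, 0 ≤ 1 - Real.cos (ξ * y) := fun ξ => sub_nonneg.2 (Real.cos_le_one _)
  have hcont : Continuous fun ξ : ℝ => 1 - Real.cos (ξ * y) := by fun_prop
  rw [← ofReal_integral_eq_lintegral_ofReal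
    (hcont.integrableOn_Ioc) (ae_of_all _ hnn), ← intervalIntegral.integral_of_le hδ.le]
  refine ENNReal.ofReal_le_ofReal ?_
  rcases le_or_gt (δ * |y|) Real.pi with h | h
  · calc _ ≤ 2 / Real.pi ^ 2 * (δ ^ 3 / 3) * y ^ 2 := by
          gcongr
          · exact min_le_right _ _
          · exact min_le_right _ _
      _ = ∫ ξ in (0 : ℝ)..δ, 2 / Real.pi ^ 2 * (ξ * y) ^ 2 := by
          simp only [mul_pow]
          rw [intervalIntegral.integral_const_mul, intervalIntegral.integral_mul_const, integral_pow]
          norm_num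
          ring
      _ ≤ _ := by
          refine intervalIntegral.integral_mono_on hδ.le
            (Continuous.intervalIntegrable (by fun_prop) _ _) (hcont.intervalIntegrable _ _)
            fun ξ hξ => ?_
          have h1 : |ξ * y| ≤ Real.pi := by
            rw [abs_mul, abs_of_nonneg hξ.1]
            exact (mul_le_mul_of_nonneg_right hξ.2 (abs_nonneg y)).trans h
          linarith [Real.cos_le_one_sub_mul_cos_sq h1]
  · have hy : y ≠ 0 := by rintro rfl; simp at h; linarith
    have h1 : ∫ ξ in (0 : ℝ)..δ, (1 - Real.cos (ξ * y)) = δ - Real.sin (δ * y) / y := by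
      rw [intervalIntegral.integral_sub (by simp) (Continuous.intervalIntegrable (by fun_prop) _ _),
        intervalIntegral.integral_comp_mul_right _ hy]
      simp
      ring
    have hy0 : 0 < |y| := abs_pos.2 hy
    have h2 : Real.sin (δ * y) / y ≤ δ / 2 := by
      refine (le_abs_self _).trans ?_
      rw [abs_div, div_le_iff₀ hy0]
      have := Real.abs_sin_le_one (δ * y)
      have := Real.pi_gt_three
      linarith
    rw [h1]
    calc _ ≤ δ / 2 * 1 := by
          gcongr
          · exact min_le_left _ _
          · exact min_le_left _ _
      _ ≤ _ := by linarith

/-! ### Limits of compositions of a Lévy exponent -/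

lemma re_levyIntegrand (ξ x : ℝ) : (levyIntegrand ξ x).re = Real.cos (ξ * x) - 1 := by
  have h1 : Complex.I * ξ * x / (1 + x ^ 2) = ((ξ * x / (1 + x ^ 2) : ℝ) : ℂ) * Complex.I := by
    push_cast; ring
  have h2 : Complex.I * ξ * x = ((ξ * x : ℝ) : ℂ) * Complex.I := by push_cast; ring
  rw [levyIntegrand, h1, h2, Complex.sub_re, Complex.sub_re, Complex.exp_ofReal_mul_I_re,
    Complex.re_ofReal_mul, Complex.I_re]
  simp

lemma re_levyExponent {γ σ2 : ℝ} {M : Measure ℝ}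
    (hM : Integrable (fun x : ℝ => min 1 (x ^ 2)) M) (ξ : ℝ) :
    (levyExponent γ σ2 M ξ).re
      = -(σ2 * ξ ^ 2 / 2) - ∫ x, (1 - Real.cos (ξ * x)) ∂M := by
  have h2 : ∫ x, (1 - Real.cos (ξ * x)) ∂M = -(∫ x, levyIntegrand ξ x ∂M).re := by
    have := integral_re (integrable_levyIntegrand hM ξ)
    simp only [RCLike.re_to_complex, re_levyIntegrand] at this
    rw [← this, ← integral_neg]
    simp
  have h3 : (Complex.I * ξ * γ - σ2 * ξ ^ 2 / 2).re = -(σ2 * ξ ^ 2 / 2) := by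
    have : Complex.I * ξ * γ - σ2 * ξ ^ 2 / 2
        = ((ξ * γ : ℝ) : ℂ) * Complex.I - ((σ2 * ξ ^ 2 / 2 : ℝ) : ℂ) := by push_cast; ring
    rw [this, Complex.sub_re, Complex.re_ofReal_mul, Complex.I_re, Complex.ofReal_re]
    ring
  rw [levyExponent, Complex.add_re, h3, h2]
  ring

lemma re_levyExponent_nonpos {γ σ2 : ℝ} {M : Measure ℝ} (hσ : 0 ≤ σ2)
    (hM : Integrable (fun x : ℝ => min 1 (x ^ 2)) M) (ξ : ℝ) :
    (levyExponent γ σ2 M ξ).re ≤ 0 := by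
  have h1 : 0 ≤ σ2 * ξ ^ 2 / 2 := by positivity
  have h2 : 0 ≤ ∫ x, (1 - Real.cos (ξ * x)) ∂M :=
    integral_nonneg fun x => sub_nonneg.2 (Real.cos_le_one _)
  rw [re_levyExponent hM]
  linarith

lemma lintegral_one_sub_cos_le {γ σ2 : ℝ} {M : Measure ℝ} (hσ : 0 ≤ σ2)
    (hM : Integrable (fun x : ℝ => min 1 (x ^ 2)) M) (ξ : ℝ) :
    ∫⁻ x, ENNReal.ofReal (1 - Real.cos (ξ * x)) ∂M
      ≤ ENNReal.ofReal (-(levyExponent γ σ2 M ξ).re) := by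
  have h1 : Integrable (fun x => 1 - Real.cos (ξ * x)) M := by
    refine (integrable_levyIntegrand hM ξ).re.neg.congr (ae_of_all _ fun x => ?_)
    simp [re_levyIntegrand]
  rw [← ofReal_integral_eq_lintegral_ofReal h1
    (ae_of_all _ fun x => sub_nonneg.2 (Real.cos_le_one _)), re_levyExponent hM]
  refine ENNReal.ofReal_le_ofReal ?_
  have : 0 ≤ σ2 * ξ ^ 2 / 2 := by positivity
  linarith

lemma lintegral_comp_swap {S : Type*} [MeasurableSpace S] {m : Measure S} [SFinite m]
    {y : S → ℝ} (hy : AEMeasurable y m) {κ : Measure ℝ} [SFinite κ] {k : ℝ × ℝ → ℝ≥0∞}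
    (hk : Measurable k) :
    ∫⁻ p, (∫⁻ ξ, k (ξ, y p) ∂κ) ∂m = ∫⁻ ξ, (∫⁻ p, k (ξ, y p) ∂m) ∂κ := by
  have h2 : AEMeasurable (fun q : S × ℝ => (q.2, y q.1)) (m.prod κ) :=
    measurable_snd.aemeasurable.prodMk hy.comp_fst
  exact lintegral_lintegral_swap (f := fun p ξ => k (ξ, y p)) (hk.comp_aemeasurable h2)

/-! ### The Lévy triplet of a limit along an exhaustion `A`. -/

section

variable {T : Type*} [MeasurableSpace T] {ν : Measure T} {c : T → ℝ} {ι : Type*} {l : Filter ι}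
  {A : ι → Set T} {γ σ2 : ℝ} {M : Measure ℝ}

lemma integrable_levyExponent_comp [IsFiniteMeasure ν] (hc : MemLp c 2 ν)
    (hM : Integrable (fun x : ℝ => min 1 (x ^ 2)) M) (ξ : ℝ) :
    Integrable (fun s => levyExponent γ σ2 M (c s * ξ)) ν := by
  refine (((integrable_const 1).add (hc.integrable_sq.const_mul (ξ ^ 2))).const_mul
    (levyConst γ σ2 M)).mono' ((continuous_levyExponent hM).comp_aestronglyMeasurable
      (hc.1.mul_const ξ)) (ae_of_all _ fun s => (norm_levyExponent_le hM _).trans (le_of_eq ?_))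
  simp only [Pi.add_apply]
  ring

lemma aemeasurable_mul_prod (hc : AEMeasurable c ν) :
    AEMeasurable (fun p : T × ℝ => c p.1 * p.2) (ν.prod M) :=
  hc.comp_fst.mul measurable_snd.aemeasurable

/-- Since re ψ ≤ 0, the quantity -log |φ(ξ)| bounds ∬ (1 - cos(ξcx)). For ξ in some (0, δ] it is at
most log 2, and averaging over these ξ replaces 1 - cos by a multiple of min(1, (cx)²). -/
lemma integrable_min_prod_of_tendsto [SigmaFinite ν] [SigmaFinite M] [l.NeBot]
    [l.IsCountablyGenerated] (hc : MemLp c 2 ν) (hσ : 0 ≤ σ2)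
    (hM : Integrable (fun x : ℝ => min 1 (x ^ 2)) M)
    (hA : AECover ν l A) (hAfin : ∀ i, ν (A i) < ∞) {φ : ℝ → ℂ} (hφ : Continuous φ) (hφ0 : φ 0 = 1)
    (hlim : ∀ ξ, Tendsto (fun i => Complex.exp (∫ s in A i, levyExponent γ σ2 M (c s * ξ) ∂ν)) l
      (𝓝 (φ ξ))) :
    Integrable (fun p : T × ℝ => min 1 ((c p.1 * p.2) ^ 2)) (ν.prod M) := by
  have hy := aemeasurable_mul_prod (M := M) hc.1.aemeasurable
  have hcos : ∀ ξ : ℝ, AEMeasurable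
      (fun p : T × ℝ => ENNReal.ofReal (1 - Real.cos (ξ * (c p.1 * p.2)))) (ν.prod M) := fun ξ => by
    have : Measurable fun y : ℝ => ENNReal.ofReal (1 - Real.cos (ξ * y)) := by fun_prop
    exact this.comp_aemeasurable hy
  have hbound : ∀ ξ, φ ξ ≠ 0 →
      ∫⁻ p, ENNReal.ofReal (1 - Real.cos (ξ * (c p.1 * p.2))) ∂(ν.prod M)
        ≤ ENNReal.ofReal (-Real.log ‖φ ξ‖) := by
    intro ξ hξ
    rw [lintegral_prod _ (hcos ξ)]
    have h1 := hA.lintegral_tendsto_of_countably_generated (hcos ξ).lintegral_prod_right'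
    have h2 : Tendsto (fun i => ENNReal.ofReal
        (-Real.log ‖Complex.exp (∫ s in A i, levyExponent γ σ2 M (c s * ξ) ∂ν)‖)) l
        (𝓝 (ENNReal.ofReal (-Real.log ‖φ ξ‖))) :=
      (ENNReal.continuous_ofReal.tendsto _).comp
        (((hlim ξ).norm.log (norm_ne_zero_iff.2 hξ)).neg)
    refine le_of_tendsto_of_tendsto' h1 h2 fun i => ?_
    have : IsFiniteMeasure (ν.restrict (A i)) := ⟨by simpa using hAfin i⟩
    have hint := integrable_levyExponent_comp (γ := γ) (σ2 := σ2) (hc.restrict (A i)) hM ξ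
    have hre := integral_re hint
    simp only [RCLike.re_to_complex] at hre
    have hire : Integrable (fun s => -(levyExponent γ σ2 M (c s * ξ)).re) (ν.restrict (A i)) :=
      hint.re.neg
    rw [Complex.norm_exp, Real.log_exp, ← hre, ← integral_neg,
      ofReal_integral_eq_lintegral_ofReal hire
        (ae_of_all _ fun s => neg_nonneg.2 (re_levyExponent_nonpos hσ hM _))]
    refine lintegral_mono fun s => ?_
    refine le_trans (le_of_eq ?_) (lintegral_one_sub_cos_le hσ hM (c s * ξ))
    refine lintegral_congr fun x => ?_
    rw [show ξ * (c s * x) = c s * ξ * x by ring]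
  obtain ⟨δ, hδ, hball⟩ : ∃ δ > 0, ∀ ξ ∈ Ioc (0 : ℝ) δ, 1 / 2 < ‖φ ξ‖ := by
    have h1 : ∀ᶠ ξ in 𝓝 (0 : ℝ), 1 / 2 < ‖φ ξ‖ :=
      hφ.norm.continuousAt.eventually_const_lt (by simp [hφ0]; norm_num)
    obtain ⟨δ, hδ, h⟩ := Metric.eventually_nhds_iff_ball.1 h1
    refine ⟨δ / 2, half_pos hδ, fun ξ hξ => h ξ ?_⟩
    rw [Metric.mem_ball, dist_zero_right, Real.norm_of_nonneg hξ.1.le]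
    linarith [hξ.2]
  obtain ⟨κ, hκ, hκle⟩ := exists_le_lintegral_one_sub_cos hδ
  have hfin : ∫⁻ p, ENNReal.ofReal (κ * min 1 ((c p.1 * p.2) ^ 2)) ∂(ν.prod M) < ∞ := by
    calc _ ≤ ∫⁻ p, (∫⁻ ξ in Ioc 0 δ, ENNReal.ofReal (1 - Real.cos (ξ * (c p.1 * p.2)))) ∂(ν.prod M) :=
          lintegral_mono fun p => hκle _
      _ = ∫⁻ ξ in Ioc 0 δ, ∫⁻ p, ENNReal.ofReal (1 - Real.cos (ξ * (c p.1 * p.2))) ∂(ν.prod M) := by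
          exact lintegral_comp_swap hy
            (k := fun q => ENNReal.ofReal (1 - Real.cos (q.1 * q.2))) (by fun_prop)
      _ ≤ ∫⁻ ξ in Ioc 0 δ, ENNReal.ofReal (Real.log 2) := by
          refine setLIntegral_mono measurable_const fun ξ hξ => ?_
          have h1 := hball ξ hξ
          have h0 : 0 < ‖φ ξ‖ := by linarith
          refine (hbound ξ (norm_pos_iff.1 h0)).trans (ENNReal.ofReal_le_ofReal ?_)
          rw [← Real.log_inv]
          refine Real.log_le_log (by positivity) ?_
          rw [inv_le_comm₀ h0 two_pos]
          linarith
      _ < ∞ := by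
          rw [setLIntegral_const]
          exact ENNReal.mul_lt_top ENNReal.ofReal_lt_top (by simp)
  have hmeas : AEStronglyMeasurable (fun p : T × ℝ => κ * min 1 ((c p.1 * p.2) ^ 2)) (ν.prod M) := by
    have : Measurable fun y : ℝ => κ * min 1 (y ^ 2) := by fun_prop
    exact (this.comp_aemeasurable hy).aestronglyMeasurable
  have hi := (lintegral_ofReal_ne_top_iff_integrable hmeas
    (ae_of_all _ fun p => by positivity)).1 hfin.ne
  refine (hi.const_mul κ⁻¹).congr (ae_of_all _ fun p => ?_)
  simp only
  rw [← mul_assoc, inv_mul_cancel₀ hκ.ne', one_mul]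

/-- The Lévy measure of a random integral: the image of `ν ⊗ M` under `(s, x) ↦ c(s) x` off `0`. -/
noncomputable def scaledLevyMeasure (ν : Measure T) (c : T → ℝ) (M : Measure ℝ) : Measure ℝ :=
  ((ν.prod M).map fun p => c p.1 * p.2).restrict {0}ᶜ

lemma integral_scaledLevyMeasure (hc : AEMeasurable c ν) {F : ℝ → ℂ} (hF : Measurable F)
    (h0 : F 0 = 0) :
    ∫ y, F y ∂(scaledLevyMeasure ν c M) = ∫ p, F (c p.1 * p.2) ∂(ν.prod M) := by
  rw [scaledLevyMeasure, setIntegral_eq_integral_of_forall_compl_eq_zero,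
    integral_map (aemeasurable_mul_prod hc) hF.aestronglyMeasurable]
  intro x hx
  simp only [mem_compl_iff, mem_singleton_iff, not_not] at hx
  rw [hx, h0]

lemma tendsto_setIntegral_prod [SigmaFinite ν] [SigmaFinite M] [l.IsCountablyGenerated]
    (hA : AECover ν l A) {F : T × ℝ → ℂ}
    (hF : Integrable F (ν.prod M)) :
    Tendsto (fun i => ∫ s in A i, (∫ x, F (s, x) ∂M) ∂ν) l (𝓝 (∫ p, F p ∂(ν.prod M))) := by
  rw [integral_prod _ hF]
  exact hA.integral_tendsto_of_countably_generated hF.integral_prod_left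

/-- Gaussian and jump parts are integrable over the whole space. Only the shift may converge
conditionally; dividing the characteristic functions by the convergent rest isolates e^{iξΓ_i} and
forces Γ_i to converge. The Voiculescu transforms are built from the same three pieces, so they
converge too. -/
theorem exists_hasLevyTriplet_of_tendsto [SigmaFinite ν] [SigmaFinite M] [l.NeBot]
    [l.IsCountablyGenerated] (hc : MemLp c 2 ν) (hσ : 0 ≤ σ2)
    (hM : Integrable (fun x : ℝ => min 1 (x ^ 2)) M)
    (hA : AECover ν l A) (hAfin : ∀ i, ν (A i) < ∞) {ρ : Measure ℝ} [IsProbabilityMeasure ρ]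
    (hlim : ∀ ξ, Tendsto (fun i => Complex.exp (∫ s in A i, levyExponent γ σ2 M (c s * ξ) ∂ν)) l
      (𝓝 (charFun ρ ξ))) :
    ∃ Γ σ2' : ℝ, ∃ M' : Measure ℝ, HasLevyTriplet ρ Γ σ2' M' ∧ ∀ t : ℝ, 0 < t →
      Tendsto (fun i => ∫ s in A i, scaledVoiculescu γ σ2 M t (c s) ∂ν) l
        (𝓝 (levyVoiculescu Γ σ2' M' (Complex.I * t))) := by
  have hcm := hc.1.aemeasurable
  have hy := aemeasurable_mul_prod (M := M) hcm
  have hmin := integrable_min_prod_of_tendsto hc hσ hM hA hAfin continuous_charFun (by simp) hlim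
  have hint : ∀ {F : ℝ → ℂ}, Measurable F → ∀ {C : ℝ}, (∀ y, ‖F y‖ ≤ C * min 1 (y ^ 2)) →
      Integrable (fun p : T × ℝ => F (c p.1 * p.2)) (ν.prod M) := fun {F} hF {C} hFC =>
    (hmin.const_mul C).mono' (hF.comp_aemeasurable hy).aestronglyMeasurable
      (ae_of_all _ fun p => hFC _)
  have hk : ∀ ξ : ℝ, Measurable (levyIntegrand ξ) := fun ξ =>
    (continuous_levyIntegrand.comp (Continuous.prodMk_right ξ)).measurable
  have hf : ∀ t : ℝ, Measurable (freeIntegrand t) := fun t =>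
    measurable_freeIntegrand.comp measurable_prodMk_left
  set M' := scaledLevyMeasure ν c M with hM'
  have hM'0 : M' {0} = 0 := by
    rw [hM', scaledLevyMeasure, Measure.restrict_apply (measurableSet_singleton 0)]
    simp
  have hM'fin : ∫⁻ y, ENNReal.ofReal (min 1 (y ^ 2)) ∂M' < ∞ := by
    refine (setLIntegral_le_lintegral _ _).trans_lt ?_
    rw [lintegral_map' (by fun_prop) hy]
    have h1 : 0 ≤ᵐ[ν.prod M] fun p : T × ℝ => min 1 ((c p.1 * p.2) ^ 2) :=
      ae_of_all _ fun p => by positivity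
    exact ((lintegral_ofReal_ne_top_iff_integrable hmin.1 h1).2 hmin).lt_top
  have hM'int := integrable_min_one_sq hM'fin
  set d := ∫ s, c s ^ 2 ∂ν with hd
  have hd0 : 0 ≤ d := integral_nonneg fun s => sq_nonneg _
  have hsqC : Integrable (fun s => ((c s ^ 2 : ℝ) : ℂ)) ν := hc.integrable_sq.ofReal
  have hDlim : Tendsto (fun i => ∫ s in A i, ((c s ^ 2 : ℝ) : ℂ) ∂ν) l (𝓝 (d : ℂ)) := by
    have := hA.integral_tendsto_of_countably_generated hsqC
    rwa [integral_complex_ofReal] at this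
  have hdrift : ∀ i, IntegrableOn (fun s => scaledDrift γ M (c s)) (A i) ν := fun i => by
    have : IsFiniteMeasure (ν.restrict (A i)) := ⟨by simpa using hAfin i⟩
    refine (((integrable_const 1).add (hc.restrict (A i)).integrable_sq).const_mul
      (|γ| + ∫ x : ℝ, min 1 (x ^ 2) ∂M)).mono'
      (measurable_scaledDrift.comp_aemeasurable hcm.restrict).aestronglyMeasurable
      (ae_of_all _ fun s => abs_scaledDrift_le hM (c s))
  have hdriftC : ∀ i, IntegrableOn (fun s => ((scaledDrift γ M (c s) : ℝ) : ℂ)) (A i) ν :=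
    fun i => (hdrift i).ofReal
  set Γ : ι → ℝ := fun i => ∫ s in A i, scaledDrift γ M (c s) ∂ν with hΓ
  have hkprod : ∀ ξ, Integrable (fun p : T × ℝ => levyIntegrand ξ (c p.1 * p.2)) (ν.prod M) :=
    fun ξ => hint (hk ξ) (norm_levyIntegrand_le ξ)
  have hψ : ∀ i ξ, ∫ s in A i, levyExponent γ σ2 M (c s * ξ) ∂ν
      = Complex.I * ξ * Γ i + (-(σ2 * ξ ^ 2 / 2) * ∫ s in A i, ((c s ^ 2 : ℝ) : ℂ) ∂ν
        + ∫ s in A i, (∫ x, levyIntegrand ξ (c s * x) ∂M) ∂ν) := fun i ξ => by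
    have hi3 : IntegrableOn (fun s => ∫ x, levyIntegrand ξ (c s * x) ∂M) (A i) ν :=
      (hkprod ξ).integral_prod_left.integrableOn
    have hi1 := (hdriftC i).const_mul (Complex.I * ξ)
    have hi2 := (hsqC.integrableOn (s := A i)).const_mul (-(σ2 * ξ ^ 2 / 2 : ℂ))
    have hi12 : IntegrableOn (fun s => Complex.I * ξ * (scaledDrift γ M (c s) : ℂ)
        + -(σ2 * ξ ^ 2 / 2 : ℂ) * ((c s ^ 2 : ℝ) : ℂ)) (A i) ν := hi1.add hi2
    simp_rw [levyExponent_mul hM]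
    rw [integral_add hi12 hi3, integral_add hi1 hi2, integral_const_mul, integral_const_mul,
      integral_complex_ofReal, add_assoc]
  have hψlim : ∀ ξ, Tendsto (fun i => -(σ2 * ξ ^ 2 / 2) * ∫ s in A i, ((c s ^ 2 : ℝ) : ℂ) ∂ν
        + ∫ s in A i, (∫ x, levyIntegrand ξ (c s * x) ∂M) ∂ν) l
      (𝓝 (levyExponent 0 (σ2 * d) M' ξ)) := fun ξ => by
    have h1 := (hDlim.const_mul (-(σ2 * ξ ^ 2 / 2 : ℂ))).add
      (tendsto_setIntegral_prod hA (hkprod ξ))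
    convert h1 using 2
    rw [levyExponent, integral_scaledLevyMeasure hcm (hk ξ) (by simp [levyIntegrand])]
    push_cast
    ring
  have hΓlim : ∀ ξ : ℝ, Tendsto (fun i => Complex.exp (Complex.I * ξ * Γ i)) l
      (𝓝 (charFun ρ ξ * Complex.exp (-levyExponent 0 (σ2 * d) M' ξ))) := fun ξ => by
    refine ((hlim ξ).mul ((Complex.continuous_exp.tendsto _).comp (hψlim ξ).neg)).congr fun i => ?_
    rw [Function.comp_apply, ← Complex.exp_add, hψ]
    congr 1
    ring
  obtain ⟨Γ', hΓ', hχ⟩ := exists_tendsto_of_tendsto_exp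
    (continuous_charFun.mul (Complex.continuous_exp.comp (continuous_levyExponent hM'int).neg))
    (by simp [levyExponent_zero]) hΓlim
  refine ⟨Γ', σ2 * d, M', ⟨by positivity, hM'0, hM'fin, fun ξ => ?_⟩, fun t ht => ?_⟩
  · have h1 : charFun ρ ξ * Complex.exp (-levyExponent 0 (σ2 * d) M' ξ)
        = Complex.exp (Complex.I * ξ * Γ') := hχ ξ
    rw [Complex.exp_neg, mul_inv_eq_iff_eq_mul₀ (Complex.exp_ne_zero _), ← Complex.exp_add] at h1
    rw [h1]
    congr 1
    simp only [levyExponent, levyIntegrand]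
    push_cast
    ring
  · have hfprod : Integrable (fun p : T × ℝ => freeIntegrand t (c p.1 * p.2)) (ν.prod M) :=
      hint (hf t) (norm_freeIntegrand_le ht.ne')
    rw [levyVoiculescu_I_mul (by positivity) hM'0 hM'int ht.ne',
      integral_scaledLevyMeasure hcm (hf t) (by simp [freeIntegrand])]
    have hΓC : Tendsto (fun i => (Γ i : ℂ)) l (𝓝 (Γ' : ℂ)) :=
      (Complex.continuous_ofReal.tendsto _).comp hΓ'
    have h1 := (hΓC.add (hDlim.const_mul (σ2 / (Complex.I * t) : ℂ))).add
      (tendsto_setIntegral_prod hA hfprod)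
    have h2 : ∀ i, ∫ s in A i, scaledVoiculescu γ σ2 M t (c s) ∂ν
        = Γ i + σ2 / (Complex.I * t) * (∫ s in A i, ((c s ^ 2 : ℝ) : ℂ) ∂ν)
          + ∫ s in A i, (∫ x, freeIntegrand t (c s * x) ∂M) ∂ν := fun i => by
      have hi3 : IntegrableOn (fun s => ∫ x, freeIntegrand t (c s * x) ∂M) (A i) ν :=
        hfprod.integral_prod_left.integrableOn
      have hi2 := (hsqC.integrableOn (s := A i)).const_mul (σ2 / (Complex.I * t) : ℂ)
      have hi12 : IntegrableOn (fun s => (scaledDrift γ M (c s) : ℂ)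
          + σ2 / (Complex.I * t) * ((c s ^ 2 : ℝ) : ℂ)) (A i) ν := (hdriftC i).add hi2
      have h3 : ∀ s, scaledVoiculescu γ σ2 M t (c s) = (scaledDrift γ M (c s) : ℂ)
          + σ2 / (Complex.I * t) * ((c s ^ 2 : ℝ) : ℂ) + ∫ x, freeIntegrand t (c s * x) ∂M := fun s => by
        rw [scaledVoiculescu]; push_cast; ring
      simp_rw [h3]
      rw [integral_add hi12 hi3, integral_add (hdriftC i) hi2, integral_const_mul,
        integral_complex_ofReal]
    simp_rw [h2]
    convert h1 using 2
    push_cast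
    ring

end

/-! ### The kernels of the transform formulas -/

/-- `cx [1/(1 + icx/t) - 1/(1 + x²)]`. -/
noncomputable def jumpKernel (t c x : ℝ) : ℂ :=
  c * x * (1 / (1 + Complex.I * (c * x) / t) - 1 / (1 + x ^ 2))

/-- `c (x - ic/t) / (1 + icx/t)`, the quotient of `jumpKernel` by `x²/(1+x²)`. -/
noncomputable def reducedKernel (t c x : ℝ) : ℂ :=
  c * ((x - Complex.I * c / t) / (1 + Complex.I * (c * x) / t))

lemma one_add_I_mul_mul_div_ne_zero (c x t : ℝ) : (1 + Complex.I * (c * x) / t : ℂ) ≠ 0 := by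
  have := one_add_I_mul_div_ne_zero (c * x) t
  push_cast at this
  exact this

lemma one_le_norm_one_add_I_mul (c x t : ℝ) : 1 ≤ ‖(1 + Complex.I * (c * x) / t : ℂ)‖ := by
  have h : (1 + Complex.I * (c * x) / t : ℂ) = 1 + ((c * x / t : ℝ) : ℂ) * Complex.I := by
    push_cast; ring
  refine le_trans ?_ (Complex.abs_re_le_norm _)
  rw [h, Complex.add_re, Complex.re_ofReal_mul]
  simp

lemma measurable_jumpKernel (t : ℝ) : Measurable fun p : ℝ × ℝ => jumpKernel t p.1 p.2 := by
  unfold jumpKernel; fun_prop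

lemma measurable_reducedKernel (t : ℝ) : Measurable fun p : ℝ × ℝ => reducedKernel t p.1 p.2 := by
  unfold reducedKernel; fun_prop

lemma mul_reducedKernel {t : ℝ} (c x : ℝ) :
    ((x ^ 2 / (1 + x ^ 2) : ℝ) : ℂ) * reducedKernel t c x = jumpKernel t c x := by
  have h1 := one_add_I_mul_mul_div_ne_zero c x t
  have h2 := one_add_sq_ne_zero x
  rw [reducedKernel, jumpKernel, div_sub_div _ _ h1 h2]
  push_cast
  rw [mul_div_assoc', div_mul_div_comm, mul_div_assoc']
  congr 1 <;> ring

/-- The denominator has real part 1 and imaginary part cx/t, so its modulus is at least both 1 and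
|cx|/|t|. -/
lemma norm_mul_div_le {t : ℝ} (ht : t ≠ 0) (c x : ℝ) :
    ‖(c * x * (1 / (1 + Complex.I * (c * x) / t)) : ℂ)‖ ≤ (1 + |t|) * min 1 |c * x| := by
  have h1 := one_le_norm_one_add_I_mul c x t
  have h0 : 0 < ‖(1 + Complex.I * (c * x) / t : ℂ)‖ := by linarith
  have h2 : ‖(c * x : ℂ)‖ = |c * x| := by
    rw [← Complex.ofReal_mul, Complex.norm_real, Real.norm_eq_abs]
  rw [norm_mul, norm_div, norm_one, h2, mul_one_div]
  rcases le_total 1 |c * x| with h | h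
  · rw [min_eq_left h, div_le_iff₀ h0]
    have h3 : |c * x| / |t| ≤ ‖(1 + Complex.I * (c * x) / t : ℂ)‖ := by
      have h : (1 + Complex.I * (c * x) / t : ℂ) = 1 + ((c * x / t : ℝ) : ℂ) * Complex.I := by
        push_cast; ring
      rw [← abs_div]
      refine le_trans ?_ (Complex.abs_im_le_norm _)
      rw [h, Complex.add_im, Complex.im_ofReal_mul]
      simp
    rw [div_le_iff₀ (abs_pos.2 ht)] at h3
    nlinarith [abs_nonneg t]
  · rw [min_eq_right h]
    refine (div_le_self (abs_nonneg _) h1).trans ?_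
    nlinarith [abs_nonneg t, abs_nonneg (c * x)]

/-- For |x| ≤ 1 the compensated kernel is O(x²), with coefficients c² and |c| that are integrable
along h. For |x| > 1 the terms are bounded separately, and the first one leaves precisely the
integrand of (∗). -/
lemma norm_jumpKernel_le {t : ℝ} (ht : t ≠ 0) (c x : ℝ) :
    ‖jumpKernel t c x‖ ≤ (c ^ 2 / |t| + |c|) * min 1 (x ^ 2)
      + {x : ℝ | 1 < |x|}.indicator (fun x => (1 + |t|) * min 1 |c * x|) x := by
  have hsq : x ^ 2 = |x| ^ 2 := (sq_abs x).symm
  by_cases hx : 1 < |x|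
  · rw [indicator_of_mem (by exact hx), min_eq_left (by rw [hsq]; nlinarith), mul_one]
    have h1 : ‖(c * x * (1 / (1 + x ^ 2)) : ℂ)‖ ≤ |c| := by
      have : (c * x * (1 / (1 + x ^ 2)) : ℂ) = ((c * (x / (1 + x ^ 2)) : ℝ) : ℂ) := by
        push_cast; ring
      rw [this, Complex.norm_real, Real.norm_eq_abs, abs_mul, abs_div,
        abs_of_pos (by positivity : 0 < 1 + x ^ 2), hsq]
      exact mul_le_of_le_one_right (abs_nonneg c)
        ((div_le_one (by positivity)).2 (by nlinarith))
    have h2 : 0 ≤ c ^ 2 / |t| := by positivity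
    rw [jumpKernel, mul_sub]
    linarith [norm_sub_le (c * x * (1 / (1 + Complex.I * (c * x) / t)) : ℂ)
      (c * x * (1 / (1 + x ^ 2)) : ℂ), norm_mul_div_le ht c x]
  · rw [indicator_of_notMem (by exact hx), add_zero]
    push Not at hx
    rw [min_eq_right (by rw [hsq]; nlinarith [abs_nonneg x]), ← mul_reducedKernel, reducedKernel,
      norm_mul, norm_mul, norm_div, Complex.norm_real, Complex.norm_real, Real.norm_eq_abs,
      Real.norm_eq_abs, abs_of_nonneg (by positivity : 0 ≤ x ^ 2 / (1 + x ^ 2))]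
    have h1 := one_le_norm_one_add_I_mul c x t
    have h2 : ‖(x - Complex.I * c / t : ℂ)‖ ≤ 1 + |c| / |t| := by
      refine (norm_sub_le _ _).trans ?_
      simp only [Complex.norm_real, Real.norm_eq_abs, norm_div, norm_mul, Complex.norm_I, one_mul]
      linarith
    have h3 : x ^ 2 / (1 + x ^ 2) ≤ x ^ 2 := div_le_self (by positivity) (by nlinarith [sq_nonneg x])
    have h4 : ‖(x - Complex.I * c / t : ℂ)‖ / ‖(1 + Complex.I * (c * x) / t : ℂ)‖
        ≤ 1 + |c| / |t| := (div_le_self (norm_nonneg _) h1).trans h2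
    calc _ ≤ x ^ 2 * (|c| * (1 + |c| / |t|)) := by gcongr
      _ = _ := by rw [← sq_abs c]; ring

lemma norm_reducedKernel_le {t c x : ℝ} (hx : |x| ≤ 1) :
    ‖reducedKernel t c x‖ ≤ |c| + c ^ 2 / |t| := by
  have h1 := one_le_norm_one_add_I_mul c x t
  have h2 : ‖(x - Complex.I * c / t : ℂ)‖ ≤ 1 + |c| / |t| := by
    refine (norm_sub_le _ _).trans ?_
    simp only [Complex.norm_real, Real.norm_eq_abs, norm_div, norm_mul, Complex.norm_I, one_mul]
    linarith
  rw [reducedKernel, norm_mul, norm_div, Complex.norm_real, Real.norm_eq_abs]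
  calc _ ≤ |c| * (1 + |c| / |t|) := by
        gcongr
        exact (div_le_self (norm_nonneg _) h1).trans h2
    _ = _ := by rw [← sq_abs c]; ring

lemma continuous_reducedKernel (t c : ℝ) : Continuous (reducedKernel t c) := by
  unfold reducedKernel
  exact continuous_const.mul (Continuous.div (by fun_prop) (by fun_prop)
    fun x => one_add_I_mul_mul_div_ne_zero c x t)

section

variable {T : Type*} [MeasurableSpace T] {ν : Measure T} {c : T → ℝ} {γ σ2 : ℝ} {M : Measure ℝ}

/-- This is where (∗) enters: it makes Fubini available for the merged kernel. -/
lemma integrable_jumpKernel_prod [SigmaFinite ν] [SigmaFinite M] (hc : Integrable c ν)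
    (hd : Integrable (fun s => c s ^ 2) ν) (hM : Integrable (fun x : ℝ => min 1 (x ^ 2)) M)
    (hlarge : ∫⁻ x in {x : ℝ | 1 < |x|}, ∫⁻ s, ENNReal.ofReal (min 1 |c s * x|) ∂ν ∂M < ∞)
    {t : ℝ} (ht : t ≠ 0) :
    Integrable (fun p : T × ℝ => jumpKernel t (c p.1) p.2) (ν.prod M) := by
  have hcm := hc.1.aemeasurable
  have hy := aemeasurable_mul_prod (M := M) hcm
  have hS : MeasurableSet {x : ℝ | 1 < |x|} := measurableSet_lt (by fun_prop) (by fun_prop)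
  have h1 : Integrable (fun p : T × ℝ => (c p.1 ^ 2 / |t| + |c p.1|) * min 1 (p.2 ^ 2))
      (ν.prod M) := ((hd.div_const |t|).add hc.abs).mul_prod hM
  have hm : AEMeasurable (fun p : T × ℝ => min 1 |c p.1 * p.2|) (ν.prod M) := by
    have : Measurable fun y : ℝ => min 1 |y| := by fun_prop
    exact this.comp_aemeasurable hy
  have hmi : AEMeasurable (fun p : T × ℝ => {x : ℝ | 1 < |x|}.indicator
      (fun x => min 1 |c p.1 * x|) p.2) (ν.prod M) :=
    hm.indicator (measurable_snd hS)
  have h2 : Integrable (fun p : T × ℝ => {x : ℝ | 1 < |x|}.indicator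
      (fun x => min 1 |c p.1 * x|) p.2) (ν.prod M) := by
    refine (lintegral_ofReal_ne_top_iff_integrable hmi.aestronglyMeasurable
      (ae_of_all _ fun p => indicator_nonneg (fun x _ => by positivity) _)).1 (ne_of_lt ?_)
    rw [lintegral_prod_symm _ hmi.ennreal_ofReal]
    refine lt_of_eq_of_lt ?_ hlarge
    rw [← lintegral_indicator hS]
    refine lintegral_congr fun x => ?_
    by_cases hx : x ∈ {x : ℝ | 1 < |x|}
    · simp only [indicator_of_mem hx]
    · simp only [indicator_of_notMem hx, ENNReal.ofReal_zero, lintegral_zero]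
  refine (h1.add (h2.const_mul (1 + |t|))).mono'
    ((measurable_jumpKernel t).comp_aemeasurable
      (hcm.comp_fst.prodMk measurable_snd.aemeasurable)).aestronglyMeasurable
    (ae_of_all _ fun p => (norm_jumpKernel_le ht (c p.1) p.2).trans (le_of_eq ?_))
  simp only [Pi.add_apply, indicator_apply]
  split_ifs <;> simp

lemma integral_scaledVoiculescu [SigmaFinite ν] [SigmaFinite M] (hc : Integrable c ν)
    (hd : Integrable (fun s => c s ^ 2) ν) (hM : Integrable (fun x : ℝ => min 1 (x ^ 2)) M)
    {t : ℝ} (ht : t ≠ 0)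
    (hJ : Integrable (fun p : T × ℝ => jumpKernel t (c p.1) p.2) (ν.prod M)) :
    Integrable (fun s => scaledVoiculescu γ σ2 M t (c s)) ν ∧
    ∫ s, scaledVoiculescu γ σ2 M t (c s) ∂ν
      = γ * (∫ s, c s ∂ν : ℝ) + σ2 / (Complex.I * t) * (∫ s, c s ^ 2 ∂ν : ℝ)
        + ∫ x, (∫ s, jumpKernel t (c s) x ∂ν) ∂M := by
  have h1 : Integrable (fun s => (γ : ℂ) * (c s : ℂ)) ν := hc.ofReal.const_mul _
  have h2 : Integrable (fun s => σ2 / (Complex.I * t) * ((c s ^ 2 : ℝ) : ℂ)) ν :=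
    hd.ofReal.const_mul _
  have h12 : Integrable (fun s => (γ : ℂ) * (c s : ℂ)
      + σ2 / (Complex.I * t) * ((c s ^ 2 : ℝ) : ℂ)) ν := h1.add h2
  have h3 : Integrable (fun s => ∫ x, jumpKernel t (c s) x ∂M) ν := hJ.integral_prod_left
  have he : ∀ s, scaledVoiculescu γ σ2 M t (c s) = (γ : ℂ) * (c s : ℂ)
      + σ2 / (Complex.I * t) * ((c s ^ 2 : ℝ) : ℂ) + ∫ x, jumpKernel t (c s) x ∂M := fun s => by
    rw [scaledVoiculescu_eq hM ht]
    simp only [jumpKernel]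
    push_cast
    ring
  simp_rw [he]
  refine ⟨h12.add h3, ?_⟩
  rw [integral_add h12 h3, integral_add h1 h2, integral_const_mul, integral_const_mul,
    integral_complex_ofReal, integral_complex_ofReal, integral_integral_swap hJ]

/-- On a finite measure space (∗) is not needed: kept unmerged, the shift, Gaussian and jump parts
each grow at most like 1 + c². -/
lemma integrableOn_scaledVoiculescu [SFinite M] (hc : MemLp c 2 ν)
    (hM : Integrable (fun x : ℝ => min 1 (x ^ 2)) M) {t : ℝ} (ht : t ≠ 0) [IsFiniteMeasure ν] :
    Integrable (fun s => scaledVoiculescu γ σ2 M t (c s)) ν := by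
  have hcm := hc.1.aemeasurable
  have hsq := hc.integrable_sq
  have h1 : Integrable (fun s => ((scaledDrift γ M (c s) : ℝ) : ℂ)) ν :=
    Integrable.ofReal <| (((integrable_const 1).add hsq).const_mul
      (|γ| + ∫ x : ℝ, min 1 (x ^ 2) ∂M)).mono'
      (measurable_scaledDrift.comp_aemeasurable hcm).aestronglyMeasurable
      (ae_of_all _ fun s => abs_scaledDrift_le hM (c s))
  have h2 : Integrable (fun s => σ2 / (Complex.I * t) * ((c s ^ 2 : ℝ) : ℂ)) ν :=
    hsq.ofReal.const_mul _
  have hm : Measurable fun a : ℝ => ∫ x, freeIntegrand t (a * x) ∂M :=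
    ((measurable_freeIntegrand.comp (by fun_prop :
      Measurable fun p : ℝ × ℝ => (t, p.1 * p.2))).stronglyMeasurable.integral_prod_right
        (f := fun a x => freeIntegrand t (a * x)) (ν := M)).measurable
  have h3 : Integrable (fun s => ∫ x, freeIntegrand t (c s * x) ∂M) ν := by
    refine (((integrable_const 1).add hsq).const_mul
      (|t| * (1 / t ^ 2 + 2) * ∫ x : ℝ, min 1 (x ^ 2) ∂M)).mono'
      (hm.comp_aemeasurable hcm).aestronglyMeasurable (ae_of_all _ fun s => ?_)
    refine (norm_integral_le_of_norm_le (hM.const_mul (|t| * (1 / t ^ 2 + 2) * (1 + c s ^ 2)))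
      (ae_of_all _ fun x => (norm_freeIntegrand_le ht _).trans ?_)).trans (le_of_eq ?_)
    · rw [mul_assoc _ (1 + c s ^ 2)]
      gcongr
      exact min_one_mul_sq_le (c s) x
    · rw [integral_const_mul]
      simp only [Pi.add_apply]
      ring
  refine ((h1.add h2).add h3).congr (ae_of_all _ fun s => ?_)
  simp only [Pi.add_apply, scaledVoiculescu]
  push_cast
  ring

end

/-! ### The kernels of the theorem as integrals against `|dr|`. -/

namespace TimeChange

variable {a b : EReal} (r : TimeChange a b) {h : timeSet a b → ℝ}

lemma constC_eq : r.constC h = ∫ s, r.sign * h s ∂r.absMeasure := by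
  rw [constC, TimeChange.integral, smul_eq_mul, integral_const_mul]

lemma sign_mul_constD_eq : r.sign * r.constD h = ∫ s, (r.sign * h s) ^ 2 ∂r.absMeasure := by
  simp_rw [mul_pow, r.sign_sq, one_mul]
  rw [constD, TimeChange.integral, smul_eq_mul, ← mul_assoc, r.sign_mul_self, one_mul]

lemma ofReal_sign_mul_self : (r.sign : ℂ) * r.sign = 1 := by
  exact_mod_cast r.sign_mul_self

/-- As (±1)² = 1, h/(zh ± 1) = (±h)/(1 + z(±h)); all signs are absorbed into c = ±h, so both
monotonicity cases become one. -/
lemma levyKernel_eq (hc : Integrable h r.absMeasure) (t x : ℝ) :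
    r.levyKernel h t x = ∫ s, jumpKernel t (r.sign * h s) x ∂r.absMeasure := by
  have hε := r.ofReal_sign_mul_self
  have hc' : Integrable (fun s => ((r.sign * h s : ℝ) : ℂ)) r.absMeasure :=
    (hc.const_mul r.sign).ofReal
  have h1 : ∀ s, (h s : ℂ) / (Complex.I * x / t * h s + r.sign)
      = ((r.sign * h s : ℝ) : ℂ) * (1 / (1 + Complex.I * ((r.sign * h s : ℝ) * x) / t)) := fun s => by
    have hne := one_add_I_mul_mul_div_ne_zero (r.sign * h s) x t
    have he : Complex.I * x / t * h s + r.sign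
        = r.sign * (1 + Complex.I * ((r.sign * h s : ℝ) * x) / t) := by
      push_cast
      linear_combination (-(Complex.I * x / t * h s)) * hε
    have hs : (r.sign : ℂ) ≠ 0 := by exact_mod_cast r.sign_ne_zero
    rw [he, mul_one_div, div_eq_div_iff (mul_ne_zero hs hne) hne]
    push_cast
    linear_combination (-(h s : ℂ) * (1 + Complex.I * (r.sign * h s * x) / t)) * hε
  have hi : Integrable (fun s => ((r.sign * h s : ℝ) : ℂ)
      * (1 / (1 + Complex.I * ((r.sign * h s : ℝ) * x) / t))) r.absMeasure := by
    have hm : Measurable fun c : ℝ => (c : ℂ) * (1 / (1 + Complex.I * (c * x) / t)) := by fun_prop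
    refine hc'.norm.mono' (hm.comp_aemeasurable
      (hc.1.aemeasurable.const_mul r.sign)).aestronglyMeasurable (ae_of_all _ fun s => ?_)
    rw [norm_mul, norm_div, norm_one]
    exact mul_le_of_le_one_right (norm_nonneg _)
      (div_le_self zero_le_one (one_le_norm_one_add_I_mul _ _ _))
  have h2 : ∀ s, jumpKernel t (r.sign * h s) x = x * (((r.sign * h s : ℝ) : ℂ)
      * (1 / (1 + Complex.I * ((r.sign * h s : ℝ) * x) / t)))
      - x / (1 + x ^ 2) * ((r.sign * h s : ℝ) : ℂ) := fun s => by
    rw [jumpKernel]; ring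
  simp_rw [h2]
  rw [integral_sub (hi.const_mul _) (hc'.const_mul _), integral_const_mul, integral_const_mul,
    integral_complex_ofReal, ← r.constC_eq, levyKernel, kernelG, TimeChange.integral,
    Complex.real_smul]
  simp_rw [h1]
  linear_combination (x * (∫ s, ((r.sign * h s : ℝ) : ℂ)
      * (1 / (1 + Complex.I * ((r.sign * h s : ℝ) * x) / t)) ∂r.absMeasure)
      - x * (r.constC h) / (1 + x ^ 2)) * hε

/-- A single formula, with integrand continuous in x, covers the separately defined value at 0;
dominated convergence then shows that this value is the limit. -/
lemma finiteKernel_eq (hc : Integrable h r.absMeasure) (t x : ℝ) :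
    r.finiteKernel h t x = ∫ s, reducedKernel t (r.sign * h s) x ∂r.absMeasure := by
  rcases eq_or_ne x 0 with rfl | hx
  · have h1 : ∀ s, reducedKernel t (r.sign * h s) 0
        = 1 / (Complex.I * t) * (((r.sign * h s) ^ 2 : ℝ) : ℂ) := fun s => by
      rw [reducedKernel, one_div, mul_inv, Complex.inv_I]
      push_cast
      simp
      ring
    simp_rw [h1]
    rw [integral_const_mul, integral_complex_ofReal, ← r.sign_mul_constD_eq, finiteKernel,
      if_pos rfl]
    push_cast
    ring
  · have h0 : ((x ^ 2 / (1 + x ^ 2) : ℝ) : ℂ) ≠ 0 := by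
      have : x ^ 2 / (1 + x ^ 2) ≠ 0 := by positivity
      exact_mod_cast this
    have hxC : (x : ℂ) ≠ 0 := by exact_mod_cast hx
    refine mul_left_cancel₀ h0 ?_
    rw [← integral_const_mul]
    simp_rw [mul_reducedKernel]
    rw [← r.levyKernel_eq hc, finiteKernel, if_neg hx, levyKernel]
    have h2 := one_add_sq_ne_zero x
    push_cast
    field_simp

lemma mul_finiteKernel (hc : Integrable h r.absMeasure) (t x : ℝ) :
    ((x ^ 2 / (1 + x ^ 2) : ℝ) : ℂ) * r.finiteKernel h t x = r.levyKernel h t x := by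
  rw [r.finiteKernel_eq hc, r.levyKernel_eq hc, ← integral_const_mul]
  simp_rw [mul_reducedKernel]

lemma continuousAt_finiteKernel (hc : Integrable h r.absMeasure)
    (hd : Integrable (fun s => h s ^ 2) r.absMeasure) (t : ℝ) :
    ContinuousAt (r.finiteKernel h t) 0 := by
  rw [funext (r.finiteKernel_eq hc t)]
  refine continuousAt_of_dominated (bound := fun s => |h s| + h s ^ 2 / |t|)
    (Eventually.of_forall fun x => ?_) ?_ (hc.abs.add (hd.div_const _))
    (ae_of_all _ fun s => (continuous_reducedKernel t _).continuousAt)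
  · have hm : Measurable fun c : ℝ => reducedKernel t c x :=
      (measurable_reducedKernel t).comp (by fun_prop : Measurable fun c : ℝ => (c, x))
    exact (hm.comp_aemeasurable (hc.1.aemeasurable.const_mul r.sign)).aestronglyMeasurable
  · filter_upwards [Metric.closedBall_mem_nhds (0 : ℝ) one_pos] with x hx
    refine ae_of_all _ fun s => (norm_reducedKernel_le (by simpa using hx)).trans (le_of_eq ?_)
    rw [abs_mul, r.abs_sign, mul_pow, r.sign_sq, one_mul, one_mul]

end TimeChange

/-! ### Images of a law under scaling -/

section

variable {μ : Measure ℝ} {γ σ2 : ℝ} {M : Measure ℝ} {c : ℝ}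

lemma HasLevyTriplet.map_mul (hμ : HasLevyTriplet μ γ σ2 M) (hc : c ≠ 0) :
    HasLevyTriplet (μ.map fun x => c * x) (scaledDrift γ M c) (σ2 * c ^ 2)
      (M.map fun x => c * x) where
  sigma_nonneg := mul_nonneg hμ.sigma_nonneg (sq_nonneg c)
  levy_zero := by
    rw [Measure.map_apply (by fun_prop) (measurableSet_singleton 0)]
    convert hμ.levy_zero
    ext x
    simp [hc]
  levy_finite := by
    rw [lintegral_map (by fun_prop) (by fun_prop)]
    exact ((lintegral_ofReal_ne_top_iff_integrable (by fun_prop)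
      (ae_of_all _ fun x => by positivity)).2
        (integrable_min_one_mul_sq hμ.integrable_min c)).lt_top
  charFun_eq ξ := by
    rw [charFun_map_mul, (isLogCharFun_levyExponent hμ).exp_eq,
      levyExponent_mul hμ.integrable_min,
      integral_map (by fun_prop) (by fun_prop)]
    simp only [levyIntegrand]
    push_cast
    congr 1
    ring

lemma HasLevyTriplet.levyVoiculescu_map_mul (hμ : HasLevyTriplet μ γ σ2 M) (hc : c ≠ 0) {t : ℝ}
    (ht : t ≠ 0) :
    levyVoiculescu (scaledDrift γ M c) (σ2 * c ^ 2) (M.map fun x => c * x) (Complex.I * t)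
      = scaledVoiculescu γ σ2 M t c := by
  have h := hμ.map_mul hc
  have hm : Measurable (freeIntegrand t) := measurable_freeIntegrand.comp measurable_prodMk_left
  rw [levyVoiculescu_I_mul h.sigma_nonneg h.levy_zero h.integrable_min ht,
    integral_map (by fun_prop) hm.aestronglyMeasurable, scaledVoiculescu]
  push_cast
  rfl

/-- Negative c is allowed: it/c then lies in the lower half-plane, where the explicit formula for V
persists. Nonincreasing r needs this case. -/
lemma HasLevyTriplet.mul_levyVoiculescu (hμ : HasLevyTriplet μ γ σ2 M) (hc : c ≠ 0) {t : ℝ}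
    (ht : t ≠ 0) :
    c * levyVoiculescu γ σ2 M (Complex.I * (t / c : ℝ)) = scaledVoiculescu γ σ2 M t c := by
  have hcC : (c : ℂ) ≠ 0 := by exact_mod_cast hc
  have htC : (t : ℂ) ≠ 0 := by exact_mod_cast ht
  rw [levyVoiculescu_I_mul hμ.sigma_nonneg hμ.levy_zero hμ.integrable_min (div_ne_zero ht hc),
    scaledVoiculescu_eq hμ.integrable_min ht, mul_add, mul_add, ← integral_const_mul]
  congr 1
  · push_cast
    field_simp
  · refine integral_congr_ae (ae_of_all _ fun x => ?_)
    simp only [freeIntegrand]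
    push_cast
    rw [div_div_eq_mul_div]
    ring_nf

end

/-! ### Proof of the theorem. -/

instance timeSet_noMinOrder (a b : EReal) : NoMinOrder (timeSet a b) where
  exists_lt s := by
    obtain ⟨x, hx1, hx2⟩ := EReal.lt_iff_exists_real_btwn.1 s.2.1
    exact ⟨⟨x, hx1, hx2.le.trans s.2.2⟩, EReal.coe_lt_coe_iff.1 hx2⟩

/-- The intervals (p,q] omit p, so exhausting (a,b] as p ↓ a requires that it has no least point. -/
lemma TimeChange.aecover_Ioc {a b : EReal} (r : TimeChange a b) :
    AECover r.absMeasure (atBot ×ˢ atTop)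
      fun pq : timeSet a b × timeSet a b => Ioc pq.1 pq.2 :=
  MeasureTheory.aecover_Ioc tendsto_fst tendsto_snd

theorem theorem1
    {Ω : Type*} [MeasurableSpace Ω] (P : Measure Ω) [IsProbabilityMeasure P]
    (a b : EReal) (hab : a < b)
    (r : TimeChange a b) (h : timeSet a b → ℝ)
    (hc : Integrable h r.absMeasure)
    (hd : Integrable (fun s => h s ^ 2) r.absMeasure)
    (μ : Measure ℝ) (γ σ2 : ℝ) (M : Measure ℝ) (hμ : HasLevyTriplet μ γ σ2 M)
    (Y : ℝ≥0 → Ω → ℝ) (hY : IsLevyProcess Y P) (hY1 : HasLaw (Y 1) μ P)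
    (X : Ω → ℝ) (hX : IsRandomIntegral P Y r h X)
    (ρ : Measure ℝ) (hρ : HasLaw X ρ P) :
    ∃ (ρ' : Measure ℝ) (V : ℂ → ℂ), IsFreeCounterpart ρ ρ' V ∧
      -- the formula in terms of the Lévy measure
      (r.LargeJumpsConverge h M → ∀ t : ℝ, 0 < t →
        Integrable (r.levyKernel h t) M ∧
        V (Complex.I * t) = γ * r.constC h + r.sign * (σ2 / (Complex.I * t)) * r.constD h +
          ∫ x, r.levyKernel h t x ∂M) ∧
      -- the formula in terms of the finite measure `m`
      IsFiniteMeasure (khintchineMeasure σ2 M) ∧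
      (∀ t : ℝ, 0 < t → ContinuousAt (r.finiteKernel h t) 0) ∧
      (r.LargeJumpsConverge h M → ∀ t : ℝ, 0 < t →
        Integrable (r.finiteKernel h t) (khintchineMeasure σ2 M) ∧
        V (Complex.I * t) = γ * r.constC h +
          ∫ x, r.finiteKernel h t x ∂(khintchineMeasure σ2 M)) ∧
      -- the relation with the background driving measure, for positive `h`
      ((∀ s, 0 < h s) →
        ∃ (μ' : Measure ℝ) (Vμ : ℂ → ℂ) (τ : timeSet a b → Measure ℝ)
          (W : timeSet a b → ℂ → ℂ),
          IsFreeCounterpart μ μ' Vμ ∧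
          (∀ s, IsFreeCounterpart (μ.map fun x => r.sign * h s * x) (τ s) (W s)) ∧
          ∀ t : ℝ, 0 < t →
            r.HasImproperIntegral (fun s => h s * Vμ (r.sign * (Complex.I * t) / h s))
              (V (Complex.I * t)) ∧
            r.HasImproperIntegral (fun s => r.sign * W s (Complex.I * t)) (V (Complex.I * t)) ∧
            (r.LargeJumpsConverge h M →
              Integrable (fun s => h s * Vμ (r.sign * (Complex.I * t) / h s)) r.absMeasure ∧
              Integrable (fun s => W s (Complex.I * t)) r.absMeasure)) := by
  have := nonempty_timeSet hab
  have hM := hμ.integrable_min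
  have := sigmaFinite_of_integrable_min hμ.levy_zero hM
  have hε := r.ofReal_sign_mul_self
  have hh : MemLp h 2 r.absMeasure := (memLp_two_iff_integrable_sq hc.1).2 hd
  have hεh : MemLp (fun s => r.sign * h s) 2 r.absMeasure := hh.const_mul r.sign
  have hεc : Integrable (fun s => r.sign * h s) r.absMeasure := hc.const_mul r.sign
  have hεd : Integrable (fun s => (r.sign * h s) ^ 2) r.absMeasure := hεh.integrable_sq
  have hρP : IsProbabilityMeasure ρ := hρ.map_eq ▸ Measure.isProbabilityMeasure_map hρ.aemeasurable
  have hlim := fun ξ => hX.tendsto_charFun hab hY hY1 (isLogCharFun_levyExponent hμ)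
    levyConst_nonneg (norm_levyExponent_le hM) hh ξ
  rw [hρ.map_eq] at hlim
  obtain ⟨Γ, σ', M', hρ', hV⟩ := exists_hasLevyTriplet_of_tendsto hεh hμ.sigma_nonneg hM
    r.aecover_Ioc (fun pq => r.absMeasure_Ioc_lt_top _ _) hlim
  obtain ⟨ρ', hfree⟩ := hρ'.exists_isFreeCounterpart
  have hJ : r.LargeJumpsConverge h M → ∀ t : ℝ, 0 < t →
      Integrable (fun p : timeSet a b × ℝ => jumpKernel t (r.sign * h p.1) p.2)
        (r.absMeasure.prod M) := fun hL t ht =>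
    integrable_jumpKernel_prod hεc hεd hM (by
      simpa only [TimeChange.LargeJumpsConverge, abs_mul, r.abs_sign, one_mul] using hL) ht.ne'
  have hlevy : r.LargeJumpsConverge h M → ∀ t : ℝ, 0 < t →
      Integrable (r.levyKernel h t) M ∧
      levyVoiculescu Γ σ' M' (Complex.I * t) = γ * r.constC h
        + r.sign * (σ2 / (Complex.I * t)) * r.constD h + ∫ x, r.levyKernel h t x ∂M :=
    fun hL t ht => by
      obtain ⟨h1, h2⟩ := integral_scaledVoiculescu (γ := γ) (σ2 := σ2) hεc hεd hM ht.ne'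
        (hJ hL t ht)
      -- Under (∗) the integrand is integrable on all of (a,b], so the improper limit is the full
      -- integral.
      have h3 := tendsto_nhds_unique (hV t ht)
        (r.aecover_Ioc.integral_tendsto_of_countably_generated h1)
      rw [h2, ← r.constC_eq, ← r.sign_mul_constD_eq] at h3
      simp_rw [← r.levyKernel_eq hc] at h3
      refine ⟨(hJ hL t ht).integral_prod_right.congr
        (ae_of_all _ fun x => (r.levyKernel_eq hc t x).symm), h3.trans ?_⟩
      push_cast
      ring
  refine ⟨ρ', levyVoiculescu Γ σ' M', hfree, hlevy,
    isFiniteMeasure_khintchineMeasure hμ.levy_finite,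
    fun t _ => r.continuousAt_finiteKernel hc hd t, fun hL t ht => ?_, fun hpos => ?_⟩
  · obtain ⟨h1, h2⟩ := hlevy hL t ht
    have h3 : Integrable (fun x => ((x ^ 2 / (1 + x ^ 2) : ℝ) : ℂ) * r.finiteKernel h t x) M := by
      simpa only [r.mul_finiteKernel hc] using h1
    refine ⟨integrable_khintchineMeasure hμ.levy_zero h3, ?_⟩
    rw [integral_khintchineMeasure hμ.sigma_nonneg hμ.levy_zero h3, h2]
    simp only [r.mul_finiteKernel hc]
    rw [TimeChange.finiteKernel, if_pos rfl]
    ring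
  · have hne : ∀ s, r.sign * h s ≠ 0 := fun s => mul_ne_zero r.sign_ne_zero (hpos s).ne'
    obtain ⟨μ', hμ'⟩ := hμ.exists_isFreeCounterpart
    choose τ hτ using fun s => (hμ.map_mul (hne s)).exists_isFreeCounterpart
    -- Rests on ±it/h = it/(±h): the scaling identity is used at c = ±h, and h = ±c produces the
    -- outer sign.
    have hVμ : ∀ t : ℝ, 0 < t → ∀ s,
        h s * levyVoiculescu γ σ2 M (r.sign * (Complex.I * t) / h s)
          = r.sign * scaledVoiculescu γ σ2 M t (r.sign * h s) := fun t ht s => by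
      have hs : (h s : ℂ) ≠ 0 := by exact_mod_cast (hpos s).ne'
      have hsg : (r.sign : ℂ) ≠ 0 := by exact_mod_cast r.sign_ne_zero
      have h1 : (r.sign * (Complex.I * t) / h s : ℂ)
          = Complex.I * ((t / (r.sign * h s) : ℝ) : ℂ) := by
        push_cast
        field_simp
        linear_combination (t : ℂ) * hε
      rw [h1, ← hμ.mul_levyVoiculescu (hne s) ht.ne']
      push_cast
      linear_combination (-(h s : ℂ) * levyVoiculescu γ σ2 M
        (Complex.I * (t / (r.sign * h s)))) * hε
    have hW : ∀ t : ℝ, 0 < t → ∀ s, levyVoiculescu (scaledDrift γ M (r.sign * h s))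
        (σ2 * (r.sign * h s) ^ 2) (M.map fun x => r.sign * h s * x) (Complex.I * t)
          = scaledVoiculescu γ σ2 M t (r.sign * h s) := fun t ht s =>
      hμ.levyVoiculescu_map_mul (hne s) ht.ne'
    refine ⟨μ', _, τ, _, hμ', hτ, fun t ht => ?_⟩
    -- The sign in front of the integrand cancels the one in dr = ±|dr|.
    have himp : r.HasImproperIntegral
        (fun s => r.sign * scaledVoiculescu γ σ2 M t (r.sign * h s))
        (levyVoiculescu Γ σ' M' (Complex.I * t)) := by
      refine ⟨fun p q => (integrableOn_scaledVoiculescu (hεh.restrict _) hM ht.ne').const_mul _,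
        (hV t ht).congr fun pq => ?_⟩
      rw [integral_const_mul, Complex.real_smul, ← mul_assoc, hε, one_mul]
    simp_rw [hVμ t ht, hW t ht]
    refine ⟨himp, himp, fun hL => ?_⟩
    have h1 := (integral_scaledVoiculescu (γ := γ) (σ2 := σ2) hεc hεd hM ht.ne' (hJ hL t ht)).1
    exact ⟨h1.const_mul _, h1⟩
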